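/- Let $\mathbb S^2=\{x\in\mathbb R^3:\|x\|=1\}$ with spherical distance $d_s(x,y)=\arccos\langle x,y\rangle$, let $c\in\mathbb S^2$, and let $S=\{x: d_s(x,c)<\pi/2\}$ be the open hemisphere centred at $c$. A set $K\subset\mathbb S^2$ is (spherically) convex if it lies in an open hemisphere and contains, with any two of its points, the shorter great-circle arc joining them. A convex disk is a compact convex set with nonempty interior. Its area is its two-dimensional Hausdorff measure. It is $c$-symmetric if it is invariant under the point reflection $x\mapsto 2\langle x,c\rangle c-x$. Let $\bar L,\bar H$ be orthogonal great circles meeting at $c$, and let $L=\bar L\cap S$, $H=\bar H\cap S$, so $L\cap H=\{c\}$. The distance curves with axis $L$ are the sets $C_\theta$ ($-\pi/2<\theta<\pi/2$) of the points of $S$ at signed spherical distance $\theta$ from $L$. Let $X\subset S$ be compact and such that $X\cap C$ is connected (possibly empty) for every distance curve $C$ with axis $L$. The Steiner symmetral $\sigma_{L,H}(X)$ is the subset of $S$ such that, for every distance curve $C$ with axis $L$: $\sigma_{L,H}(X)\cap C=\emptyset$ if $X\cap C=\emptyset$; $\sigma_{L,H}(X)\cap C=C\cap H$ if $X\cap C$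 is a single point; and, if $X\cap C$ is a closed circular arc, $\sigma_{L,H}(X)\cap C$ is the closed arc of $C$ of the same length whose midpoint is $C\cap H$. Theorem. Let $K\subset S$ be a $c$-symmetric convex disk, and let $\mathcal F_K$ be the family of $c$-symmetric convex disks contained in $S$ that can be obtained from $K$ by finitely many subsequent Steiner symmetrizations $\sigma_{L,H}$ with $L\cap H=\{c\}$, where the pair $(L,H)$ may change from step to step. Then there is exactly one $r\in(0,\pi)$ such that the spherical cap $D_c(K)=\{x\in\mathbb S^2: d_s(x,c)\le r\}$ has the same area as $K$, and there is a sequence $(K_m)_{m\ge1}$ of elements of $\mathcal F_K$ that converges to $D_c(K)$ in the Hausdorff metric (with respect to $d_s$). -/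

import Mathlib

open scoped MeasureTheory

noncomputable section

/-- The unit sphere of Euclidean `3`-space, with the topology it inherits. -/
abbrev Sph2 : Type := Metric.sphere (0 : EuclideanSpace ℝ (Fin 3)) 1

namespace Sph2

/-- The inner product of two points of the sphere, as vectors of `ℝ³`. -/
def ip (x y : Sph2) : ℝ :=
  inner ℝ (x : EuclideanSpace ℝ (Fin 3)) (y : EuclideanSpace ℝ (Fin 3))

/-- Spherical distance. -/
def sdist (x y : Sph2) : ℝ := Real.arccos (ip x y)

/-- The open hemisphere with centre `c`. -/
def hemisphere (c : Sph2) : Set Sph2 := {x | sdist x c < Real.pi / 2}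

/-- The closed spherical ball (spherical cap) with centre `c` and radius `r`. -/
def cap (c : Sph2) (r : ℝ) : Set Sph2 := {x | sdist x c ≤ r}

/-- For distinct, non-antipodal `x`, `y`: the shorter arc with endpoints `x`, `y` of the great
circle through `x` and `y`, that is, the points of the sphere in the cone spanned by `x`, `y`. -/
def segment (x y : Sph2) : Set Sph2 :=
  {z | ∃ a b : ℝ, 0 ≤ a ∧ 0 ≤ b ∧
    (z : EuclideanSpace ℝ (Fin 3)) =
      a • (x : EuclideanSpace ℝ (Fin 3)) + b • (y : EuclideanSpace ℝ (Fin 3))}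

/-- Spherical convexity: contained in an open hemisphere and closed under taking segments. -/
def IsSConvex (K : Set Sph2) : Prop :=
  (∃ c : Sph2, K ⊆ hemisphere c) ∧ ∀ x ∈ K, ∀ y ∈ K, segment x y ⊆ K

/-- A convex disk: a compact, spherically convex set with nonempty interior in the sphere. -/
def IsConvexDisk (K : Set Sph2) : Prop :=
  IsCompact K ∧ IsSConvex K ∧ (interior K).Nonempty

/-- The point reflection of the sphere about `c` sends `x` to `2⟨x, c⟩c - x`; the set `K` is
`c`-symmetric if it contains the reflected copy of each of its points. -/
def IsSymmAbout (c : Sph2) (K : Set Sph2) : Prop :=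
  ∀ x ∈ K, ∀ y : Sph2,
    (y : EuclideanSpace ℝ (Fin 3)) =
      (2 * ip x c) • (c : EuclideanSpace ℝ (Fin 3)) - (x : EuclideanSpace ℝ (Fin 3)) → y ∈ K

/-- The `c`-symmetric convex disks contained in the open hemisphere centred at `c`. -/
def IsSymmConvexDisk (c : Sph2) (K : Set Sph2) : Prop :=
  K ⊆ hemisphere c ∧ IsConvexDisk K ∧ IsSymmAbout c K

/-- Spherical area: the two-dimensional Hausdorff measure. -/
def area (K : Set Sph2) : ENNReal := μHE[2] K

/-- The Hausdorff distance of two nonempty subsets of the sphere, with respect to the spherical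
distance. -/
def hausdorffSDist (K M : Set Sph2) : ℝ :=
  sInf {r : ℝ | 0 ≤ r ∧ (∀ x ∈ K, ∃ y ∈ M, sdist x y ≤ r) ∧ ∀ y ∈ M, ∃ x ∈ K, sdist x y ≤ r}

/-- A pair `L`, `H` of orthogonal lines (open great half circles in the hemisphere `S` centred
at `c`) meeting at `c`. The pair is given by unit vectors `u`, `p` that form an orthonormal basis
of `ℝ³` together with `c`: the line `L` lies in the plane of `c` and `u`, and `H` in the plane of
`c` and `p`. The vectors `p` and `-p` are the poles. -/
structure Axes (c : Sph2) where
  u : Sph2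
  p : Sph2
  ip_c_u : ip c u = 0
  ip_c_p : ip c p = 0
  ip_u_p : ip u p = 0

namespace Axes

variable {c : Sph2} (A : Axes c)

/-- The axis `L`. -/
def L : Set Sph2 := {x | x ∈ hemisphere c ∧ ip x A.p = 0}

/-- The line `H` orthogonal to `L`. -/
def H : Set Sph2 := {x | x ∈ hemisphere c ∧ ip x A.u = 0}

/-- The signed spherical distance of `x` from `L`. -/
def lat (x : Sph2) : ℝ := Real.arcsin (ip x A.p)

/-- For `x` in the hemisphere, the signed spherical distance from `H` of the orthogonal projection
of `x` onto `L`. -/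
def lon (x : Sph2) : ℝ := Real.arctan (ip x A.u / ip x c)

/-- The distance curve with axis `L` and signed distance `t`, for `-π/2 < t < π/2`: a half
circle. -/
def distCurve (t : ℝ) : Set Sph2 := {x | x ∈ hemisphere c ∧ A.lat x = t}

/-- The closed arc of a distance curve with end points at the longitudes `a ≤ b`; it is a single
point if `a = b`. On a fixed distance curve the length of an arc is a fixed multiple of its angular
length `b - a`, and the curve meets `H` in its point of longitude `0`. -/
def arc (t a b : ℝ) : Set Sph2 := {x | x ∈ A.distCurve t ∧ a ≤ A.lon x ∧ A.lon x ≤ b}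

theorem distCurve_zero : A.distCurve 0 = A.L := by
  ext x
  simp [distCurve, L, lat, Real.arcsin_eq_zero_iff]

theorem arc_zero_zero (t : ℝ) : A.arc t 0 0 = A.distCurve t ∩ A.H := by
  ext x
  constructor
  · rintro ⟨hx, h1, h2⟩
    have h0 : A.lon x = 0 := le_antisymm h2 h1
    have hpos : 0 < ip x c := by
      have h := hx.1
      simpa [hemisphere, sdist, Real.arccos_lt_pi_div_two] using h
    refine ⟨hx, hx.1, ?_⟩
    rcases div_eq_zero_iff.mp (Real.arctan_eq_zero_iff.mp h0) with h | h
    · exact h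
    · exact absurd h hpos.ne'
  · rintro ⟨hx, -, h⟩
    have h0 : A.lon x = 0 := by simp [lon, h]
    exact ⟨hx, h0.ge, h0.le⟩

/-- The sets to which the symmetrization with respect to `(L, H)` applies: the compact subsets of
the hemisphere whose intersection with each distance curve with axis `L` is connected
(possibly empty). -/
def Applicable (X : Set Sph2) : Prop :=
  X ⊆ hemisphere c ∧ IsCompact X ∧
    ∀ t ∈ Set.Ioo (-(Real.pi / 2)) (Real.pi / 2), IsPreconnected (X ∩ A.distCurve t)

/-- The Steiner symmetral of `X` with respect to `(L, H)`. On each distance curve `C` that meets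
`X`, the arc (or single point) `X ∩ C` is replaced by the arc of `C` of the same length whose
midpoint is on `H`; on the other distance curves there is nothing. -/
def steiner (X : Set Sph2) : Set Sph2 :=
  {y | y ∈ hemisphere c ∧
    ∃ a b : ℝ, -(Real.pi / 2) < a ∧ a ≤ b ∧ b < Real.pi / 2 ∧
      X ∩ A.distCurve (A.lat y) = A.arc (A.lat y) a b ∧
      y ∈ A.arc (A.lat y) (-((b - a) / 2)) ((b - a) / 2)}

end Axes

/-- `Obtainable c K X`: the set `X` is obtained from `K` by finitely many subsequent Steiner
symmetrizations with respect to pairs of orthogonal lines meeting at `c`, each of which is applied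
to a set in its domain. -/
inductive Obtainable (c : Sph2) (K : Set Sph2) : Set Sph2 → Prop
  | base : Obtainable c K K
  | step (X : Set Sph2) (A : Axes c) :
      Obtainable c K X → A.Applicable X → Obtainable c K (A.steiner X)

end Sph2

end

/-! ### Symmetric cones and their fibres. -/

noncomputable section

open Real Set

/-! Let `D` be the cap about `c` with the area of `K`. Among the bodies reached from `K`, maximise
the area of the intersection with `D`. All of them lie between two fixed caps about `c`, since
symmetrization respects inclusion in, and of, such caps. So a maximising sequence has a subsequence
with a Hausdorff limit `Z`; it is a symmetric convex disk with the area of `K`, and the area of `Z ∩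
D` is the supremum. If `Z ≠ D`, both differences have interior points `x` and `y`. A pole orthogonal
to `c` and to `x - y` puts `x`, `y` on one distance curve, and symmetrization then strictly enlarges
the overlap of `Z` with `D` (`area_inter_lt`). The limit `Z` need not be reachable, but
symmetrization never shrinks the overlap of two bodies (`area_inter_le`), so the symmetrals of the
approximating bodies fill up the symmetral of `Z` in area, and would eventually beat the supremum.
Hence `Z = D`, and the subsequence itself converges to `D`.

The geometric part is that symmetrals of symmetric convex disks are convex. A point is described by
a vector `(cos l, sin l, t)` of the cone, with `l` the longitude and `t` the tangent of the
latitude. By central symmetry the fibre at level `t` is the interval from `-R Q (-t)` to `R Q t`,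
and it is replaced by the centred interval of half width `hw Q t`. The half width decreases in `|t|`
(`hw_anti`) and the great-circle chord of a fibre lies in the body (`chord_above`); together they
make the symmetrised body closed under shrinking its gnomonic coordinates (`sym_shrink`). It remains
to find one further point on each descending chord in a quadrant (`exists_mem_segment`). In the main
case this follows from a determinant inequality for three right ends (`orient`), applied to the body
and to its mirror image at a level whose fibre midpoint is the mean of those of the two given
fibres, and added up (`exists_between`).

The area enters without a formula for its density. Rotations about the pole are isometries that keep
the latitude, so uniqueness of Haar measure on the circle splits the area into Lebesgue measure in
longitude and some finite measure in latitude (`exists_area_eq_lintegral`). Statements on areas then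
reduce to statements on the lengths of fibres. -/

/-- The cone over a compact convex set that lies in an open hemisphere and is symmetric about its
centre, in coordinates with the centre on the first axis. -/
structure SymCone (Q : ℝ → ℝ → ℝ → Prop) : Prop where
  pos : ∀ {w s t}, Q w s t → 0 < w
  add : ∀ {w s t w' s' t'}, Q w s t → Q w' s' t' → Q (w + w') (s + s') (t + t')
  smul : ∀ {r w s t}, 0 < r → Q w s t → Q (r * w) (r * s) (r * t)
  center : Q 1 0 0
  neg : ∀ {w s t}, Q w s t → Q w (-s) (-t)
  compact : IsCompact {q : ℝ × ℝ | Q 1 q.1 q.2}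

namespace SymCone

variable {Q : ℝ → ℝ → ℝ → Prop}

/-- The longitudes of the points at level `t`. -/
def fib (Q : ℝ → ℝ → ℝ → Prop) (t : ℝ) : Set ℝ :=
  {l | l ∈ Ioo (-(π / 2)) (π / 2) ∧ Q (cos l) (sin l) t}

/-- The largest longitude at level `t`. -/
def R (Q : ℝ → ℝ → ℝ → Prop) (t : ℝ) : ℝ := sSup (fib Q t)

/-- Half the width of the fibre at level `t` of a symmetric body. -/
def hw (Q : ℝ → ℝ → ℝ → Prop) (t : ℝ) : ℝ := (R Q t + R Q (-t)) / 2

/-- One of the coefficients may vanish here, which `add` and `smul` alone do not cover. -/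
theorem comb (hQ : SymCone Q) {a b w s t w' s' t' : ℝ} (ha : 0 ≤ a) (hb : 0 ≤ b) (hab : 0 < a + b)
    (h : Q w s t) (h' : Q w' s' t') :
    Q (a * w + b * w') (a * s + b * s') (a * t + b * t') := by
  rcases ha.eq_or_lt with rfl | ha
  · simpa using hQ.smul (by simpa using hab) h'
  rcases hb.eq_or_lt with rfl | hb
  · simpa using hQ.smul ha h
  exact hQ.add (hQ.smul ha h) (hQ.smul hb h')

/-- The axis of the cone belongs to it, so a multiple of `(1, 0, 0)` may be added. -/
theorem raise (hQ : SymCone Q) {w w' s t : ℝ} (h : Q w s t) (hw : w ≤ w') : Q w' s t := by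
  rcases hw.eq_or_lt with rfl | hw
  · exact h
  · have := hQ.add h (hQ.smul (sub_pos.2 hw) hQ.center)
    simpa using this

/-- The reflection exchanges left and right ends of fibres, so that results on right ends yield
results on left ends (`R_mirror`). -/
theorem mirror (hQ : SymCone Q) : SymCone (fun w s t => Q w (-s) t) where
  pos h := hQ.pos h
  add h h' := by
    have := hQ.add h h'
    rwa [← neg_add] at this
  smul hr h := by
    have := hQ.smul hr h
    rwa [mul_neg] at this
  center := by simpa using hQ.center
  neg h := hQ.neg h
  compact := by
    have := hQ.compact.image (f := fun q : ℝ × ℝ => (-q.1, q.2)) (by fun_prop)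
    convert this using 1
    ext ⟨x, y⟩
    constructor
    · intro h
      exact ⟨(-x, y), h, by simp⟩
    · rintro ⟨⟨x', y'⟩, h, he⟩
      simp only [Prod.mk.injEq] at he
      obtain ⟨rfl, rfl⟩ := he
      simpa using h

theorem mem_fib_neg (hQ : SymCone Q) {l t : ℝ} : -l ∈ fib Q (-t) ↔ l ∈ fib Q t := by
  simp only [fib, mem_ofPred_eq, cos_neg, sin_neg, mem_Ioo]
  constructor
  · rintro ⟨⟨h1, h2⟩, h⟩
    exact ⟨⟨by linarith, by linarith⟩, by simpa using hQ.neg h⟩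
  · rintro ⟨⟨h1, h2⟩, h⟩
    exact ⟨⟨by linarith, by linarith⟩, hQ.neg h⟩

theorem fib_neg (hQ : SymCone Q) (t : ℝ) : fib Q (-t) = (fun l => -l) '' fib Q t := by
  ext l
  constructor
  · intro h
    refine ⟨-l, ?_, neg_neg l⟩
    rw [← hQ.mem_fib_neg]
    simpa using h
  · rintro ⟨l, h, rfl⟩
    exact hQ.mem_fib_neg.2 h

theorem fib_neg_nonempty (hQ : SymCone Q) {t : ℝ} (h : (fib Q t).Nonempty) :
    (fib Q (-t)).Nonempty := by
  rw [hQ.fib_neg]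
  exact h.image _

theorem mem_fib_mirror (hQ : SymCone Q) {l t : ℝ} :
    l ∈ fib (fun w s t => Q w (-s) t) t ↔ l ∈ fib Q (-t) := by
  simp only [fib, mem_ofPred_eq]
  refine and_congr_right fun _ => ⟨fun h => ?_, fun h => ?_⟩
  · simpa using hQ.neg h
  · simpa using hQ.neg h

theorem R_mirror (hQ : SymCone Q) (t : ℝ) : R (fun w s t => Q w (-s) t) t = R Q (-t) := by
  unfold R
  congr 1
  ext l
  exact hQ.mem_fib_mirror

/-- The body in coordinates longitude and level. -/
theorem isCompact_graph (hQ : SymCone Q) : IsCompact {q : ℝ × ℝ | q.1 ∈ fib Q q.2} := by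
  have hc : Continuous (fun q : ℝ × ℝ => (arctan q.1, q.2 / √(1 + q.1 ^ 2))) := by
    refine Continuous.prodMk (continuous_arctan.comp continuous_fst) ?_
    refine Continuous.div (by fun_prop) (by fun_prop) fun q => ?_
    have : 0 < 1 + q.1 ^ 2 := by positivity
    positivity
  convert hQ.compact.image hc using 1
  ext ⟨l, t⟩
  constructor
  · rintro ⟨hl, h⟩
    have hcos : 0 < cos l := cos_pos_of_mem_Ioo hl
    have hsq : √(1 + tan l ^ 2) = (cos l)⁻¹ := by
      rw [← inv_sqrt_one_add_tan_sq hcos, inv_inv]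
    refine ⟨(tan l, t / cos l), ?_, ?_⟩
    · have := hQ.smul (inv_pos.2 hcos) h
      simpa [hcos.ne', tan_eq_sin_div_cos, div_eq_inv_mul] using this
    · simp only [Prod.mk.injEq]
      refine ⟨arctan_tan hl.1 hl.2, ?_⟩
      rw [hsq]
      field_simp
  · rintro ⟨⟨x, y⟩, h, he⟩
    simp only [Prod.mk.injEq] at he
    obtain ⟨rfl, rfl⟩ := he
    refine ⟨arctan_mem_Ioo x, ?_⟩
    have hp : 0 < √(1 + x ^ 2) := by positivity
    rw [cos_arctan, sin_arctan]
    have := hQ.smul (inv_pos.2 hp) h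
    simpa [div_eq_inv_mul] using this

theorem isCompact_fib (hQ : SymCone Q) (t : ℝ) : IsCompact (fib Q t) := by
  have h1 : IsCompact ({q : ℝ × ℝ | q.1 ∈ fib Q q.2} ∩ {q | q.2 = t}) :=
    hQ.isCompact_graph.inter_right (isClosed_eq continuous_snd continuous_const)
  convert h1.image continuous_fst using 1
  ext l
  constructor
  · intro h
    exact ⟨(l, t), ⟨h, rfl⟩, rfl⟩
  · rintro ⟨⟨l, t⟩, ⟨h, rfl⟩, rfl⟩
    exact h

theorem R_mem (hQ : SymCone Q) {t : ℝ} (h : (fib Q t).Nonempty) : R Q t ∈ fib Q t :=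
  (hQ.isCompact_fib t).sSup_mem h

theorem le_R (hQ : SymCone Q) {l t : ℝ} (h : l ∈ fib Q t) : l ≤ R Q t :=
  le_csSup (hQ.isCompact_fib t).bddAbove h

theorem neg_R_mem (hQ : SymCone Q) {t : ℝ} (h : (fib Q t).Nonempty) : -R Q (-t) ∈ fib Q t := by
  have := hQ.R_mem (hQ.fib_neg_nonempty h)
  rw [← hQ.mem_fib_neg]
  simpa using this

theorem neg_R_le (hQ : SymCone Q) {l t : ℝ} (h : l ∈ fib Q t) : -R Q (-t) ≤ l := by
  have := hQ.le_R (hQ.mem_fib_neg.2 h)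
  linarith

theorem hw_nonneg (hQ : SymCone Q) {t : ℝ} (h : (fib Q t).Nonempty) : 0 ≤ hw Q t := by
  have := hQ.le_R (hQ.neg_R_mem h)
  unfold hw
  linarith

theorem hw_neg (Q : ℝ → ℝ → ℝ → Prop) (t : ℝ) : hw Q (-t) = hw Q t := by
  simp [hw, add_comm]

theorem mem_Ioo_of_mem {l₁ l₂ l t t' : ℝ} (h₁ : l₁ ∈ fib Q t)
    (h₂ : l₂ ∈ fib Q t') (h : l₁ ≤ l) (h' : l ≤ l₂) : l ∈ Ioo (-(π / 2)) (π / 2) :=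
  ⟨h₁.1.1.trans_le h, h'.trans_lt h₂.1.2⟩

/-- In the coordinates `(sin l, t)` the body is convex. -/
theorem exists_comb (hQ : SymCone Q) {a b l₁ l₂ t₁ t₂ : ℝ} (ha : 0 ≤ a) (hb : 0 ≤ b)
    (hab : a + b = 1) (h₁ : l₁ ∈ fib Q t₁) (h₂ : l₂ ∈ fib Q t₂) :
    arcsin (a * sin l₁ + b * sin l₂) ∈ fib Q (a * t₁ + b * t₂) := by
  have c₁ := cos_pos_of_mem_Ioo h₁.1
  have c₂ := cos_pos_of_mem_Ioo h₂.1
  have e₁ := sin_sq_add_cos_sq l₁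
  have e₂ := sin_sq_add_cos_sq l₂
  set s := a * sin l₁ + b * sin l₂ with hs
  set w := a * cos l₁ + b * cos l₂ with hw
  have hQ' : Q w s (a * t₁ + b * t₂) := hQ.comb ha hb (by linarith) h₁.2 h₂.2
  have hwp : 0 < w := hQ.pos hQ'
  -- Both vectors project to the unit circle in the `(w, s)` plane, so the combination projects into
  -- the disk; `raise` moves it back to the circle without changing `s` and the level.
  have hsum : w ^ 2 + s ^ 2 ≤ 1 := by
    have hcs : cos l₁ * cos l₂ + sin l₁ * sin l₂ ≤ 1 := by
      rw [← cos_sub]; exact cos_le_one _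
    have hab0 := mul_nonneg ha hb
    have : w ^ 2 + s ^ 2 = a ^ 2 + b ^ 2 + 2 * (a * b) * (cos l₁ * cos l₂ + sin l₁ * sin l₂) := by
      rw [hw, hs]
      linear_combination a ^ 2 * e₁ + b ^ 2 * e₂
    have h1 : (a + b) ^ 2 = 1 := by rw [hab]; norm_num
    nlinarith
  have hs1 : s ^ 2 < 1 := by nlinarith
  have hs2 := abs_lt.1 ((sq_lt_one_iff_abs_lt_one s).1 hs1)
  have hI : arcsin s ∈ Ioo (-(π / 2)) (π / 2) :=
    ⟨neg_pi_div_two_lt_arcsin.2 hs2.1, arcsin_lt_pi_div_two.2 hs2.2⟩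
  refine ⟨hI, ?_⟩
  rw [sin_arcsin hs2.1.le hs2.2.le, cos_arcsin]
  exact hQ.raise hQ' (le_sqrt_of_sq_le (by linarith))

theorem zero_mem_fib (hQ : SymCone Q) : (0 : ℝ) ∈ fib Q 0 :=
  ⟨⟨by linarith [pi_pos], by linarith [pi_pos]⟩, by simpa using hQ.center⟩

theorem exists_smul (hQ : SymCone Q) {a l t : ℝ} (ha : 0 ≤ a) (ha' : a ≤ 1) (h : l ∈ fib Q t) :
    arcsin (a * sin l) ∈ fib Q (a * t) := by
  simpa using hQ.exists_comb ha (sub_nonneg.2 ha') (by ring) h hQ.zero_mem_fib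

/-- Combining the two end points of one level with `exists_comb` reaches every intermediate value of
`sin l`. -/
theorem fib_eq_Icc (hQ : SymCone Q) {t : ℝ} (h : (fib Q t).Nonempty) :
    fib Q t = Icc (-R Q (-t)) (R Q t) := by
  ext l
  refine ⟨fun hl => ⟨hQ.neg_R_le hl, hQ.le_R hl⟩, fun ⟨h1, h2⟩ => ?_⟩
  have m1 := hQ.neg_R_mem h
  have m2 := hQ.R_mem h
  have hl := mem_Ioo_of_mem m1 m2 h1 h2
  have s1 : sin (-R Q (-t)) ≤ sin l :=
    (strictMonoOn_sin.monotoneOn) (Ioo_subset_Icc_self m1.1) (Ioo_subset_Icc_self hl) h1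
  have s2 : sin l ≤ sin (R Q t) :=
    (strictMonoOn_sin.monotoneOn) (Ioo_subset_Icc_self hl) (Ioo_subset_Icc_self m2.1) h2
  have hseg : sin l ∈ segment ℝ (sin (-R Q (-t))) (sin (R Q t)) := by
    rw [segment_eq_Icc (s1.trans s2)]
    exact ⟨s1, s2⟩
  obtain ⟨a, b, ha, hb, hab, he⟩ := hseg
  have := hQ.exists_comb ha hb hab m1 m2
  simp only [smul_eq_mul] at he
  rw [he, arcsin_sin hl.1.le hl.2.le, ← add_mul, hab, one_mul] at this
  exact this

/-- After reduction to nonnegative levels by symmetry, a point is scaled towards the centre by `t' /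
t`. -/
theorem fib_nonempty_of_abs_le (hQ : SymCone Q) {t t' : ℝ} (h : (fib Q t).Nonempty)
    (ht : |t'| ≤ |t|) : (fib Q t').Nonempty := by
  wlog h0 : 0 ≤ t' generalizing t'
  · have := this (t' := -t') (by simpa using ht) (by linarith)
    simpa using hQ.fib_neg_nonempty this
  wlog h1 : 0 ≤ t generalizing t
  · exact this (t := -t) (hQ.fib_neg_nonempty h) (by simpa using ht) (by linarith)
  rw [abs_of_nonneg h0, abs_of_nonneg h1] at ht
  obtain ⟨l, hl⟩ := h
  rcases h1.eq_or_lt with rfl | h1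
  · obtain rfl : t' = 0 := le_antisymm ht h0
    exact ⟨l, hl⟩
  · refine ⟨arcsin (t' / t * sin l), ?_⟩
    have := hQ.exists_smul (a := t' / t) (by positivity) ((div_le_one h1).2 ht) hl
    rwa [div_mul_cancel₀ _ h1.ne'] at this

end SymCone
end

/-! ### Half widths, chords of fibres, and convex position of the ends. -/

noncomputable section

open Real Set

namespace SymCone

variable {Q : ℝ → ℝ → ℝ → Prop}

/-- The sides of the parallelogram spanned by the end points of a fibre. -/
theorem exists_side (hQ : SymCone Q) {t t' : ℝ} (h : (fib Q t).Nonempty) (ht : 0 < t)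
    (ht' : |t'| ≤ t) :
    hw Q t + arcsin (t' / t * sin ((R Q t - R Q (-t)) / 2)) ∈ fib Q t' := by
  have m1 := hQ.R_mem h
  have m2 := hQ.R_mem (hQ.fib_neg_nonempty h)
  set α := R Q t
  set β := R Q (-t)
  have hm : hw Q t = (α + β) / 2 := rfl
  set d₀ := (α - β) / 2 with hd₀
  set q := t' / t with hq
  have hq1 : |q| ≤ 1 := by
    rw [hq, abs_div, abs_of_pos ht, div_le_one ht]; exact ht'
  have hd₀I : d₀ ∈ Ioo (-(π / 2)) (π / 2) := by
    constructor <;> linarith [m1.1.1, m1.1.2, m2.1.1, m2.1.2]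
  have hc₀ := cos_pos_of_mem_Ioo hd₀I
  have hs : |q * sin d₀| ≤ |sin d₀| := by
    rw [abs_mul]; exact mul_le_of_le_one_left (abs_nonneg _) hq1
  have hs1 := abs_le.1 (hs.trans (abs_sin_le_one d₀))
  set d := arcsin (q * sin d₀) with hd
  have hsd : sin d = q * sin d₀ := sin_arcsin hs1.1 hs1.2
  have hcd : cos d₀ ≤ cos d := by
    rw [hd, cos_arcsin, cos_eq_sqrt_one_sub_sin_sq hd₀I.1.le hd₀I.2.le]
    apply sqrt_le_sqrt
    have := sq_le_sq.2 hs
    linarith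
  have hdd : |d| ≤ |d₀| := by
    by_contra hlt
    push Not at hlt
    have : cos d < cos d₀ := by
      rw [← cos_abs d, ← cos_abs d₀]
      refine cos_lt_cos_of_nonneg_of_le_pi_div_two (abs_nonneg _) ?_ hlt
      exact abs_le.2 ⟨neg_pi_div_two_le_arcsin _, arcsin_le_pi_div_two _⟩
    linarith
  have hI : hw Q t + d ∈ Ioo (-(π / 2)) (π / 2) := by
    have h1 := abs_le.1 hdd
    rw [hm]
    rcases abs_cases d₀ with ⟨h2, _⟩ | ⟨h2, _⟩ <;> rw [h2] at h1 <;>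
      constructor <;> linarith [m1.1.1, m1.1.2, m2.1.1, m2.1.2]
  refine ⟨hI, ?_⟩
  have hx : 1 ≤ cos d / cos d₀ := (one_le_div hc₀).2 hcd
  have hq2 := abs_le.1 hq1
  -- The two end points have longitudes `hw Q t ± d₀` and levels `±t`. The coefficients have sum
  -- `cos d / cos d₀` and difference `q`, which turns `± d₀` into `d` and the level into `q * t`.
  have key := hQ.comb (a := (cos d / cos d₀ + q) / 2) (b := (cos d / cos d₀ - q) / 2)
    (by linarith) (by linarith) (by linarith) m1.2 m2.2
  have hα : α = hw Q t + d₀ := by rw [hm, hd₀]; ring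
  have hβ : β = hw Q t - d₀ := by rw [hm, hd₀]; ring
  rw [hα, hβ] at key
  have hqt : q * t = t' := div_mul_cancel₀ _ ht.ne'
  have hcc : cos d / cos d₀ * cos d₀ = cos d := div_mul_cancel₀ _ hc₀.ne'
  convert key using 1
  · rw [cos_add, cos_add, cos_sub, hsd]
    linear_combination -cos (hw Q t) * hcc
  · rw [sin_add, sin_add, sin_sub, hsd]
    linear_combination -sin (hw Q t) * hcc
  · linear_combination -hqt

/-- The body contains a parallelogram whose fibres all have half width `hw Q t`: by `exists_side`
its right sides at the levels `t'` and `-t'` deviate from `hw Q t` by opposite amounts. -/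
theorem hw_anti (hQ : SymCone Q) {t t' : ℝ} (h : (fib Q t).Nonempty) (ht : |t'| ≤ |t|) :
    hw Q t ≤ hw Q t' := by
  wlog h1 : 0 ≤ t generalizing t
  · have := this (t := -t) (hQ.fib_neg_nonempty h) (by simpa using ht) (by linarith)
    rwa [hw_neg] at this
  rw [abs_of_nonneg h1] at ht
  rcases h1.eq_or_lt with rfl | h1
  · rw [abs_nonpos_iff.1 ht]
  have e1 := hQ.le_R (hQ.exists_side h h1 ht)
  have e2 := hQ.le_R (hQ.exists_side h h1 (t' := -t') (by simpa using ht))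
  rw [neg_div, neg_mul, arcsin_neg] at e2
  rw [show hw Q t' = (R Q t' + R Q (-t')) / 2 from rfl]
  linarith

/-- The chord of a fibre at the levels above it. -/
theorem chord_above (hQ : SymCone Q) {t l : ℝ} (h : (fib Q t).Nonempty) (hl0 : 0 ≤ l)
    (hl : l ≤ hw Q t) :
    (fib Q (t / cos (hw Q t) * cos l)).Nonempty ∧ l ≤ hw Q (t / cos (hw Q t) * cos l) := by
  have m1 := hQ.R_mem h
  have m2 := hQ.neg_R_mem h
  have hm : hw Q t = (R Q t + R Q (-t)) / 2 := rfl
  set α := R Q t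
  set β := R Q (-t)
  have hmI : hw Q t < π / 2 := by linarith [m1.1.2, m2.1.1]
  have hcm : 0 < cos (hw Q t) := cos_pos_of_mem_Ioo ⟨by linarith [pi_pos], hmI⟩
  -- For `l = 0` only the midpoint of the chord is needed; the general coefficients divide by `sin
  -- (hw Q t)`, which may be zero then.
  rcases hl0.eq_or_lt with rfl | hl0
  · have hle : |t| ≤ |t / cos (hw Q t) * cos 0| := by
      rw [cos_zero, mul_one, abs_div, abs_of_pos hcm]
      exact le_div_self (abs_nonneg _) hcm (cos_le_one _)
    have key : (fib Q (t / cos (hw Q t) * cos 0)).Nonempty := by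
      refine ⟨(α - β) / 2, ?_⟩
      refine ⟨?_, ?_⟩
      · constructor <;> linarith [m1.1.1, m1.1.2, m2.1.1, m2.1.2]
      · have := hQ.comb (a := 1 / (2 * cos (hw Q t))) (b := 1 / (2 * cos (hw Q t)))
          (by positivity) (by positivity) (by positivity) m1.2 m2.2
        have hα : α = (α - β) / 2 + hw Q t := by rw [hm]; ring
        have hβ : -β = (α - β) / 2 - hw Q t := by rw [hm]; ring
        rw [hβ] at this
        nth_rewrite 1 3 [hα] at this
        convert this using 1
        · rw [cos_add, cos_sub]; field_simp; ring
        · rw [sin_add, sin_sub]; field_simp; ring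
        · simp; field_simp; ring
    exact ⟨key, hQ.hw_nonneg key⟩
  have hm0 : 0 < hw Q t := hl0.trans_le hl
  have hsm : 0 < sin (hw Q t) := sin_pos_of_pos_of_lt_pi hm0 (by linarith [pi_pos])
  set m := hw Q t with hmdef
  have hcl : cos m ≤ cos l := cos_le_cos_of_nonneg_of_le_pi hl0.le (by linarith [pi_pos]) hl
  have hsl : sin l ≤ sin m := sin_le_sin_of_le_of_le_pi_div_two (by linarith [pi_pos]) hmI.le hl
  have hsl0 : 0 ≤ sin l := sin_nonneg_of_nonneg_of_le_pi hl0.le (by linarith [pi_pos])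
  have hx : 1 ≤ cos l / cos m := (one_le_div hcm).2 hcl
  have hy : sin l / sin m ≤ 1 := (div_le_one hsm).2 hsl
  have hy0 : 0 ≤ sin l / sin m := by positivity
  have hα : α = (α - β) / 2 + m := by rw [hm]; ring
  have hβ : -β = (α - β) / 2 - m := by rw [hm]; ring
  have hI : ∀ e, |e| ≤ m → (α - β) / 2 + e ∈ Ioo (-(π / 2)) (π / 2) := by
    intro e he
    have he := abs_le.1 he
    constructor <;> linarith [m1.1.1, m1.1.2, m2.1.1, m2.1.2]
  have hcc : cos l / cos m * cos m = cos l := div_mul_cancel₀ _ hcm.ne'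
  have hss : sin l / sin m * sin m = sin l := div_mul_cancel₀ _ hsm.ne'
  -- The fibre has midpoint `(α - β) / 2`. Coefficients with sum `cos l / cos m` and difference `sin
  -- l / sin m` replace the offset `m` by `l` and scale the level by the sum.
  have p1 : (α - β) / 2 + l ∈ fib Q (t / cos m * cos l) := by
    refine ⟨hI l (by rwa [abs_of_pos hl0]), ?_⟩
    have key := hQ.comb (a := (cos l / cos m + sin l / sin m) / 2)
      (b := (cos l / cos m - sin l / sin m) / 2)
      (by linarith) (by linarith) (by linarith) m1.2 m2.2
    rw [hβ] at key
    nth_rewrite 1 3 [hα] at key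
    convert key using 1
    · rw [cos_add, cos_add, cos_sub]
      linear_combination -cos ((α - β) / 2) * hcc + sin ((α - β) / 2) * hss
    · rw [sin_add, sin_add, sin_sub]
      linear_combination -sin ((α - β) / 2) * hcc - cos ((α - β) / 2) * hss
    · ring
  have p2 : (α - β) / 2 + -l ∈ fib Q (t / cos m * cos l) := by
    refine ⟨hI (-l) (by rwa [abs_neg, abs_of_pos hl0]), ?_⟩
    have key := hQ.comb (a := (cos l / cos m - sin l / sin m) / 2)
      (b := (cos l / cos m + sin l / sin m) / 2)
      (by linarith) (by linarith) (by linarith) m1.2 m2.2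
    rw [hβ] at key
    nth_rewrite 1 3 [hα] at key
    convert key using 1
    · rw [cos_add, cos_neg, sin_neg, cos_add, cos_sub]
      linear_combination -cos ((α - β) / 2) * hcc - sin ((α - β) / 2) * hss
    · rw [sin_add, cos_neg, sin_neg, sin_add, sin_sub]
      linear_combination -sin ((α - β) / 2) * hcc + cos ((α - β) / 2) * hss
    · ring
  refine ⟨⟨_, p1⟩, ?_⟩
  have e1 := hQ.le_R p1
  have e2 := hQ.neg_R_le p2
  rw [show hw Q (t / cos m * cos l) = (R Q (t / cos m * cos l) + R Q (-(t / cos m * cos l))) / 2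
    from rfl]
  linarith

/-- Right end points of fibres are in convex position. -/
theorem orient (hQ : SymCone Q) {t₁ t₂ t : ℝ} (h₁ : (fib Q t₁).Nonempty) (ht₂ : 0 ≤ t₂)
    (h2t : t₂ < t) (ht1 : t < t₁) (hpos : t₂ = 0 → 0 < R Q t₂) :
    0 ≤ t₁ * sin (R Q t - R Q t₂) - t₂ * sin (R Q t - R Q t₁) + t * sin (R Q t₂ - R Q t₁) := by
  have t₁p : 0 < t₁ := by linarith
  have tp : 0 < t := by linarith
  have h : (fib Q t).Nonempty := hQ.fib_nonempty_of_abs_le h₁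
    (by rw [abs_of_pos tp, abs_of_pos t₁p]; exact ht1.le)
  have h₂ : (fib Q t₂).Nonempty := hQ.fib_nonempty_of_abs_le h₁
    (by rw [abs_of_nonneg ht₂, abs_of_pos t₁p]; linarith)
  -- the polar angle of the right end points is monotone in the level
  have ray : ∀ {p q : ℝ}, 0 ≤ p → p < q → (fib Q p).Nonempty → (fib Q q).Nonempty →
      p * sin (R Q q) ≤ sin (R Q p) * q := by
    intro p q hp hpq np nq
    have hq : 0 < q := hp.trans_lt hpq
    have := hQ.exists_smul (a := p / q) (by positivity) ((div_le_one hq).2 hpq.le) (hQ.R_mem nq)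
    rw [div_mul_cancel₀ _ hq.ne'] at this
    have hle := hQ.le_R this
    have hs := sin_le_sin_of_le_of_le_pi_div_two (this.1.1.le) (hQ.R_mem np).1.2.le hle
    have hm : |p / q * sin (R Q q)| ≤ 1 := by
      rw [abs_mul]
      refine mul_le_one₀ ?_ (abs_nonneg _) (abs_sin_le_one _)
      rw [abs_of_nonneg (by positivity)]
      exact (div_le_one hq).2 hpq.le
    have hm := abs_le.1 hm
    rw [sin_arcsin hm.1 hm.2] at hs
    calc p * sin (R Q q) = p / q * sin (R Q q) * q := by field_simp
      _ ≤ sin (R Q p) * q := by gcongr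
  have r21 := ray ht₂ (h2t.trans ht1) h₂ h₁
  have r2 := ray ht₂ h2t h₂ h
  have r1 := ray tp.le ht1 h h₁
  have m := hQ.R_mem h
  have m₁ := hQ.R_mem h₁
  have m₂ := hQ.R_mem h₂
  have hmax : ∀ l ∈ fib Q t, l ≤ R Q t := fun l hl => hQ.le_R hl
  set A := R Q t
  set A₁ := R Q t₁
  set A₂ := R Q t₂
  have c := cos_pos_of_mem_Ioo m.1
  have c₁ := cos_pos_of_mem_Ioo m₁.1
  have c₂ := cos_pos_of_mem_Ioo m₂.1
  have e := sin_sq_add_cos_sq A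
  have e₁ := sin_sq_add_cos_sq A₁
  have e₂ := sin_sq_add_cos_sq A₂
  -- By Cramer's rule, `D` is the denominator when a vector with prescribed `s` and level is
  -- expressed through the two outer end points.
  set D := sin A₂ * t₁ - sin A₁ * t₂ with hD
  have hD0 : 0 ≤ D := by linarith
  -- If the determinant is negative, the combination of the outer ends with the `s` and level of the
  -- middle end has first coordinate below `cos A`. This slack lets the middle fibre be prolonged
  -- beyond its maximum, by `raise`.
  by_contra! hneg
  have hdet : D * cos A > (sin A₂ * t - sin A * t₂) * cos A₁ +
      (sin A * t₁ - sin A₁ * t) * cos A₂ := by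
    rw [sin_sub, sin_sub, sin_sub] at hneg
    nlinarith
  have hDp : 0 < D := by
    rcases hD0.eq_or_lt with h0 | h0
    · exfalso
      rw [← h0] at hdet
      have := mul_nonneg (show 0 ≤ sin A₂ * t - sin A * t₂ by linarith) c₁.le
      have := mul_nonneg (show 0 ≤ sin A * t₁ - sin A₁ * t by linarith) c₂.le
      linarith
    · exact h0
  -- Strictness keeps the coefficient nonnegative when `l` moves past `A`. In case of equality with
  -- `t₂ > 0`, the pair `(sin A, t)` is a multiple of `(sin A₂, t₂)` with factor above one; then
  -- `hdet` makes `cos A ^ 2 + sin A ^ 2` exceed one.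
  have ha : 0 < sin A₂ * t - sin A * t₂ := by
    refine lt_of_le_of_ne (by linarith) fun h0 => ?_
    rcases ht₂.eq_or_lt with h00 | h00
    · have hA2 := hpos h00.symm
      have := sin_pos_of_pos_of_lt_pi hA2 (by linarith [m₂.1.2, pi_pos])
      rw [← h00] at h0
      nlinarith
    · -- `A` and `A₂` on a ray
      have hb : sin A * t₁ - sin A₁ * t = D * (t / t₂) := by
        field_simp
        rw [hD]
        linear_combination t₁ * h0
      rw [← h0, hb, zero_mul, zero_add, mul_assoc] at hdet
      have h3 : t / t₂ * cos A₂ < cos A := lt_of_mul_lt_mul_left hdet hD0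
      have h4 : 1 < t / t₂ := (one_lt_div h00).2 h2t
      have h5 : sin A = t / t₂ * sin A₂ := by
        field_simp
        linarith
      have h6 : (t / t₂ * cos A₂) ^ 2 < cos A ^ 2 := by
        apply pow_lt_pow_left₀ h3 (by positivity) two_ne_zero
      have h7 : sin A ^ 2 = (t / t₂ * sin A₂) ^ 2 := by rw [h5]
      have h8 : (t / t₂ * cos A₂) ^ 2 + (t / t₂ * sin A₂) ^ 2 = (t / t₂) ^ 2 := by
        linear_combination (t / t₂) ^ 2 * e₂
      have h9 : 1 < (t / t₂) ^ 2 := one_lt_pow₀ h4 two_ne_zero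
      linarith
  have ev1 : ∀ᶠ l in nhdsWithin A (Ioi A), 0 < sin A₂ * t - sin l * t₂ := by
    apply Filter.Tendsto.eventually_const_lt ha
    exact (Continuous.tendsto (by fun_prop) A).mono_left nhdsWithin_le_nhds
  have ev2 : ∀ᶠ l in nhdsWithin A (Ioi A), 0 < D * cos l -
      ((sin A₂ * t - sin l * t₂) * cos A₁ + (sin l * t₁ - sin A₁ * t) * cos A₂) := by
    refine Filter.Tendsto.eventually_const_lt (sub_pos.2 hdet) ?_
    exact (Continuous.tendsto (by fun_prop) A).mono_left nhdsWithin_le_nhds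
  have ev3 : ∀ᶠ l in nhdsWithin A (Ioi A), l < π / 2 :=
    (Filter.Tendsto.eventually_lt_const m.1.2 Filter.tendsto_id).filter_mono nhdsWithin_le_nhds
  obtain ⟨l, ⟨⟨l1, l2⟩, l3⟩, l4⟩ := (((ev1.and ev2).and ev3).and self_mem_nhdsWithin).exists
  have l4 : A < l := l4
  have hlI : l ∈ Ioo (-(π / 2)) (π / 2) := ⟨m.1.1.trans l4, l3⟩
  have hsl : sin A < sin l :=
    strictMonoOn_sin (Ioo_subset_Icc_self m.1) (Ioo_subset_Icc_self hlI) l4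
  have hb : 0 < sin l * t₁ - sin A₁ * t := by nlinarith
  refine absurd (hmax l ⟨hlI, ?_⟩) (not_le.2 l4)
  have key := hQ.comb (a := (sin A₂ * t - sin l * t₂) / D) (b := (sin l * t₁ - sin A₁ * t) / D)
    (by positivity) (by positivity) (by positivity) m₁.2 m₂.2
  refine hQ.raise (w := (sin A₂ * t - sin l * t₂) / D * cos A₁ + (sin l * t₁ - sin A₁ * t) / D *
    cos A₂) ?_ ?_
  · convert key using 1
    · field_simp
      rw [hD]; ring
    · field_simp
      rw [hD]; ring
  · rw [div_mul_eq_mul_div, div_mul_eq_mul_div, ← add_div, div_le_iff₀ hDp]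
    linarith

end SymCone
end

/-! ### Continuity of the half width and the symmetrised cone. -/

noncomputable section

open Real Set Filter Topology

/-- A missing point would lie in a gap bounded by the nearest points of `T` on its two sides.
Convexity of a closed set is thereby reduced to one extra point on each chord. -/
theorem Icc_subset_of_exists_between {T : Set ℝ} (hT : IsClosed T) (h0 : (0 : ℝ) ∈ T)
    (h1 : (1 : ℝ) ∈ T)
    (h : ∀ a ∈ T, ∀ b ∈ T, 0 ≤ a → a < b → b ≤ 1 → ∃ s ∈ T, a < s ∧ s < b) :
    Icc (0 : ℝ) 1 ⊆ T := by
  intro s hs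
  by_contra hsT
  have c1 : IsCompact (T ∩ Icc 0 s) := isCompact_Icc.inter_left hT
  have c2 : IsCompact (T ∩ Icc s 1) := isCompact_Icc.inter_left hT
  have m1 := c1.sSup_mem ⟨0, h0, le_rfl, hs.1⟩
  have m2 := c2.sInf_mem ⟨1, h1, hs.2, le_rfl⟩
  have l1 : sSup (T ∩ Icc 0 s) < s := lt_of_le_of_ne m1.2.2 fun e => hsT (e ▸ m1.1)
  have l2 : s < sInf (T ∩ Icc s 1) := lt_of_le_of_ne m2.2.1 fun e => hsT (e.symm ▸ m2.1)
  obtain ⟨x, hx, hx1, hx2⟩ := h _ m1.1 _ m2.1 m1.2.1 (l1.trans l2) m2.2.2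
  rcases le_total x s with hxs | hxs
  · exact absurd (le_csSup c1.bddAbove ⟨hx, m1.2.1.trans hx1.le, hxs⟩) (not_le.2 hx1)
  · exact absurd (csInf_le c2.bddBelow ⟨hx, hxs, hx2.le.trans m2.2.2⟩) (not_le.2 hx2)

namespace SymCone

variable {Q : ℝ → ℝ → ℝ → Prop}

/-- Upper semicontinuity: the levels of the points of longitude at least `y` form a compact set that
omits `t₀`. -/
theorem eventually_R_lt (hQ : SymCone Q) {T t₀ y : ℝ} (hT : (fib Q T).Nonempty)
    (hy : R Q t₀ < y) : ∀ᶠ t in 𝓝[Icc (-|T|) |T|] t₀, R Q t < y := by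
  have hc : IsCompact (Prod.snd '' ({q : ℝ × ℝ | q.1 ∈ fib Q q.2} ∩ {q | y ≤ q.1})) :=
    (hQ.isCompact_graph.inter_right (isClosed_le continuous_const continuous_fst)).image
      continuous_snd
  have hmem : t₀ ∉ Prod.snd '' ({q : ℝ × ℝ | q.1 ∈ fib Q q.2} ∩ {q | y ≤ q.1}) := by
    rintro ⟨⟨l, t⟩, ⟨h1, h2⟩, rfl⟩
    exact absurd ((show y ≤ l from h2).trans (hQ.le_R h1)) (not_le.2 hy)
  have := mem_nhdsWithin_of_mem_nhds (t := Icc (-|T|) |T|) (hc.isClosed.isOpen_compl.mem_nhds hmem)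
  filter_upwards [this, self_mem_nhdsWithin] with t h1 h2
  by_contra! h3
  exact h1 ⟨(R Q t, t), ⟨hQ.R_mem (hQ.fib_nonempty_of_abs_le hT (abs_le.2 h2)), h3⟩, rfl⟩

/-- Lower semicontinuity on the side of `E`: in the coordinates `(sin l, t)` the chord from the
right end at `t₀` to the right end at `E` is a continuous lower bound for `R Q`. -/
theorem eventually_lt_R (hQ : SymCone Q) {E t₀ y : ℝ} (hne : t₀ ≠ E) (hE : (fib Q E).Nonempty)
    (h₀ : (fib Q t₀).Nonempty) (hy : y < R Q t₀) : ∀ᶠ t in 𝓝[uIcc t₀ E] t₀, y < R Q t := by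
  have hE' : E - t₀ ≠ 0 := sub_ne_zero.2 hne.symm
  have hf : Tendsto (fun t => arcsin ((1 - (t - t₀) / (E - t₀)) * sin (R Q t₀) +
      (t - t₀) / (E - t₀) * sin (R Q E))) (𝓝[uIcc t₀ E] t₀) (𝓝 (R Q t₀)) := by
    have : Continuous (fun t => arcsin ((1 - (t - t₀) / (E - t₀)) * sin (R Q t₀) +
      (t - t₀) / (E - t₀) * sin (R Q E))) := continuous_arcsin.comp (by fun_prop)
    have h2 := this.tendsto t₀
    have m := (hQ.R_mem h₀).1
    simp only [sub_self, zero_div, sub_zero, one_mul, zero_mul, add_zero] at h2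
    rw [arcsin_sin m.1.le m.2.le] at h2
    exact h2.mono_left nhdsWithin_le_nhds
  filter_upwards [hf.eventually_const_lt hy, self_mem_nhdsWithin] with t h1 h2
  refine h1.trans_le ?_
  have ha : 0 ≤ (t - t₀) / (E - t₀) ∧ (t - t₀) / (E - t₀) ≤ 1 := by
    rcases mem_uIcc.1 h2 with ⟨h3, h4⟩ | ⟨h3, h4⟩
    · have : 0 < E - t₀ := lt_of_le_of_ne (by linarith) hE'.symm
      exact ⟨div_nonneg (by linarith) this.le, (div_le_one this).2 (by linarith)⟩
    · have : E - t₀ < 0 := lt_of_le_of_ne (by linarith) hE'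
      exact ⟨div_nonneg_of_nonpos (by linarith) this.le, (div_le_one_of_neg this).2 (by linarith)⟩
  have := hQ.exists_comb (sub_nonneg.2 ha.2) ha.1 (by ring) (hQ.R_mem h₀) (hQ.R_mem hE)
  have e : (1 - (t - t₀) / (E - t₀)) * t₀ + (t - t₀) / (E - t₀) * E = t := by
    field_simp
    ring
  rw [e] at this
  exact hQ.le_R this

theorem continuousOn_R (hQ : SymCone Q) {T : ℝ} (hT : (fib Q T).Nonempty) :
    ContinuousOn (R Q) (Icc (-|T|) |T|) := by
  intro t₀ ht₀
  have habs : ∀ {E}, |E| ≤ |T| → (fib Q E).Nonempty := fun h => hQ.fib_nonempty_of_abs_le hT h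
  have h₀ : (fib Q t₀).Nonempty := habs (abs_le.2 ht₀)
  refine tendsto_order.2 ⟨fun y hy => ?_, fun y hy => hQ.eventually_R_lt hT hy⟩
  have side : ∀ E, |E| ≤ |T| → ∀ᶠ t in 𝓝[uIcc t₀ E] t₀, y < R Q t := by
    intro E hE
    rcases eq_or_ne t₀ E with rfl | hne
    · rw [uIcc_self]
      simpa [nhdsWithin_singleton] using hy
    · exact hQ.eventually_lt_R hne (habs hE) h₀ hy
  have h1 := side (-|T|) (by simp)
  have h2 := side |T| (by simp)
  rw [uIcc_of_ge ht₀.1] at h1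
  rw [uIcc_of_le ht₀.2] at h2
  rw [← Icc_union_Icc_eq_Icc ht₀.1 ht₀.2, nhdsWithin_union]
  exact eventually_sup.2 ⟨h1, h2⟩

theorem continuousOn_hw (hQ : SymCone Q) {T : ℝ} (hT : (fib Q T).Nonempty) :
    ContinuousOn (hw Q) (Icc (-|T|) |T|) := by
  have h1 := hQ.continuousOn_R hT
  have h2 : ContinuousOn (fun t => R Q (-t)) (Icc (-|T|) |T|) :=
    h1.comp (by fun_prop) fun t ht => ⟨by linarith [ht.2], by linarith [ht.1]⟩
  exact (h1.add h2).div_const 2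

/-- The cone over the symmetrised body. -/
def sym (Q : ℝ → ℝ → ℝ → Prop) (w s t : ℝ) : Prop :=
  0 < w ∧ (fib Q (t / √(w ^ 2 + s ^ 2))).Nonempty ∧ |arctan (s / w)| ≤ hw Q (t / √(w ^ 2 + s ^ 2))

theorem sym_polar (Q : ℝ → ℝ → ℝ → Prop) {l r t : ℝ} (hl : l ∈ Ioo (-(π / 2)) (π / 2))
    (hr : 0 < r) :
    sym Q (r * cos l) (r * sin l) (r * t) ↔ (fib Q t).Nonempty ∧ |l| ≤ hw Q t := by
  have hc := cos_pos_of_mem_Ioo hl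
  have h1 : (r * cos l) ^ 2 + (r * sin l) ^ 2 = r ^ 2 := by
    linear_combination r ^ 2 * sin_sq_add_cos_sq l
  have h2 : r * sin l / (r * cos l) = tan l := by
    rw [tan_eq_sin_div_cos]; field_simp
  unfold sym
  rw [h1, h2, arctan_tan hl.1 hl.2, sqrt_sq hr.le, mul_div_cancel_left₀ _ hr.ne']
  exact ⟨fun h => h.2, fun h => ⟨by positivity, h⟩⟩

theorem exists_polar {w : ℝ} (hw : 0 < w) (s t : ℝ) :
    ∃ l ∈ Ioo (-(π / 2)) (π / 2), ∃ r > 0, ∃ t', w = r * cos l ∧ s = r * sin l ∧ t = r * t' := by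
  have hp : 0 < √(1 + (s / w) ^ 2) := by positivity
  refine ⟨arctan (s / w), arctan_mem_Ioo _, w * √(1 + (s / w) ^ 2), by positivity,
    t / (w * √(1 + (s / w) ^ 2)), ?_, ?_, ?_⟩
  · rw [cos_arctan]; field_simp
  · rw [sin_arctan]; field_simp
  · field_simp

theorem sym_smul {r w s t : ℝ} (hr : 0 < r) (h : sym Q w s t) :
    sym Q (r * w) (r * s) (r * t) := by
  obtain ⟨l, hl, ρ, hρ, t', rfl, rfl, rfl⟩ := exists_polar h.1 s t
  rw [← mul_assoc, ← mul_assoc, ← mul_assoc, sym_polar Q hl (by positivity)]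
  exact (sym_polar Q hl hρ).1 h

theorem sym_abs (hQ : SymCone Q) {w s s' t t' : ℝ} (h : sym Q w s t) (hs : |s'| = |s|)
    (ht : |t'| = |t|) : sym Q w s' t' := by
  have hs2 : s' ^ 2 = s ^ 2 := sq_eq_sq_iff_abs_eq_abs _ _ |>.2 hs
  obtain ⟨h1, h2, h3⟩ := h
  refine ⟨h1, ?_, ?_⟩
  · rw [hs2]
    exact hQ.fib_nonempty_of_abs_le h2 (by rw [abs_div, abs_div, ht])
  · have e1 : |arctan (s' / w)| = |arctan (s / w)| := by
      rcases abs_eq_abs.1 hs with rfl | rfl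
      · rfl
      · rw [neg_div, arctan_neg, abs_neg]
    rw [e1, hs2]
    rcases abs_eq_abs.1 ht with rfl | rfl
    · exact h3
    · rwa [neg_div, hw_neg]

/-- The symmetrised body is closed under shrinking the gnomonic coordinates. -/
theorem sym_shrink (hQ : SymCone Q) {w s s' t t' : ℝ} (h : sym Q w s t) (hs : |s'| ≤ |s|)
    (ht : |t'| ≤ |t|) : sym Q w s' t' := by
  suffices hmain : sym Q w |s'| |t'| from hQ.sym_abs hmain (by simp) (by simp)
  have h : sym Q w |s| |t| := hQ.sym_abs h (by simp) (by simp)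
  have hs' := abs_nonneg s'
  have ht' := abs_nonneg t'
  generalize |s| = S at *
  generalize |s'| = S' at *
  generalize |t| = T at *
  generalize |t'| = T' at *
  have hw0 := h.1
  obtain ⟨l, hl, r, hr, u, rfl, rfl, rfl⟩ := exists_polar h.1 S T
  obtain ⟨l', hl', r', hr', u', e1, rfl, rfl⟩ := exists_polar h.1 S' T'
  have hc := cos_pos_of_mem_Ioo hl
  have hc' := cos_pos_of_mem_Ioo hl'
  rw [e1, sym_polar Q hl' hr']
  obtain ⟨hne, hle⟩ := (sym_polar Q hl hr).1 h
  have hu' : 0 ≤ u' := nonneg_of_mul_nonneg_right ht' hr'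
  have hsl' : 0 ≤ sin l' := nonneg_of_mul_nonneg_right hs' hr'
  have hl'0 : 0 ≤ l' := by
    by_contra! hn
    exact absurd (sin_neg_of_neg_of_neg_pi_lt hn (by linarith [hl'.1, pi_pos])) (not_lt.2 hsl')
  have hu : 0 ≤ u := nonneg_of_mul_nonneg_right (ht'.trans ht) hr
  have hll : l' ≤ l := by
    have : tan l' ≤ tan l := by
      rw [tan_eq_sin_div_cos, tan_eq_sin_div_cos, div_le_div_iff₀ hc' hc]
      have : r' * (sin l' * (r * cos l)) ≤ r' * (sin l * (r * cos l)) * (r / r') := by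
        have e : r' * (sin l * (r * cos l)) * (r / r') = (r * sin l) * (r * cos l) := by
          field_simp
        rw [e, ← mul_assoc]
        gcongr
      have e2 : r' * (sin l' * (r * cos l)) = r' * r * (sin l' * cos l) := by ring
      have e3 : r' * (sin l * (r * cos l)) * (r / r') = r' * r * (sin l * cos l') := by
        have : cos l' = r * cos l / r' := by rw [e1]; field_simp
        rw [this]; field_simp
      rw [e2, e3] at this
      exact le_of_mul_le_mul_left this (by positivity)
    by_contra! hn
    exact absurd (strictMonoOn_tan hl hl' hn) (not_lt.2 this)
  have hl0 : 0 ≤ l := hl'0.trans hll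
  rw [abs_of_nonneg hl0] at hle
  rw [abs_of_nonneg hl'0]
  -- The chord of the fibre at level `u` passes longitude `l'` at a level not below `u'`; `hw_anti`
  -- then leads down to `u'`.
  obtain ⟨k1, k2⟩ := hQ.chord_above hne hl'0 (hll.trans hle)
  have hmI : hw Q u < π / 2 := by
    have a1 := (hQ.R_mem hne).1.2
    have a2 := (hQ.R_mem (hQ.fib_neg_nonempty hne)).1.2
    unfold hw; linarith
  have hcm : 0 < cos (hw Q u) := cos_pos_of_mem_Ioo ⟨by linarith [pi_pos], hmI⟩
  have hcml : cos (hw Q u) ≤ cos l := cos_le_cos_of_nonneg_of_le_pi hl0 (by linarith [pi_pos]) hle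
  have hlev : |u'| ≤ |u / cos (hw Q u) * cos l'| := by
    rw [abs_of_nonneg hu', abs_of_nonneg (by positivity)]
    calc u' ≤ u / cos l * cos l' := by
          rw [div_mul_eq_mul_div, le_div_iff₀ hc]
          have : r' * u' * cos l' ≤ r * u * cos l' := by gcongr
          have : r * cos l * u' ≤ r * (u * cos l') := by
            rw [e1]; linarith
          have : r * (u' * cos l) ≤ r * (u * cos l') := by linarith
          exact le_of_mul_le_mul_left this hr
      _ ≤ u / cos (hw Q u) * cos l' := by gcongr
  exact ⟨hQ.fib_nonempty_of_abs_le k1 hlev, k2.trans (hQ.hw_anti k1 hlev)⟩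

end SymCone
end

/-! ### The interpolation inequality for half widths. -/

noncomputable section

open Real Set Filter Topology

namespace SymCone

variable {Q : ℝ → ℝ → ℝ → Prop}

/-- End points of fibres at different levels do not lie too far apart. -/
theorem abs_sub_lt (hQ : SymCone Q) {t₁ t₂ : ℝ} (h₁ : (fib Q t₁).Nonempty) (ht₂ : 0 ≤ t₂)
    (h21 : t₂ < t₁) :
    |(R Q t₂ - R Q (-t₂)) - (R Q t₁ - R Q (-t₁))| < π := by
  have h₂ : (fib Q t₂).Nonempty := hQ.fib_nonempty_of_abs_le h₁
    (by rw [abs_of_nonneg ht₂, abs_of_pos (by linarith)]; linarith)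
  -- The level `t₂` lies between `-t₂` and `t₁`, and in the coordinates `(sin l, t)` a chord does
  -- not fall below its lower end.
  have key : ∀ {Q : ℝ → ℝ → ℝ → Prop}, SymCone Q → (fib Q t₁).Nonempty → (fib Q t₂).Nonempty →
      min (R Q t₁) (R Q (-t₂)) ≤ R Q t₂ := by
    intro Q hQ h₁ h₂
    have m₁ := hQ.R_mem h₁
    have m₂ := hQ.R_mem (hQ.fib_neg_nonempty h₂)
    have hp : 0 < t₁ + t₂ := by linarith
    have := hQ.exists_comb (a := 2 * t₂ / (t₁ + t₂)) (b := (t₁ - t₂) / (t₁ + t₂)) (by positivity)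
      (div_nonneg (by linarith) hp.le) (by field_simp; ring) m₁ m₂
    have e : 2 * t₂ / (t₁ + t₂) * t₁ + (t₁ - t₂) / (t₁ + t₂) * -t₂ = t₂ := by
      field_simp; ring
    rw [e] at this
    refine le_trans ?_ (hQ.le_R this)
    have hI : min (R Q t₁) (R Q (-t₂)) ∈ Icc (-(π / 2)) (π / 2) :=
      ⟨le_min m₁.1.1.le m₂.1.1.le, (min_le_left _ _).trans m₁.1.2.le⟩
    have s1 : sin (min (R Q t₁) (R Q (-t₂))) ≤ sin (R Q t₁) :=
      sin_le_sin_of_le_of_le_pi_div_two hI.1 m₁.1.2.le (min_le_left _ _)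
    have s2 : sin (min (R Q t₁) (R Q (-t₂))) ≤ sin (R Q (-t₂)) :=
      sin_le_sin_of_le_of_le_pi_div_two hI.1 m₂.1.2.le (min_le_right _ _)
    rw [← arcsin_sin hI.1 hI.2]
    apply monotone_arcsin
    have a0 : 0 ≤ 2 * t₂ / (t₁ + t₂) := by positivity
    have b0 : 0 ≤ (t₁ - t₂) / (t₁ + t₂) := div_nonneg (by linarith) hp.le
    have ab : 2 * t₂ / (t₁ + t₂) + (t₁ - t₂) / (t₁ + t₂) = 1 := by field_simp; ring
    calc sin (min (R Q t₁) (R Q (-t₂)))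
        = 2 * t₂ / (t₁ + t₂) * sin (min (R Q t₁) (R Q (-t₂))) +
          (t₁ - t₂) / (t₁ + t₂) * sin (min (R Q t₁) (R Q (-t₂))) := by rw [← add_mul, ab, one_mul]
      _ ≤ _ := by gcongr
  have k1 := key hQ h₁ h₂
  have k2 := key hQ.mirror
    (by simpa [Set.Nonempty, hQ.mem_fib_mirror] using hQ.fib_neg_nonempty h₁)
    (by simpa [Set.Nonempty, hQ.mem_fib_mirror] using hQ.fib_neg_nonempty h₂)
  rw [hQ.R_mirror, hQ.R_mirror, hQ.R_mirror, neg_neg] at k2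
  have a1 := (hQ.R_mem h₁).1
  have a2 := (hQ.R_mem h₂).1
  have a3 := (hQ.R_mem (hQ.fib_neg_nonempty h₁)).1
  have a4 := (hQ.R_mem (hQ.fib_neg_nonempty h₂)).1
  simp only [mem_Ioo] at a1 a2 a3 a4
  rw [abs_lt]
  rcases min_le_iff.1 k1 with k1 | k1 <;> rcases min_le_iff.1 k2 with k2 | k2 <;>
    constructor <;> linarith

/-- Between two boundary points of the symmetrised body there is a further point of the body. -/
theorem exists_between (hQ : SymCone Q) {t₁ t₂ : ℝ} (h₁ : (fib Q t₁).Nonempty) (ht₂ : 0 ≤ t₂)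
    (h21 : t₂ < t₁) (hlt : hw Q t₁ < hw Q t₂) :
    ((fib Q ((t₁ + t₂) / (2 * cos ((hw Q t₂ - hw Q t₁) / 2)))).Nonempty ∧
      (hw Q t₁ + hw Q t₂) / 2 ≤ hw Q ((t₁ + t₂) / (2 * cos ((hw Q t₂ - hw Q t₁) / 2)))) ∨
    ∃ t, t₂ < t ∧ t < t₁ ∧ 0 ≤ t₁ * sin (hw Q t - hw Q t₂) - t₂ * sin (hw Q t - hw Q t₁) +
      t * sin (hw Q t₂ - hw Q t₁) := by
  have ht₁ : 0 < t₁ := by linarith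
  have h₂ : (fib Q t₂).Nonempty := hQ.fib_nonempty_of_abs_le h₁
    (by rw [abs_of_nonneg ht₂, abs_of_pos ht₁]; linarith)
  have hw₁ := hQ.hw_nonneg h₁
  have a1 := (hQ.R_mem h₁)
  have a2 := (hQ.R_mem h₂)
  have a3 := (hQ.R_mem (hQ.fib_neg_nonempty h₁))
  have a4 := (hQ.R_mem (hQ.fib_neg_nonempty h₂))
  have hN0 : 0 < hw Q t₂ - hw Q t₁ := by linarith
  have hNlt : hw Q t₂ - hw Q t₁ < π / 2 := by
    have : hw Q t₂ < π / 2 := by unfold hw; linarith [a2.1.2, a4.1.2]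
    linarith
  -- These differences are twice the midpoints of the fibres. If they agree, left and right ends are
  -- both shifted by `N`, so the normalised sums of the two right ends and of the two left ends lie
  -- at one common level.
  by_cases hδ : R Q t₁ - R Q (-t₁) = R Q t₂ - R Q (-t₂)
  · left
    set N := hw Q t₂ - hw Q t₁ with hN
    have hcN : 0 < cos (N / 2) := cos_pos_of_mem_Ioo ⟨by linarith, by linarith⟩
    have r1 : R Q t₁ = (R Q t₁ + R Q t₂) / 2 - N / 2 := by
      rw [hN]; unfold hw; linarith
    have r2 : R Q t₂ = (R Q t₁ + R Q t₂) / 2 + N / 2 := by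
      rw [hN]; unfold hw; linarith
    have r3 : R Q (-t₁) = (R Q (-t₁) + R Q (-t₂)) / 2 - N / 2 := by
      rw [hN]; unfold hw; linarith
    have r4 : R Q (-t₂) = (R Q (-t₁) + R Q (-t₂)) / 2 + N / 2 := by
      rw [hN]; unfold hw; linarith
    have mid : ∀ {m u v : ℝ}, m - N / 2 ∈ fib Q u → m + N / 2 ∈ fib Q v →
        m ∈ fib Q ((u + v) / (2 * cos (N / 2))) := by
      intro m u v hu hv
      refine ⟨mem_Ioo_of_mem hu hv (by linarith) (by linarith), ?_⟩
      have := hQ.comb (a := 1 / (2 * cos (N / 2))) (b := 1 / (2 * cos (N / 2)))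
        (by positivity) (by positivity) (by positivity) hu.2 hv.2
      convert this using 1
      · rw [cos_add, cos_sub]; field_simp; ring
      · rw [sin_add, sin_sub]; field_simp; ring
      · field_simp
    have p1 := mid (m := (R Q t₁ + R Q t₂) / 2) (r1 ▸ a1) (r2 ▸ a2)
    have p2 := mid (m := (R Q (-t₁) + R Q (-t₂)) / 2) (r3 ▸ a3) (r4 ▸ a4)
    refine ⟨⟨_, p1⟩, ?_⟩
    have e1 := hQ.le_R p1
    have e2 := hQ.le_R p2
    rw [← neg_add, neg_div] at e2
    rw [show hw Q t₁ = (R Q t₁ + R Q (-t₁)) / 2 from rfl,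
      show hw Q t₂ = (R Q t₂ + R Q (-t₂)) / 2 from rfl,
      show ∀ s, hw Q s = (R Q s + R Q (-s)) / 2 from fun _ => rfl]
    linarith
  · right
    have hcont : ContinuousOn (fun t => R Q t - R Q (-t)) (Icc t₂ t₁) := by
      have h1 := hQ.continuousOn_R h₁
      rw [abs_of_pos ht₁] at h1
      refine (h1.mono (Icc_subset_Icc (by linarith) le_rfl)).sub (h1.comp (by fun_prop) ?_)
      intro t ht
      exact ⟨by linarith [ht.2], by linarith [ht.1]⟩
    have hivt : ((R Q t₁ - R Q (-t₁)) + (R Q t₂ - R Q (-t₂))) / 2 ∈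
        (fun t => R Q t - R Q (-t)) '' Icc t₂ t₁ := by
      have h3 := intermediate_value_uIcc (a := t₂) (b := t₁) (f := fun t => R Q t - R Q (-t))
        (by rwa [uIcc_of_le h21.le])
      rw [uIcc_of_le h21.le] at h3
      apply h3
      rw [mem_uIcc]
      rcases le_total (R Q t₁ - R Q (-t₁)) (R Q t₂ - R Q (-t₂)) with h | h
      · right; constructor <;> linarith
      · left; constructor <;> linarith
    obtain ⟨t, ht, hte⟩ := hivt
    simp only at hte
    have t2 : t₂ < t := by
      refine lt_of_le_of_ne ht.1 ?_
      rintro rfl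
      apply hδ; linarith
    have t1 : t < t₁ := by
      refine lt_of_le_of_ne ht.2 ?_
      rintro rfl
      apply hδ; linarith
    have h : (fib Q t).Nonempty := hQ.fib_nonempty_of_abs_le h₁
      (by rw [abs_of_pos (by linarith), abs_of_pos ht₁]; linarith)
    refine ⟨t, t2, t1, ?_⟩
    -- At level zero, `hw Q 0 = R Q 0` by symmetry, so `hlt` supplies the positivity that `orient`
    -- asks for.
    have o1 := hQ.orient h₁ ht₂ t2 t1 (by
      rintro rfl
      rw [show hw Q 0 = (R Q 0 + R Q (-0)) / 2 from rfl, neg_zero] at hlt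
      linarith)
    have o2 := hQ.mirror.orient
      (by simpa [Set.Nonempty, hQ.mem_fib_mirror] using hQ.fib_neg_nonempty h₁) ht₂ t2 t1 (by
      rintro rfl
      rw [hQ.R_mirror, neg_zero]
      rw [show hw Q 0 = (R Q 0 + R Q (-0)) / 2 from rfl, neg_zero] at hlt
      linarith)
    rw [hQ.R_mirror, hQ.R_mirror, hQ.R_mirror] at o2
    have hab := abs_lt.1 (hQ.abs_sub_lt h₁ ht₂ h21)
    -- Since the midpoint at level `t` is the mean of the other two, right and left ends differ from
    -- the half widths by opposite multiples of `d`; the terms odd in `d` cancel in the sum of `o1`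
    -- and `o2`.
    set d := ((R Q t₂ - R Q (-t₂)) - (R Q t₁ - R Q (-t₁))) / 4 with hd
    have x1 : R Q t - R Q t₂ = (hw Q t - hw Q t₂) - d := by
      rw [hd]; unfold hw; linarith
    have x2 : R Q t - R Q t₁ = (hw Q t - hw Q t₁) + d := by
      rw [hd]; unfold hw; linarith
    have x3 : R Q t₂ - R Q t₁ = (hw Q t₂ - hw Q t₁) + 2 * d := by
      rw [hd]; unfold hw; linarith
    have y1 : R Q (-t) - R Q (-t₂) = (hw Q t - hw Q t₂) + d := by
      rw [hd]; unfold hw; linarith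
    have y2 : R Q (-t) - R Q (-t₁) = (hw Q t - hw Q t₁) - d := by
      rw [hd]; unfold hw; linarith
    have y3 : R Q (-t₂) - R Q (-t₁) = (hw Q t₂ - hw Q t₁) - 2 * d := by
      rw [hd]; unfold hw; linarith
    rw [x1, x2, x3, sin_sub _ d, sin_add _ d, sin_add _ (2 * d)] at o1
    rw [y1, y2, y3, sin_add _ d, sin_sub _ d, sin_sub _ (2 * d)] at o2
    set W := t₂ * sin (hw Q t - hw Q t₁) - t₁ * sin (hw Q t - hw Q t₂) with hW
    have hsum : W * cos d ≤ t * sin (hw Q t₂ - hw Q t₁) * cos (2 * d) := by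
      rw [hW]; linarith
    -- This is the use of `abs_sub_lt`: it gives `|2 * d| < π / 2`.
    have hc2 : 0 < cos (2 * d) := cos_pos_of_mem_Ioo ⟨by rw [hd]; linarith, by rw [hd]; linarith⟩
    have hcc : cos (2 * d) ≤ cos d := by
      rw [← cos_abs d, ← cos_abs (2 * d), abs_mul, abs_two]
      refine cos_le_cos_of_nonneg_of_le_pi (abs_nonneg _) ?_ (by linarith [abs_nonneg d])
      have : |d| ≤ π / 4 := by rw [hd, abs_le]; constructor <;> linarith
      linarith
    have hsN : 0 ≤ t * sin (hw Q t₂ - hw Q t₁) :=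
      mul_nonneg (by linarith) (sin_nonneg_of_nonneg_of_le_pi hN0.le (by linarith [pi_pos]))
    have hfin : W ≤ t * sin (hw Q t₂ - hw Q t₁) := by
      rcases le_total W 0 with hW0 | hW0
      · exact hW0.trans hsN
      · have : W * cos (2 * d) ≤ t * sin (hw Q t₂ - hw Q t₁) * cos (2 * d) :=
          (mul_le_mul_of_nonneg_left hcc hW0).trans hsum
        exact le_of_mul_le_mul_right this hc2
    rw [hW] at hfin
    linarith

end SymCone
end

/-! ### Compactness and convexity of the symmetrised body. -/

noncomputable section

open Real Set Filter Topology

namespace SymCone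

variable {Q : ℝ → ℝ → ℝ → Prop}

theorem hw_lt (hQ : SymCone Q) {t : ℝ} (h : (fib Q t).Nonempty) : hw Q t < π / 2 := by
  have a1 := (hQ.R_mem h).1.2
  have a2 := (hQ.R_mem (hQ.fib_neg_nonempty h)).1.2
  unfold hw; linarith

theorem sym_one_iff (Q : ℝ → ℝ → ℝ → Prop) {l t : ℝ} (hl : l ∈ Ioo (-(π / 2)) (π / 2)) :
    sym Q 1 (tan l) (t / cos l) ↔ (fib Q t).Nonempty ∧ |l| ≤ hw Q t := by
  have hc := cos_pos_of_mem_Ioo hl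
  rw [← sym_polar Q hl (inv_pos.2 hc), inv_mul_cancel₀ hc.ne', tan_eq_sin_div_cos, div_eq_inv_mul,
    div_eq_inv_mul]

/-- Measuring position in a fibre as a fraction of its half width presents the body as a continuous
image of a rectangle. -/
theorem isCompact_sym (hQ : SymCone Q) : IsCompact {q : ℝ × ℝ | sym Q 1 q.1 q.2} := by
  have hlev : IsCompact (Prod.snd '' {q : ℝ × ℝ | q.1 ∈ fib Q q.2}) :=
    hQ.isCompact_graph.image continuous_snd
  obtain ⟨T, ⟨⟨l₀, T'⟩, hT, rfl⟩, hTmax⟩ := hlev.exists_isGreatest ⟨0, (0, 0), hQ.zero_mem_fib, rfl⟩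
  have hT : l₀ ∈ fib Q T' := hT
  have hTmax : ∀ t, (fib Q t).Nonempty → t ≤ T' := fun t ⟨l, hl⟩ => hTmax ⟨(l, t), hl, rfl⟩
  have hT0 : 0 ≤ T' := hTmax 0 ⟨0, hQ.zero_mem_fib⟩
  have hne : (fib Q T').Nonempty := ⟨l₀, hT⟩
  have hdom : ∀ t, (fib Q t).Nonempty ↔ t ∈ Icc (-|T'|) |T'| := by
    intro t
    rw [abs_of_nonneg hT0]
    refine ⟨fun h => ⟨?_, hTmax t h⟩, fun h => ?_⟩
    · have := hTmax (-t) (hQ.fib_neg_nonempty h)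
      linarith
    · exact hQ.fib_nonempty_of_abs_le hne (by rw [abs_of_nonneg hT0]; exact abs_le.2 h)
  have hI : ∀ p ∈ (Icc (-|T'|) |T'|) ×ˢ (Icc (-1 : ℝ) 1),
      p.2 * hw Q p.1 ∈ Ioo (-(π / 2)) (π / 2) ∧ |p.2 * hw Q p.1| ≤ hw Q p.1 := by
    rintro ⟨t, x⟩ ⟨ht, hx⟩
    have h1 := hQ.hw_nonneg ((hdom t).2 ht)
    have h2 := hQ.hw_lt ((hdom t).2 ht)
    have h3 : |x * hw Q t| ≤ hw Q t := by
      rw [abs_mul, abs_of_nonneg h1]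
      exact mul_le_of_le_one_left h1 (abs_le.2 hx)
    have h4 := abs_le.1 h3
    exact ⟨⟨by linarith, by linarith⟩, h3⟩
  have hc : ContinuousOn (fun p : ℝ × ℝ => p.2 * hw Q p.1)
      ((Icc (-|T'|) |T'|) ×ˢ (Icc (-1 : ℝ) 1)) :=
    continuousOn_snd.mul ((hQ.continuousOn_hw hne).comp continuousOn_fst fun p hp => hp.1)
  have hc2 : ContinuousOn (fun p : ℝ × ℝ => (tan (p.2 * hw Q p.1), p.1 / cos (p.2 * hw Q p.1)))
      ((Icc (-|T'|) |T'|) ×ˢ (Icc (-1 : ℝ) 1)) := by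
    refine ContinuousOn.prodMk (continuousOn_tan_Ioo.comp hc fun p hp => (hI p hp).1) ?_
    exact continuousOn_fst.div (continuous_cos.comp_continuousOn hc)
      fun p hp => (cos_pos_of_mem_Ioo (hI p hp).1).ne'
  convert (isCompact_Icc.prod isCompact_Icc).image_of_continuousOn hc2 using 1
  ext ⟨x, y⟩
  constructor
  · intro h
    have h : sym Q 1 x y := h
    obtain ⟨l, hl, r, hr, t, e1, rfl, rfl⟩ := exists_polar one_pos x y
    have hcl := cos_pos_of_mem_Ioo hl
    obtain rfl : r = (cos l)⁻¹ := eq_inv_of_mul_eq_one_left e1.symm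
    nth_rewrite 1 [e1] at h
    obtain ⟨h1, h2⟩ := (sym_polar Q hl hr).1 h
    -- On a fibre of width zero the quotient is `0`, which is the right value since `l = 0` there.
    refine ⟨(t, l / hw Q t), ⟨(hdom t).1 h1, ?_⟩, ?_⟩
    · rw [mem_Icc, ← abs_le, abs_div, abs_of_nonneg (hQ.hw_nonneg h1)]
      exact div_le_one_of_le₀ h2 (hQ.hw_nonneg h1)
    · have : l / hw Q t * hw Q t = l := by
        rcases eq_or_ne (hw Q t) 0 with h0 | h0
        · rw [h0, abs_nonpos_iff] at h2
          simp [h2]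
        · exact div_mul_cancel₀ _ h0
      simp only [this]
      simp only [tan_eq_sin_div_cos, div_eq_inv_mul]
  · rintro ⟨⟨t, a⟩, hp, he⟩
    simp only [Prod.mk.injEq] at he
    obtain ⟨rfl, rfl⟩ := he
    exact (sym_one_iff Q (hI _ hp).1).2 ⟨(hdom t).2 hp.1, (hI _ hp).2⟩

/-- A point of the body above the chord can be shrunk on to it by `sym_shrink`. If one of the given
points is not the end of its fibre, the end of that fibre or of a nearby one serves; if both are
ends, `exists_between` applies. -/
theorem exists_mem_segment (hQ : SymCone Q) {x₁ x₂ y₁ y₂ : ℝ} (hx₁ : 0 ≤ x₁) (hx : x₁ < x₂)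
    (hy₂ : 0 ≤ y₂) (hy : y₂ < y₁) (h₁ : sym Q 1 x₁ y₁) (h₂ : sym Q 1 x₂ y₂) :
    ∃ s : ℝ, 0 < s ∧ s < 1 ∧ sym Q 1 ((1 - s) * x₁ + s * x₂) ((1 - s) * y₁ + s * y₂) := by
  -- it suffices to find a point of the body which lies on or above the segment
  have suff : ∀ x y, sym Q 1 x y → x₁ < x → y₂ < y →
      0 ≤ y₁ * (x - x₂) - y₂ * (x - x₁) + y * (x₂ - x₁) →
      ∃ s : ℝ, 0 < s ∧ s < 1 ∧ sym Q 1 ((1 - s) * x₁ + s * x₂) ((1 - s) * y₁ + s * y₂) := by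
    intro x y hxy h1 h2 h3
    have dx : 0 < x₂ - x₁ := by linarith
    have dy : 0 < y₁ - y₂ := by linarith
    have hle : (y₁ - y) / (y₁ - y₂) ≤ (x - x₁) / (x₂ - x₁) := by
      rw [div_le_div_iff₀ dy dx]
      linarith
    have l1 : 0 < (x - x₁) / (x₂ - x₁) := div_pos (by linarith) dx
    have l2 : (y₁ - y) / (y₁ - y₂) < 1 := (div_lt_one dy).2 (by linarith)
    -- The chord point with parameter `s` is dominated by `(x, y)` in both coordinates precisely
    -- when `s` lies between these two quotients.
    obtain ⟨s, hs0, hs1, hs2, hs3⟩ : ∃ s : ℝ, 0 < s ∧ s < 1 ∧ (y₁ - y) / (y₁ - y₂) ≤ s ∧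
        s ≤ (x - x₁) / (x₂ - x₁) := by
      rcases le_total ((y₁ - y) / (y₁ - y₂)) 0 with h | h
      · refine ⟨min (1 / 2) ((x - x₁) / (x₂ - x₁)), lt_min (by norm_num) l1,
          (min_le_left _ _).trans_lt (by norm_num), ?_, min_le_right _ _⟩
        exact h.trans (le_min (by norm_num) l1.le)
      · rcases h.eq_or_lt with h | h
        · refine ⟨min (1 / 2) ((x - x₁) / (x₂ - x₁)), lt_min (by norm_num) l1,
            (min_le_left _ _).trans_lt (by norm_num), ?_, min_le_right _ _⟩
          rw [← h]
          exact le_min (by norm_num) l1.le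
        · exact ⟨_, h, l2, le_rfl, hle⟩
    refine ⟨s, hs0, hs1, hQ.sym_shrink hxy ?_ ?_⟩
    · rw [le_div_iff₀ dx] at hs3
      rw [abs_of_nonneg (by nlinarith), abs_of_nonneg (by linarith)]
      linarith
    · rw [div_le_iff₀ dy] at hs2
      rw [abs_of_nonneg (by nlinarith), abs_of_nonneg (by linarith)]
      linarith
  obtain ⟨l₁, hl₁, r₁, hr₁, t₁, e1, rfl, rfl⟩ := exists_polar one_pos x₁ y₁
  obtain ⟨l₂, hl₂, r₂, hr₂, t₂, e2, rfl, rfl⟩ := exists_polar one_pos x₂ y₂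
  have c₁ := cos_pos_of_mem_Ioo hl₁
  have c₂ := cos_pos_of_mem_Ioo hl₂
  obtain rfl : r₁ = (cos l₁)⁻¹ := eq_inv_of_mul_eq_one_left e1.symm
  obtain rfl : r₂ = (cos l₂)⁻¹ := eq_inv_of_mul_eq_one_left e2.symm
  clear e1 e2 hr₁ hr₂
  simp only [← div_eq_inv_mul, ← tan_eq_sin_div_cos] at *
  obtain ⟨n₁, b₁⟩ := (sym_one_iff Q hl₁).1 h₁
  obtain ⟨n₂, b₂⟩ := (sym_one_iff Q hl₂).1 h₂
  have hl10 : 0 ≤ l₁ := by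
    by_contra! hn
    exact absurd (tan_neg_of_neg_of_pi_div_two_lt hn hl₁.1) (not_lt.2 hx₁)
  have hl12 : l₁ < l₂ := by
    by_contra! hn
    exact absurd (strictMonoOn_tan.monotoneOn hl₂ hl₁ hn) (not_le.2 hx)
  rw [abs_of_nonneg hl10] at b₁
  rw [abs_of_nonneg (hl10.trans hl12.le)] at b₂
  have c12 : cos l₂ < cos l₁ := cos_lt_cos_of_nonneg_of_le_pi_div_two hl10 hl₂.2.le hl12
  have ht₂ : 0 ≤ t₂ := by
    by_contra! hn
    exact absurd (div_neg_of_neg_of_pos hn c₂) (not_lt.2 hy₂)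
  have ht21 : t₂ < t₁ := by
    rw [div_lt_div_iff₀ c₂ c₁] at hy
    nlinarith
  have ht₁ : 0 < t₁ := by linarith
  -- a point `(l, t)` of the body with `l > l₁` at the level of the first point is enough
  have hw1lt : hw Q t₁ < π / 2 := hQ.hw_lt n₁
  have hw2lt : hw Q t₂ < π / 2 := hQ.hw_lt n₂
  -- The end of the first point's fibre is farther to the right and, in gnomonic coordinates, also
  -- higher.
  rcases b₁.lt_or_eq with b₁ | b₁
  · have hI : hw Q t₁ ∈ Ioo (-(π / 2)) (π / 2) := ⟨by linarith [pi_pos], hw1lt⟩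
    have hx' : tan l₁ < tan (hw Q t₁) := strictMonoOn_tan hl₁ hI b₁
    have hy' : t₁ / cos l₁ < t₁ / cos (hw Q t₁) :=
      div_lt_div_of_pos_left ht₁ (cos_pos_of_mem_Ioo hI)
        (cos_lt_cos_of_nonneg_of_le_pi_div_two hl10 hw1lt.le b₁)
    refine suff _ _ ((sym_one_iff Q hI).2 ⟨n₁, by rw [abs_of_nonneg (hQ.hw_nonneg n₁)]⟩) hx'
      (hy.trans hy') ?_
    nlinarith [mul_pos (sub_pos.2 hx') (sub_pos.2 hy), mul_pos (sub_pos.2 hy') (sub_pos.2 hx)]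
  -- By continuity of `hw`, a slightly higher fibre still reaches beyond `l₂`, and its end exceeds
  -- the second point in both coordinates.
  rcases b₂.lt_or_eq with b₂ | b₂
  · have hcont := hQ.continuousOn_hw n₁
    rw [abs_of_pos ht₁] at hcont
    have hev : ∀ᶠ t in 𝓝[>] t₂, l₂ < hw Q t := by
      have h1 : Tendsto (hw Q) (𝓝[Icc (-t₁) t₁] t₂) (𝓝 (hw Q t₂)) :=
        hcont t₂ ⟨by linarith, by linarith⟩
      have h2 : Tendsto (hw Q) (𝓝[>] t₂) (𝓝 (hw Q t₂)) := by
        refine h1.mono_left (nhdsWithin_le_of_mem ?_)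
        filter_upwards [Ioo_mem_nhdsGT ht21] with t ht
        exact ⟨by linarith [ht.1], ht.2.le⟩
      exact h2.eventually_const_lt b₂
    obtain ⟨t, htl, ht2, ht1⟩ := (hev.and (Ioo_mem_nhdsGT ht21)).exists
    have n : (fib Q t).Nonempty := hQ.fib_nonempty_of_abs_le n₁
      (by rw [abs_of_pos (by linarith), abs_of_pos ht₁]; linarith)
    have hI : hw Q t ∈ Ioo (-(π / 2)) (π / 2) :=
      ⟨by linarith [pi_pos, hQ.hw_nonneg n], hQ.hw_lt n⟩
    have c := cos_pos_of_mem_Ioo hI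
    have hx' : tan l₂ < tan (hw Q t) := strictMonoOn_tan hl₂ hI htl
    have hcc : cos (hw Q t) < cos l₂ :=
      cos_lt_cos_of_nonneg_of_le_pi_div_two (hl10.trans hl12.le) hI.2.le htl
    have hy' : t₂ / cos l₂ < t / cos (hw Q t) := by
      rw [div_lt_div_iff₀ c₂ c]
      nlinarith
    refine suff _ _ ((sym_one_iff Q hI).2 ⟨n, (abs_of_nonneg (hQ.hw_nonneg n)).le⟩)
      (hx.trans hx') hy' ?_
    nlinarith [mul_pos (sub_pos.2 hx') (sub_pos.2 hy), mul_pos (sub_pos.2 hy') (sub_pos.2 hx)]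
  subst b₁ b₂
  rcases hQ.exists_between n₁ ht₂ ht21 hl12 with ⟨h1, h2⟩ | ⟨t, ht2, ht1, hdet⟩
  · set l₁ := hw Q t₁
    set l₂ := hw Q t₂
    have hcN : 0 < cos ((l₂ - l₁) / 2) := cos_pos_of_mem_Ioo ⟨by linarith, by linarith [hl₂.2]⟩
    have hm : (l₁ + l₂) / 2 ∈ Ioo (-(π / 2)) (π / 2) := ⟨by linarith [pi_pos], by linarith⟩
    have hcm := cos_pos_of_mem_Ioo hm
    have key := (sym_one_iff Q hm).2 ⟨h1, by rwa [abs_of_nonneg (by linarith)]⟩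
    have es : sin l₁ + sin l₂ = 2 * sin ((l₁ + l₂) / 2) * cos ((l₂ - l₁) / 2) := by
      have a1 : sin l₁ = sin ((l₁ + l₂) / 2 - (l₂ - l₁) / 2) := by congr 1; ring
      have a2 : sin l₂ = sin ((l₁ + l₂) / 2 + (l₂ - l₁) / 2) := by congr 1; ring
      rw [a1, a2, sin_add, sin_sub]; ring
    have ec : cos l₁ + cos l₂ = 2 * cos ((l₁ + l₂) / 2) * cos ((l₂ - l₁) / 2) := by
      have a1 : cos l₁ = cos ((l₁ + l₂) / 2 - (l₂ - l₁) / 2) := by congr 1; ring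
      have a2 : cos l₂ = cos ((l₁ + l₂) / 2 + (l₂ - l₁) / 2) := by congr 1; ring
      rw [a1, a2, cos_add, cos_sub]; ring
    -- The sum of the two vectors has first coordinate `cos l₁ + cos l₂`; rescaling it to first
    -- coordinate one produces this weight.
    refine ⟨cos l₂ / (cos l₁ + cos l₂), by positivity, (div_lt_one (by positivity)).2 (by linarith),
      ?_⟩
    have e1 : 1 - cos l₂ / (cos l₁ + cos l₂) = cos l₁ / (cos l₁ + cos l₂) := by field_simp; ring
    convert key using 1
    · rw [e1, tan_eq_sin_div_cos, tan_eq_sin_div_cos, tan_eq_sin_div_cos]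
      calc cos l₁ / (cos l₁ + cos l₂) * (sin l₁ / cos l₁) +
            cos l₂ / (cos l₁ + cos l₂) * (sin l₂ / cos l₂)
          = (sin l₁ + sin l₂) / (cos l₁ + cos l₂) := by field_simp
        _ = _ := by rw [es, ec]; field_simp
    · rw [e1]
      calc cos l₁ / (cos l₁ + cos l₂) * (t₁ / cos l₁) +
            cos l₂ / (cos l₁ + cos l₂) * (t₂ / cos l₂)
          = (t₁ + t₂) / (cos l₁ + cos l₂) := by field_simp
        _ = _ := by rw [ec]; field_simp
  · have n : (fib Q t).Nonempty := hQ.fib_nonempty_of_abs_le n₁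
      (by rw [abs_of_pos (by linarith), abs_of_pos ht₁]; linarith)
    have hI : hw Q t ∈ Ioo (-(π / 2)) (π / 2) :=
      ⟨by linarith [pi_pos, hQ.hw_nonneg n], hQ.hw_lt n⟩
    have c := cos_pos_of_mem_Ioo hI
    have hmem := (sym_one_iff Q hI).2 ⟨n, (abs_of_nonneg (hQ.hw_nonneg n)).le⟩
    have hdet' : 0 ≤ t₁ / cos (hw Q t₁) * (tan (hw Q t) - tan (hw Q t₂)) -
        t₂ / cos (hw Q t₂) * (tan (hw Q t) - tan (hw Q t₁)) +
        t / cos (hw Q t) * (tan (hw Q t₂) - tan (hw Q t₁)) := by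
      have : 0 ≤ (t₁ * sin (hw Q t - hw Q t₂) - t₂ * sin (hw Q t - hw Q t₁) +
        t * sin (hw Q t₂ - hw Q t₁)) / (cos (hw Q t₁) * cos (hw Q t₂) * cos (hw Q t)) := by
        positivity
      convert this using 1
      rw [sin_sub, sin_sub, sin_sub, tan_eq_sin_div_cos, tan_eq_sin_div_cos, tan_eq_sin_div_cos]
      field_simp
    refine suff _ _ hmem ?_ ?_ hdet'
    -- If the new end were not to the right of the first point, the determinant would force it to be
    -- at least as high; but its level is smaller and its cosine is not.
    · by_contra! hn
      have hle : hw Q t ≤ hw Q t₁ := by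
        by_contra! h'
        exact absurd (strictMonoOn_tan hl₁ hI h') (not_lt.2 hn)
      have hyy : t₁ / cos (hw Q t₁) ≤ t / cos (hw Q t) := by
        by_contra! h'
        nlinarith [mul_pos (sub_pos.2 h') (sub_pos.2 hx),
          mul_nonneg (sub_nonneg.2 hn) (sub_pos.2 hy).le]
      have hcc : cos (hw Q t₁) ≤ cos (hw Q t) :=
        cos_le_cos_of_nonneg_of_le_pi (hQ.hw_nonneg n) (by linarith [pi_pos]) hle
      rw [div_le_div_iff₀ c₁ c] at hyy
      nlinarith
    · by_contra! hn
      have hxx : tan (hw Q t₂) ≤ tan (hw Q t) := by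
        by_contra! h'
        nlinarith [mul_pos (sub_pos.2 h') (sub_pos.2 hy),
          mul_nonneg (sub_nonneg.2 hn) (sub_pos.2 hx).le]
      have hle : hw Q t₂ ≤ hw Q t := by
        by_contra! h'
        exact absurd (strictMonoOn_tan hI hl₂ h') (not_lt.2 hxx)
      have hcc : cos (hw Q t) ≤ cos (hw Q t₂) :=
        cos_le_cos_of_nonneg_of_le_pi (hQ.hw_nonneg n₂) (by linarith [pi_pos, hI.2]) hle
      rw [div_le_div_iff₀ c c₂] at hn
      nlinarith

/-- The reflections, the triangle inequality and `sym_shrink` reduce to the first quadrant. There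
either one point dominates the chord, or the chord descends and `exists_mem_segment` excludes gaps
in its closed intersection with the body. -/
theorem convex_sym (hQ : SymCone Q) : Convex ℝ {q : ℝ × ℝ | sym Q 1 q.1 q.2} := by
  have quad : ∀ {x₁ y₁ x₂ y₂ : ℝ}, 0 ≤ x₁ → 0 ≤ y₁ → 0 ≤ x₂ → 0 ≤ y₂ → sym Q 1 x₁ y₁ →
      sym Q 1 x₂ y₂ → ∀ {a b : ℝ}, 0 ≤ a → 0 ≤ b → a + b = 1 →
      sym Q 1 (a * x₁ + b * x₂) (a * y₁ + b * y₂) := by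
    intro x₁ y₁ x₂ y₂ hx₁ hy₁ hx₂ hy₂ h₁ h₂ a b ha hb hab
    wlog hx : x₁ ≤ x₂ generalizing x₁ x₂ y₁ y₂ a b
    · have := this hx₂ hy₂ hx₁ hy₁ h₂ h₁ hb ha (by linarith) (le_of_not_ge hx)
      rwa [add_comm (b * x₂), add_comm (b * y₂)] at this
    have hb' : b = 1 - a := by linarith
    subst hb'
    rcases le_or_gt y₁ y₂ with hy | hy
    · refine hQ.sym_shrink h₂ ?_ ?_
      · rw [abs_of_nonneg (by positivity), abs_of_nonneg hx₂]
        nlinarith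
      · rw [abs_of_nonneg (by positivity), abs_of_nonneg hy₂]
        nlinarith
    rcases hx.eq_or_lt with rfl | hx
    · refine hQ.sym_shrink h₁ ?_ ?_
      · rw [abs_of_nonneg (by positivity), abs_of_nonneg hx₂]
        nlinarith
      · rw [abs_of_nonneg (by positivity), abs_of_nonneg hy₁]
        nlinarith
    have hT : IsClosed {s : ℝ | sym Q 1 ((1 - s) * x₁ + s * x₂) ((1 - s) * y₁ + s * y₂)} :=
      hQ.isCompact_sym.isClosed.preimage (f := fun s : ℝ =>
        ((1 - s) * x₁ + s * x₂, (1 - s) * y₁ + s * y₂)) (by fun_prop)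
    have := Icc_subset_of_exists_between hT (by simpa using h₁) (by simpa using h₂) ?_
      (show 1 - a ∈ Icc (0 : ℝ) 1 from ⟨hb, by linarith⟩)
    · simpa using this
    intro p hp q hq h0p hpq hq1
    have hp1 : p ≤ 1 := by linarith
    have h0q : 0 ≤ q := by linarith
    obtain ⟨s, hs0, hs1, hs⟩ := hQ.exists_mem_segment
      (by have := sub_nonneg.2 hp1; positivity)
      (by nlinarith [mul_pos (sub_pos.2 hpq) (sub_pos.2 hx)])
      (by have := sub_nonneg.2 hq1; positivity)
      (by nlinarith [mul_pos (sub_pos.2 hpq) (sub_pos.2 hy)]) hp hq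
    refine ⟨(1 - s) * p + s * q, ?_, by nlinarith, by nlinarith⟩
    have e1 : (1 - ((1 - s) * p + s * q)) * x₁ + ((1 - s) * p + s * q) * x₂ =
      (1 - s) * ((1 - p) * x₁ + p * x₂) + s * ((1 - q) * x₁ + q * x₂) := by ring
    have e2 : (1 - ((1 - s) * p + s * q)) * y₁ + ((1 - s) * p + s * q) * y₂ =
      (1 - s) * ((1 - p) * y₁ + p * y₂) + s * ((1 - q) * y₁ + q * y₂) := by ring
    show sym Q 1 _ _
    rw [e1, e2]
    exact hs
  rintro ⟨x₁, y₁⟩ h₁ ⟨x₂, y₂⟩ h₂ a b ha hb hab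
  have h₁ : sym Q 1 x₁ y₁ := h₁
  have h₂ : sym Q 1 x₂ y₂ := h₂
  have key := quad (abs_nonneg x₁) (abs_nonneg y₁) (abs_nonneg x₂) (abs_nonneg y₂)
    (hQ.sym_abs h₁ (by simp) (by simp)) (hQ.sym_abs h₂ (by simp) (by simp)) ha hb hab
  have tri : ∀ u v : ℝ, |a * u + b * v| ≤ abs (a * |u| + b * |v|) := by
    intro u v
    have h0 : 0 ≤ a * |u| + b * |v| := by positivity
    rw [abs_of_nonneg h0]
    refine (abs_add_le _ _).trans_eq ?_
    rw [abs_mul, abs_mul, abs_of_nonneg ha, abs_of_nonneg hb]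
  exact hQ.sym_shrink key (tri x₁ x₂) (tri y₁ y₂)

/-- The symmetrised body is again convex, compact and symmetric. -/
theorem symCone_sym (hQ : SymCone Q) : SymCone (sym Q) where
  pos h := h.1
  smul hr h := sym_smul hr h
  center := by
    have := (sym_one_iff Q (l := 0) (t := 0) hQ.zero_mem_fib.1).2
      ⟨⟨0, hQ.zero_mem_fib⟩, by simpa using hQ.hw_nonneg ⟨0, hQ.zero_mem_fib⟩⟩
    simpa using this
  neg h := hQ.sym_abs h (abs_neg _) (abs_neg _)
  compact := hQ.isCompact_sym
  add := by
    intro w s t w' s' t' h h'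
    have hw := h.1
    have hw' := h'.1
    have e1 := sym_smul (inv_pos.2 hw) h
    have e2 := sym_smul (inv_pos.2 hw') h'
    rw [inv_mul_cancel₀ hw.ne'] at e1
    rw [inv_mul_cancel₀ hw'.ne'] at e2
    have e3 := hQ.convex_sym (x := (w⁻¹ * s, w⁻¹ * t)) e1 (y := (w'⁻¹ * s', w'⁻¹ * t')) e2
      (a := w / (w + w')) (b := w' / (w + w')) (by positivity) (by positivity) (by field_simp)
    have e4 : sym Q 1 (w / (w + w') * (w⁻¹ * s) + w' / (w + w') * (w'⁻¹ * s'))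
      (w / (w + w') * (w⁻¹ * t) + w' / (w + w') * (w'⁻¹ * t')) := e3
    have e5 := sym_smul (add_pos hw hw') e4
    convert e5 using 1
    · ring
    · field_simp
    · field_simp

end SymCone
end

/-! ### Gnomonic coordinates on the sphere and the Steiner symmetral. -/

noncomputable section

open Real Set Filter Topology MeasureTheory

namespace Sph2

/-- Euclidean `3`-space. -/
local notation "E3" => EuclideanSpace ℝ (Fin 3)

theorem ip_comm (x y : Sph2) : ip x y = ip y x := real_inner_comm _ _

theorem ip_self (x : Sph2) : ip x x = 1 := by
  have : ‖(x : E3)‖ = 1 := by simp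
  rw [ip, real_inner_self_eq_norm_sq, this, one_pow]

theorem mem_hemisphere {x c : Sph2} : x ∈ hemisphere c ↔ 0 < ip x c := by
  simp [hemisphere, sdist, Real.arccos_lt_pi_div_two]

@[fun_prop]
theorem continuous_ip (y : Sph2) : Continuous fun x => ip x y := by
  unfold ip
  fun_prop

namespace Axes

variable {c : Sph2} (A : Axes c)

theorem orthonormal : Orthonormal ℝ ![(c : E3), (A.u : E3), (A.p : E3)] := by
  have h1 : ∀ x : Sph2, ‖(x : E3)‖ = 1 := fun x => by simp
  have h2 : inner ℝ (c : E3) (A.u : E3) = 0 := A.ip_c_u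
  have h3 : inner ℝ (c : E3) (A.p : E3) = 0 := A.ip_c_p
  have h4 : inner ℝ (A.u : E3) (A.p : E3) = 0 := A.ip_u_p
  constructor
  · intro i
    fin_cases i <;> simp [h1]
  · intro i j hij
    fin_cases i <;> fin_cases j <;>
      simp_all [real_inner_comm]

/-- The orthonormal basis `c, u, p`. -/
def basis : OrthonormalBasis (Fin 3) ℝ E3 :=
  OrthonormalBasis.mk A.orthonormal (by
    have := A.orthonormal.linearIndependent.span_eq_top_of_card_eq_finrank (by simp)
    rw [this])

theorem basis_eq : ⇑A.basis = ![(c : E3), (A.u : E3), (A.p : E3)] := by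
  simp [basis]

/-- The vector with the given coordinates. -/
def vec (w s t : ℝ) : E3 := w • (c : E3) + s • (A.u : E3) + t • (A.p : E3)

theorem inner_vec (w s t : ℝ) (x : Sph2) :
    inner ℝ (A.vec w s t) (x : E3) = w * ip x c + s * ip x A.u + t * ip x A.p := by
  simp only [vec, inner_add_left, inner_smul_left, RCLike.conj_to_real]
  rw [show inner ℝ (c : E3) (x : E3) = ip x c from real_inner_comm _ _,
    show inner ℝ (A.u : E3) (x : E3) = ip x A.u from real_inner_comm _ _,
    show inner ℝ (A.p : E3) (x : E3) = ip x A.p from real_inner_comm _ _]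

theorem vec_inj_c (w s t : ℝ) : inner ℝ (A.vec w s t) (c : E3) = w := by
  rw [inner_vec, ip_self, A.ip_c_u, A.ip_c_p]; ring

theorem vec_inj_u (w s t : ℝ) : inner ℝ (A.vec w s t) (A.u : E3) = s := by
  rw [inner_vec, ip_self, ip_comm, A.ip_c_u, A.ip_u_p]; ring

theorem vec_inj_p (w s t : ℝ) : inner ℝ (A.vec w s t) (A.p : E3) = t := by
  rw [inner_vec, ip_self, ip_comm, A.ip_c_p, ip_comm A.p A.u, A.ip_u_p]; ring

theorem norm_vec_sq (w s t : ℝ) : ‖A.vec w s t‖ ^ 2 = w ^ 2 + s ^ 2 + t ^ 2 := by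
  rw [← real_inner_self_eq_norm_sq]
  nth_rewrite 2 [vec]
  rw [inner_add_right, inner_add_right, inner_smul_right, inner_smul_right, inner_smul_right,
    vec_inj_c, vec_inj_u, vec_inj_p]
  ring

theorem eq_vec (v : E3) :
    v = A.vec (inner ℝ v (c : E3)) (inner ℝ v (A.u : E3)) (inner ℝ v (A.p : E3)) := by
  have := A.basis.sum_repr' v
  rw [Fin.sum_univ_three, basis_eq] at this
  simp only [Matrix.cons_val] at this
  rw [vec, real_inner_comm, real_inner_comm _ v, real_inner_comm _ v]
  exact this.symm

theorem coe_eq_vec (x : Sph2) : (x : E3) = A.vec (ip x c) (ip x A.u) (ip x A.p) := A.eq_vec x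

theorem sum_sq (x : Sph2) : ip x c ^ 2 + ip x A.u ^ 2 + ip x A.p ^ 2 = 1 := by
  rw [← A.norm_vec_sq, ← A.coe_eq_vec]
  have : ‖(x : E3)‖ = 1 := by simp
  rw [this, one_pow]

theorem smul_vec (r w s t : ℝ) : r • A.vec w s t = A.vec (r * w) (r * s) (r * t) := by
  simp [vec, smul_smul]

theorem add_vec (w s t w' s' t' : ℝ) :
    A.vec w s t + A.vec w' s' t' = A.vec (w + w') (s + s') (t + t') := by
  simp only [vec, add_smul]; abel

theorem ext_coords {x y : Sph2} (h1 : ip x c = ip y c) (h2 : ip x A.u = ip y A.u)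
    (h3 : ip x A.p = ip y A.p) : x = y := by
  apply Subtype.ext
  rw [A.coe_eq_vec x, A.coe_eq_vec y, h1, h2, h3]

/-- The inverse of the gnomonic projection. -/
def gn (x y : ℝ) : Sph2 :=
  ⟨(√(1 + x ^ 2 + y ^ 2))⁻¹ • A.vec 1 x y, by
    have h0 : 0 < 1 + x ^ 2 + y ^ 2 := by positivity
    rw [mem_sphere_zero_iff_norm, norm_smul, norm_inv, norm_of_nonneg (sqrt_nonneg _)]
    have h : ‖A.vec 1 x y‖ = √(1 + x ^ 2 + y ^ 2) := by
      rw [← sqrt_sq (norm_nonneg (A.vec 1 x y)), norm_vec_sq, one_pow]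
    rw [h, inv_mul_cancel₀ (by positivity)]⟩

theorem coe_gn (x y : ℝ) : (A.gn x y : E3) = (√(1 + x ^ 2 + y ^ 2))⁻¹ • A.vec 1 x y := rfl

theorem ip_gn_c (x y : ℝ) : ip (A.gn x y) c = (√(1 + x ^ 2 + y ^ 2))⁻¹ := by
  rw [ip, coe_gn, inner_smul_left, vec_inj_c]; simp

theorem ip_gn_u (x y : ℝ) : ip (A.gn x y) A.u = (√(1 + x ^ 2 + y ^ 2))⁻¹ * x := by
  rw [ip, coe_gn, inner_smul_left, vec_inj_u]; simp

theorem ip_gn_p (x y : ℝ) : ip (A.gn x y) A.p = (√(1 + x ^ 2 + y ^ 2))⁻¹ * y := by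
  rw [ip, coe_gn, inner_smul_left, vec_inj_p]; simp

theorem gn_mem (x y : ℝ) : A.gn x y ∈ hemisphere c := by
  rw [mem_hemisphere, ip_gn_c]
  have h0 : 0 < 1 + x ^ 2 + y ^ 2 := by positivity
  positivity

theorem gn_eq {x : Sph2} (hx : x ∈ hemisphere c) :
    A.gn (ip x A.u / ip x c) (ip x A.p / ip x c) = x := by
  rw [mem_hemisphere] at hx
  have h : √(1 + (ip x A.u / ip x c) ^ 2 + (ip x A.p / ip x c) ^ 2) = (ip x c)⁻¹ := by
    have e : 1 + (ip x A.u / ip x c) ^ 2 + (ip x A.p / ip x c) ^ 2 = (ip x c)⁻¹ ^ 2 := by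
      field_simp
      exact A.sum_sq x
    rw [e, sqrt_sq (by positivity)]
  apply A.ext_coords
  · rw [ip_gn_c, h, inv_inv]
  · rw [ip_gn_u, h, inv_inv]; field_simp
  · rw [ip_gn_p, h, inv_inv]; field_simp

theorem gn_div_u (x y : ℝ) : ip (A.gn x y) A.u / ip (A.gn x y) c = x := by
  have h0 : 0 < 1 + x ^ 2 + y ^ 2 := by positivity
  rw [ip_gn_u, ip_gn_c]; field_simp

theorem gn_div_p (x y : ℝ) : ip (A.gn x y) A.p / ip (A.gn x y) c = y := by
  have h0 : 0 < 1 + x ^ 2 + y ^ 2 := by positivity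
  rw [ip_gn_p, ip_gn_c]; field_simp

theorem continuous_gn : Continuous fun q : ℝ × ℝ => A.gn q.1 q.2 := by
  have h : Continuous fun q : ℝ × ℝ => (√(1 + q.1 ^ 2 + q.2 ^ 2))⁻¹ • A.vec 1 q.1 q.2 := by
    unfold vec
    have h1 : Continuous fun q : ℝ × ℝ => √(1 + q.1 ^ 2 + q.2 ^ 2) := by fun_prop
    refine (h1.inv₀ fun q => ?_).smul (by fun_prop)
    have h0 : 0 < 1 + q.1 ^ 2 + q.2 ^ 2 := by positivity
    positivity
  exact h.subtype_mk _

theorem continuousOn_gnomonic :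
    ContinuousOn (fun x : Sph2 => (ip x A.u / ip x c, ip x A.p / ip x c)) (hemisphere c) := by
  have h : ∀ x ∈ hemisphere c, ip x c ≠ 0 := fun x hx => (mem_hemisphere.1 hx).ne'
  exact ((continuous_ip _).continuousOn.div (continuous_ip _).continuousOn h).prodMk
    ((continuous_ip _).continuousOn.div (continuous_ip _).continuousOn h)

/-- The cone over `K` in the coordinates of `A`. -/
def cone (K : Set Sph2) (w s t : ℝ) : Prop := 0 < w ∧ A.gn (s / w) (t / w) ∈ K

theorem cone_one (K : Set Sph2) (x y : ℝ) : A.cone K 1 x y ↔ A.gn x y ∈ K := by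
  simp [cone]

theorem cone_coords {K : Set Sph2} {x : Sph2} (hx : x ∈ hemisphere c) :
    A.cone K (ip x c) (ip x A.u) (ip x A.p) ↔ x ∈ K := by
  rw [cone, A.gn_eq hx, and_iff_right (mem_hemisphere.1 hx)]

theorem gn_mem_segment {w s t w' s' t' : ℝ} (hw : 0 < w) (hw' : 0 < w') :
    A.gn ((s + s') / (w + w')) ((t + t') / (w + w')) ∈
      segment (A.gn (s / w) (t / w)) (A.gn (s' / w') (t' / w')) := by
  have key : ∀ x y : ℝ, 0 < √(1 + x ^ 2 + y ^ 2) := fun x y => by positivity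
  have h1 := key (s / w) (t / w)
  have h2 := key (s' / w') (t' / w')
  have h3 := key ((s + s') / (w + w')) ((t + t') / (w + w'))
  refine ⟨(√(1 + ((s + s') / (w + w')) ^ 2 + ((t + t') / (w + w')) ^ 2))⁻¹ * (w / (w + w')) *
    √(1 + (s / w) ^ 2 + (t / w) ^ 2),
    (√(1 + ((s + s') / (w + w')) ^ 2 + ((t + t') / (w + w')) ^ 2))⁻¹ * (w' / (w + w')) *
    √(1 + (s' / w') ^ 2 + (t' / w') ^ 2), by positivity, by positivity, ?_⟩
  simp only [coe_gn, smul_vec, add_vec]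
  congr 1 <;> field_simp

theorem segment_subset_gn {x y z : Sph2} (hx : x ∈ hemisphere c) (hy : y ∈ hemisphere c)
    (hz : z ∈ segment x y) : z ∈ hemisphere c := by
  obtain ⟨a, b, ha, hb, he⟩ := hz
  rw [mem_hemisphere] at *
  have e : ip z c = a * ip x c + b * ip y c := by
    rw [ip, he, inner_add_left, inner_smul_left, inner_smul_left]; rfl
  have hne : a ≠ 0 ∨ b ≠ 0 := by
    by_contra! h
    rw [h.1, h.2, zero_smul, zero_smul, zero_add] at he
    have : ‖(z : E3)‖ = 1 := by simp
    rw [he, norm_zero] at this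
    exact zero_ne_one this
  rw [e]
  rcases hne with h | h
  · have := lt_of_le_of_ne ha h.symm
    positivity
  · have := lt_of_le_of_ne hb h.symm
    positivity

/-- A point of `K` and its reflection add up to a positive multiple of `c`. -/
theorem center_mem {K : Set Sph2} (hK : IsSymmConvexDisk c K) : c ∈ K := by
  obtain ⟨x, hx⟩ := hK.2.1.2.2
  have hx := interior_subset hx
  have hxc := mem_hemisphere.1 (hK.1 hx)
  have hn : ‖(2 * ip x c) • (c : E3) - (x : E3)‖ = 1 := by
    have h1 : ‖(c : E3)‖ = 1 := by simp
    have h2 : ‖(x : E3)‖ = 1 := by simp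
    have h3 : inner ℝ (c : E3) (x : E3) = ip x c := real_inner_comm _ _
    have : ‖(2 * ip x c) • (c : E3) - (x : E3)‖ ^ 2 = 1 := by
      rw [norm_sub_sq_real, inner_smul_left, norm_smul, h1, h2, h3, norm_eq_abs, mul_one, sq_abs]
      simp; ring
    nlinarith [norm_nonneg ((2 * ip x c) • (c : E3) - (x : E3))]
  have hy := hK.2.2 x hx ⟨(2 * ip x c) • (c : E3) - (x : E3), by simpa using hn⟩ rfl
  refine hK.2.1.2.1.2 x hx _ hy ⟨(2 * ip x c)⁻¹, (2 * ip x c)⁻¹, by positivity, by positivity, ?_⟩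
  rw [← smul_add, add_sub_cancel, smul_smul, inv_mul_cancel₀ (by positivity), one_smul]

theorem gn_zero : A.gn 0 0 = c := by
  apply A.ext_coords
  · rw [ip_gn_c, ip_self]; simp
  · rw [ip_gn_u, A.ip_c_u]; simp
  · rw [ip_gn_p, A.ip_c_p]; simp

theorem reflect_gn (x y : ℝ) : (A.gn (-x) (-y) : E3) =
    (2 * ip (A.gn x y) c) • (c : E3) - (A.gn x y : E3) := by
  rw [coe_gn, coe_gn, ip_gn_c, neg_sq, neg_sq]
  set r := (√(1 + x ^ 2 + y ^ 2))⁻¹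
  simp only [vec]
  module

theorem isCompact_cone {K : Set Sph2} (hS : K ⊆ hemisphere c) (hK : IsCompact K) :
    IsCompact {q : ℝ × ℝ | A.cone K 1 q.1 q.2} := by
  convert hK.image_of_continuousOn (A.continuousOn_gnomonic.mono hS) using 1
  ext ⟨x, y⟩
  rw [mem_image]
  constructor
  · intro h
    exact ⟨A.gn x y, (A.cone_one K x y).1 h, by rw [gn_div_u, gn_div_p]⟩
  · rintro ⟨z, hz, he⟩
    simp only [Prod.mk.injEq] at he
    obtain ⟨rfl, rfl⟩ := he
    show A.cone K 1 _ _
    rwa [cone_one, A.gn_eq (hS hz)]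

theorem symCone {K : Set Sph2} (hK : IsSymmConvexDisk c K) : SymCone (A.cone K) where
  pos h := h.1
  add h h' := ⟨add_pos h.1 h'.1, hK.2.1.2.1.2 _ h.2 _ h'.2 (A.gn_mem_segment h.1 h'.1)⟩
  smul hr h := ⟨mul_pos hr h.1, by
    rw [mul_div_mul_left _ _ hr.ne', mul_div_mul_left _ _ hr.ne']; exact h.2⟩
  center := by
    rw [cone_one, gn_zero]; exact center_mem hK
  neg h := ⟨h.1, by
    rw [neg_div, neg_div]
    exact hK.2.2 _ h.2 _ (A.reflect_gn _ _)⟩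
  compact := A.isCompact_cone hK.1 hK.2.1.1

/-- The way back from the cone to the body; it serves both for symmetrals and for Hausdorff limits.
-/
theorem isSymmConvexDisk_of_symCone {X : Set Sph2} (hS : X ⊆ hemisphere c)
    (hX : SymCone (A.cone X)) (hint : (interior X).Nonempty) : IsSymmConvexDisk c X := by
  refine ⟨hS, ⟨?_, ⟨⟨c, hS⟩, ?_⟩, hint⟩, ?_⟩
  · convert hX.compact.image A.continuous_gn using 1
    ext x
    constructor
    · intro hx
      exact ⟨(ip x A.u / ip x c, ip x A.p / ip x c), (A.cone_one _ _ _).2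
        (by rwa [A.gn_eq (hS hx)]), A.gn_eq (hS hx)⟩
    · rintro ⟨⟨a, b⟩, h, rfl⟩
      exact (A.cone_one _ _ _).1 h
  · intro x hx y hy z hz
    have hzS := segment_subset_gn (hS hx) (hS hy) hz
    obtain ⟨a, b, ha, hb, he⟩ := hz
    have hip : ∀ v : Sph2, ip z v = a * ip x v + b * ip y v := fun v => by
      rw [ip, he, inner_add_left, inner_smul_left, inner_smul_left]; rfl
    rw [← A.cone_coords hzS, hip, hip, hip]
    have hab : 0 < a + b := by
      refine lt_of_le_of_ne (by positivity) fun h => ?_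
      have h1 : a = 0 := by linarith
      have h2 : b = 0 := by linarith
      have := mem_hemisphere.1 hzS
      rw [hip, h1, h2] at this
      simp at this
    exact hX.comb ha hb hab ((A.cone_coords (hS hx)).2 hx) ((A.cone_coords (hS hy)).2 hy)
  · intro x hx y hy
    have hip : ∀ v : Sph2, ip y v = 2 * ip x c * ip c v - ip x v := fun v => by
      rw [ip, hy, inner_sub_left, inner_smul_left]; rfl
    have hyc : ip y c = ip x c := by rw [hip, ip_self]; ring
    have hyS : y ∈ hemisphere c := by
      rw [mem_hemisphere, hyc]; exact mem_hemisphere.1 (hS hx)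
    rw [← A.cone_coords hyS, hyc, hip, hip, A.ip_c_u, A.ip_c_p, mul_zero, zero_sub, zero_sub]
    exact hX.neg ((A.cone_coords (hS hx)).2 hx)

/-- The point with longitude `l` on the distance curve whose signed distance from the axis has
tangent `t`. -/
def pt (l t : ℝ) : Sph2 := A.gn (tan l) (t / cos l)

theorem exists_pt {x : Sph2} (hx : x ∈ hemisphere c) :
    ∃ l ∈ Ioo (-(π / 2)) (π / 2), ∃ t, x = A.pt l t := by
  obtain ⟨l, hl, r, hr, t, e1, e2, e3⟩ := SymCone.exists_polar (mem_hemisphere.1 hx)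
    (ip x A.u) (ip x A.p)
  refine ⟨l, hl, t, ?_⟩
  have hc := cos_pos_of_mem_Ioo hl
  rw [← A.gn_eq hx, pt, e1, e2, e3, mul_div_mul_left _ _ hr.ne', mul_div_mul_left _ _ hr.ne',
    tan_eq_sin_div_cos]

theorem sqrt_pt {l : ℝ} (hl : l ∈ Ioo (-(π / 2)) (π / 2)) (t : ℝ) :
    √(1 + tan l ^ 2 + (t / cos l) ^ 2) = √(1 + t ^ 2) / cos l := by
  have hc := cos_pos_of_mem_Ioo hl
  have : 1 + tan l ^ 2 + (t / cos l) ^ 2 = (1 + t ^ 2) / cos l ^ 2 := by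
    rw [tan_eq_sin_div_cos]
    field_simp
    linear_combination sin_sq_add_cos_sq l
  rw [this, sqrt_div (by positivity), sqrt_sq hc.le]

theorem ip_pt_c {l : ℝ} (hl : l ∈ Ioo (-(π / 2)) (π / 2)) (t : ℝ) :
    ip (A.pt l t) c = cos l / √(1 + t ^ 2) := by
  rw [pt, ip_gn_c, sqrt_pt hl, inv_div]

theorem ip_pt_p {l : ℝ} (hl : l ∈ Ioo (-(π / 2)) (π / 2)) (t : ℝ) :
    ip (A.pt l t) A.p = t / √(1 + t ^ 2) := by
  have hc := cos_pos_of_mem_Ioo hl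
  have h0 : 0 < √(1 + t ^ 2) := by positivity
  rw [pt, ip_gn_p, sqrt_pt hl]
  field_simp

theorem pt_mem {l t : ℝ} : A.pt l t ∈ hemisphere c := A.gn_mem _ _

theorem lon_pt {l : ℝ} (hl : l ∈ Ioo (-(π / 2)) (π / 2)) (t : ℝ) : A.lon (A.pt l t) = l := by
  rw [lon, pt, gn_div_u, arctan_tan hl.1 hl.2]

theorem lat_pt {l : ℝ} (hl : l ∈ Ioo (-(π / 2)) (π / 2)) (t : ℝ) :
    A.lat (A.pt l t) = arctan t := by
  rw [lat, ip_pt_p _ hl, arctan_eq_arcsin]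

theorem mem_distCurve_pt {l : ℝ} (hl : l ∈ Ioo (-(π / 2)) (π / 2)) (t s : ℝ) :
    A.pt l t ∈ A.distCurve (arctan s) ↔ t = s := by
  simp only [distCurve, mem_ofPred_eq, A.pt_mem, true_and]
  rw [lat_pt _ hl, arctan_inj]

theorem mem_fib {K : Set Sph2} {l t : ℝ} :
    l ∈ SymCone.fib (A.cone K) t ↔ l ∈ Ioo (-(π / 2)) (π / 2) ∧ A.pt l t ∈ K := by
  refine and_congr_right fun hl => ?_
  rw [cone, and_iff_right (cos_pos_of_mem_Ioo hl), pt, tan_eq_sin_div_cos]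

theorem mem_arc_pt {l : ℝ} (hl : l ∈ Ioo (-(π / 2)) (π / 2)) (t s a b : ℝ) :
    A.pt l t ∈ A.arc (arctan s) a b ↔ t = s ∧ l ∈ Icc a b := by
  simp only [arc, mem_ofPred_eq]
  rw [mem_distCurve_pt _ hl, lon_pt _ hl, mem_Icc]

theorem inter_distCurve_eq_arc_iff {X : Set Sph2} {t a b : ℝ} (ha : -(π / 2) < a) (hb : b < π / 2) :
    X ∩ A.distCurve (arctan t) = A.arc (arctan t) a b ↔ SymCone.fib (A.cone X) t = Icc a b := by
  constructor
  · intro h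
    ext l
    rw [mem_fib]
    constructor
    · rintro ⟨hl, hX⟩
      have : A.pt l t ∈ A.arc (arctan t) a b := h ▸ ⟨hX, (A.mem_distCurve_pt hl t t).2 rfl⟩
      exact ((A.mem_arc_pt hl _ _ _ _).1 this).2
    · intro hl
      have hlI : l ∈ Ioo (-(π / 2)) (π / 2) := ⟨ha.trans_le hl.1, hl.2.trans_lt hb⟩
      have : A.pt l t ∈ A.arc (arctan t) a b := (A.mem_arc_pt hlI _ _ _ _).2 ⟨rfl, hl⟩
      exact ⟨hlI, (h.symm ▸ this : A.pt l t ∈ X ∩ A.distCurve (arctan t)).1⟩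
  · intro h
    ext x
    by_cases hx : x ∈ hemisphere c
    · obtain ⟨l, hl, s, rfl⟩ := A.exists_pt hx
      rw [mem_inter_iff, mem_distCurve_pt _ hl, mem_arc_pt _ hl, and_comm]
      refine and_congr_right ?_
      rintro rfl
      rw [← h, mem_fib, and_iff_right hl]
    · constructor
      · rintro ⟨-, h1, -⟩
        exact absurd h1 hx
      · rintro ⟨⟨h1, -⟩, -⟩
        exact absurd h1 hx

variable {K : Set Sph2}

/-- A nonempty fibre is a closed interval, so the end longitudes `a`, `b` in the definition of the
symmetral are unique and half their difference is `hw`. -/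
theorem pt_mem_steiner (hK : SymCone (A.cone K)) {l : ℝ} (hl : l ∈ Ioo (-(π / 2)) (π / 2)) (t : ℝ) :
    A.pt l t ∈ A.steiner K ↔
      (SymCone.fib (A.cone K) t).Nonempty ∧ |l| ≤ SymCone.hw (A.cone K) t := by
  simp only [steiner, mem_ofPred_eq, A.pt_mem, true_and]
  rw [lat_pt _ hl]
  constructor
  · rintro ⟨a, b, ha, hab, hb, h1, h2⟩
    rw [A.inter_distCurve_eq_arc_iff ha hb] at h1
    have hne : (SymCone.fib (A.cone K) t).Nonempty := h1 ▸ nonempty_Icc.2 hab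
    have h3 := hK.fib_eq_Icc hne
    rw [h1] at h3
    have e1 : a = -SymCone.R (A.cone K) (-t) ∧ b = SymCone.R (A.cone K) t :=
      (Icc_eq_Icc_iff hab).1 h3
    refine ⟨hne, ?_⟩
    have h2 := ((A.mem_arc_pt hl _ _ _ _).1 h2).2
    rw [abs_le, SymCone.hw]
    constructor <;> linarith [h2.1, h2.2, e1.1, e1.2]
  · rintro ⟨hne, h⟩
    have m1 := hK.neg_R_mem hne
    have m2 := hK.R_mem hne
    refine ⟨_, _, m1.1.1, hK.neg_R_le m2, m2.1.2,
      (A.inter_distCurve_eq_arc_iff m1.1.1 m2.1.2).2 (hK.fib_eq_Icc hne),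
      (A.mem_arc_pt hl _ _ _ _).2 ⟨rfl, ?_⟩⟩
    have h := abs_le.1 h
    rw [SymCone.hw] at h
    constructor <;> linarith [h.1, h.2]

theorem cone_steiner (hK : SymCone (A.cone K)) : A.cone (A.steiner K) = SymCone.sym (A.cone K) := by
  ext w s t
  by_cases hw : 0 < w
  · obtain ⟨l, hl, r, hr, t', rfl, rfl, rfl⟩ := SymCone.exists_polar hw s t
    have hc := cos_pos_of_mem_Ioo hl
    rw [SymCone.sym_polar _ hl hr, ← A.pt_mem_steiner hK hl, cone, and_iff_right hw,
      mul_div_mul_left _ _ hr.ne', mul_div_mul_left _ _ hr.ne', pt, tan_eq_sin_div_cos]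
  · exact ⟨fun h => absurd h.1 hw, fun h => absurd h.1 hw⟩

theorem steiner_subset_hemisphere : A.steiner K ⊆ hemisphere c := fun _ h => h.1

/-- Each slice is empty or the continuous image of an interval of longitudes. -/
theorem applicable (hK : IsSymmConvexDisk c K) : A.Applicable K := by
  have hC := A.symCone hK
  refine ⟨hK.1, hK.2.1.1, fun T hT => ?_⟩
  obtain ⟨t, rfl⟩ : ∃ t, T = arctan t := ⟨tan T, (arctan_tan hT.1 hT.2).symm⟩
  rcases (SymCone.fib (A.cone K) t).eq_empty_or_nonempty with he | hne
  · have : K ∩ A.distCurve (arctan t) = ∅ := by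
      ext x
      refine ⟨?_, fun h => absurd h (notMem_empty _)⟩
      rintro ⟨h1, h2⟩
      obtain ⟨l, hl, s, rfl⟩ := A.exists_pt (hK.1 h1)
      obtain rfl := (A.mem_distCurve_pt hl _ _).1 h2
      exact absurd (A.mem_fib.2 ⟨hl, h1⟩) (by simp [he])
    rw [this]
    exact isPreconnected_empty
  · have himg : K ∩ A.distCurve (arctan t) = (fun l => A.pt l t) '' SymCone.fib (A.cone K) t := by
      ext x
      constructor
      · rintro ⟨h1, h2⟩
        obtain ⟨l, hl, s, rfl⟩ := A.exists_pt (hK.1 h1)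
        obtain rfl := (A.mem_distCurve_pt hl _ _).1 h2
        exact ⟨l, A.mem_fib.2 ⟨hl, h1⟩, rfl⟩
      · rintro ⟨l, hl, rfl⟩
        exact ⟨(A.mem_fib.1 hl).2, (A.mem_distCurve_pt hl.1 _ _).2 rfl⟩
    rw [himg]
    have hcont : ContinuousOn (fun l => A.pt l t) (SymCone.fib (A.cone K) t) := by
      show ContinuousOn ((fun q : ℝ × ℝ => A.gn q.1 q.2) ∘ fun l => (tan l, t / cos l)) _
      refine A.continuous_gn.comp_continuousOn (ContinuousOn.prodMk ?_ ?_)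
      · exact continuousOn_tan_Ioo.mono fun l hl => hl.1
      · exact continuousOn_const.div continuous_cos.continuousOn
          fun l hl => (cos_pos_of_mem_Ioo hl.1).ne'
    refine IsPreconnected.image ?_ _ hcont
    rw [hC.fib_eq_Icc hne]
    exact isPreconnected_Icc

end Axes

/-! ### Choice of axes, finiteness and positivity of the area, rotations. -/

theorem exists_orthogonal (v w : E3) :
    ∃ p : Sph2, inner ℝ v (p : E3) = 0 ∧ inner ℝ w (p : E3) = 0 := by
  have hlt : Module.finrank ℝ (Submodule.span ℝ {v, w}) < Module.finrank ℝ E3 := by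
    have h1 : Module.finrank ℝ (Submodule.span ℝ ({v, w} : Set E3)) ≤ 2 := by
      classical
      have := finrank_span_le_card (R := ℝ) ({v, w} : Set E3)
      refine this.trans ?_
      rw [Set.toFinset_card]
      have h2 := Set.ncard_insert_le v {w}
      rw [Set.ncard_singleton] at h2
      rwa [← Nat.card_eq_fintype_card, Nat.card_coe_set_eq]
    simp; omega
  have hne : (Submodule.span ℝ ({v, w} : Set E3))ᗮ ≠ ⊥ := by
    intro h
    rw [Submodule.orthogonal_eq_bot_iff] at h
    rw [h, finrank_top] at hlt
    exact lt_irrefl _ hlt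
  obtain ⟨x, hx, hx0⟩ := Submodule.exists_mem_ne_zero_of_ne_bot hne
  have hn : ‖x‖ ≠ 0 := norm_ne_zero_iff.2 hx0
  rw [Submodule.mem_orthogonal] at hx
  refine ⟨⟨‖x‖⁻¹ • x, ?_⟩, ?_, ?_⟩
  · rw [mem_sphere_zero_iff_norm, norm_smul, norm_inv, norm_norm, inv_mul_cancel₀ hn]
  · show inner ℝ v (‖x‖⁻¹ • x) = 0
    rw [inner_smul_right, hx v (Submodule.subset_span (by simp)), mul_zero]
  · show inner ℝ w (‖x‖⁻¹ • x) = 0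
    rw [inner_smul_right, hx w (Submodule.subset_span (by simp)), mul_zero]

/-- The freedom to prescribe the pole is what later puts two given points on one distance curve. -/
theorem exists_axes {c p : Sph2} (h : ip c p = 0) : ∃ A : Axes c, A.p = p := by
  obtain ⟨u, h1, h2⟩ := exists_orthogonal (c : E3) (p : E3)
  exact ⟨⟨u, p, h1, h, by rw [ip_comm]; exact h2⟩, rfl⟩

theorem nonempty_axes (c : Sph2) : Nonempty (Axes c) := by
  obtain ⟨p, h, -⟩ := exists_orthogonal (c : E3) (c : E3)
  obtain ⟨A, -⟩ := exists_axes (c := c) (p := p) h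
  exact ⟨A⟩

/-- Splitting off `‖a‖⁻¹ • (a - b)` leaves a multiple of `b` of length at most `‖a - b‖`. -/
theorem norm_inv_smul_sub_le {a b : E3} (ha : 1 ≤ ‖a‖) (hb : 1 ≤ ‖b‖) :
    ‖‖a‖⁻¹ • a - ‖b‖⁻¹ • b‖ ≤ 2 * ‖a - b‖ := by
  have ha0 : 0 < ‖a‖ := by linarith
  have hb0 : 0 < ‖b‖ := by linarith
  have e : ‖a‖⁻¹ • a - ‖b‖⁻¹ • b = ‖a‖⁻¹ • (a - b) + (‖a‖⁻¹ - ‖b‖⁻¹) • b := by module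
  have h1 : ‖a‖⁻¹ ≤ 1 := inv_le_one_of_one_le₀ ha
  have h2 : |‖a‖⁻¹ - ‖b‖⁻¹| * ‖b‖ ≤ ‖a - b‖ := by
    have : ‖a‖⁻¹ - ‖b‖⁻¹ = (‖b‖ - ‖a‖) * (‖a‖⁻¹ * ‖b‖⁻¹) := by field_simp
    rw [this, abs_mul, abs_of_pos (show 0 < ‖a‖⁻¹ * ‖b‖⁻¹ by positivity), mul_assoc, mul_assoc,
      inv_mul_cancel₀ hb0.ne', mul_one]
    calc |‖b‖ - ‖a‖| * ‖a‖⁻¹ ≤ |‖b‖ - ‖a‖| * 1 := by gcongr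
      _ ≤ ‖a - b‖ := by rw [mul_one, abs_sub_comm]; exact abs_norm_sub_norm_le _ _
  rw [e]
  refine (norm_add_le _ _).trans ?_
  rw [norm_smul, norm_smul, norm_inv, norm_norm, norm_eq_abs]
  have : ‖a‖⁻¹ * ‖a - b‖ ≤ 1 * ‖a - b‖ := by gcongr
  linarith

namespace Axes

variable {c : Sph2} (A : Axes c)

theorem norm_vec (w s t : ℝ) : ‖A.vec w s t‖ = √(w ^ 2 + s ^ 2 + t ^ 2) := by
  rw [← sqrt_sq (norm_nonneg _), norm_vec_sq]

/-- One factor `2` comes from the normalisation, the other from comparing the Euclidean norm with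
the maximum metric on `ℝ × ℝ`. -/
theorem lipschitzWith_gn : LipschitzWith 4 fun q : ℝ × ℝ => A.gn q.1 q.2 := by
  refine LipschitzWith.of_dist_le_mul fun q r => ?_
  have e : ∀ q : ℝ × ℝ, (A.gn q.1 q.2 : E3) = ‖A.vec 1 q.1 q.2‖⁻¹ • A.vec 1 q.1 q.2 := fun q => by
    rw [coe_gn, norm_vec, one_pow]
  have h1 : ∀ q : ℝ × ℝ, 1 ≤ ‖A.vec 1 q.1 q.2‖ := fun q => by
    rw [norm_vec, one_le_sqrt]
    nlinarith [sq_nonneg q.1, sq_nonneg q.2]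
  rw [Subtype.dist_eq, e, e, dist_eq_norm]
  refine (norm_inv_smul_sub_le (h1 q) (h1 r)).trans ?_
  have h2 : A.vec 1 q.1 q.2 - A.vec 1 r.1 r.2 = A.vec 0 (q.1 - r.1) (q.2 - r.2) := by
    simp only [vec]; module
  have h3 : ‖A.vec 0 (q.1 - r.1) (q.2 - r.2)‖ ≤ |q.1 - r.1| + |q.2 - r.2| := by
    rw [norm_vec]
    refine sqrt_le_iff.2 ⟨by positivity, ?_⟩
    nlinarith [sq_abs (q.1 - r.1), sq_abs (q.2 - r.2), abs_nonneg (q.1 - r.1),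
      abs_nonneg (q.2 - r.2), mul_nonneg (abs_nonneg (q.1 - r.1)) (abs_nonneg (q.2 - r.2))]
  have h4 : |q.1 - r.1| ≤ dist q r := by
    rw [Prod.dist_eq, ← Real.dist_eq]; exact le_max_left _ _
  have h5 : |q.2 - r.2| ≤ dist q r := by
    rw [Prod.dist_eq, ← Real.dist_eq]; exact le_max_right _ _
  rw [h2]
  norm_num
  linarith

theorem hausdorff_gn_image_le (s : Set (ℝ × ℝ)) :
    (μH[2] : Measure Sph2) ((fun q : ℝ × ℝ => A.gn q.1 q.2) '' s) ≤ 16 * volume s := by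
  have := A.lipschitzWith_gn.hausdorffMeasure_image_le (d := 2) (by norm_num) s
  rw [hausdorffMeasure_prod_real] at this
  refine this.trans (le_of_eq ?_)
  norm_num

theorem area_gn_image_eq_zero {s : Set (ℝ × ℝ)} (hs : volume s = 0) :
    area ((fun q : ℝ × ℝ => A.gn q.1 q.2) '' s) = 0 := by
  have h := A.hausdorff_gn_image_le s
  rw [hs, mul_zero, nonpos_iff_eq_zero] at h
  rw [area, Measure.euclideanHausdorffMeasure_def, Measure.smul_apply]
  simp [h]

theorem area_gn_image_lt_top {s : Set (ℝ × ℝ)} (hs : volume s < ⊤) :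
    area ((fun q : ℝ × ℝ => A.gn q.1 q.2) '' s) < ⊤ := by
  have h := (A.hausdorff_gn_image_le s).trans_lt (ENNReal.mul_lt_top (by simp) hs)
  rw [area, Measure.euclideanHausdorffMeasure_def, Measure.smul_apply]
  exact ENNReal.mul_lt_top (by simp) h

end Axes

/-- By compactness it suffices to bound the area near each point, where a Lipschitz image of a
square is a neighbourhood. -/
instance : IsFiniteMeasure (μHE[2] : Measure Sph2) := by
  refine ⟨isCompact_univ.measure_lt_top_of_nhdsWithin fun c _ => ?_⟩
  obtain ⟨A⟩ := nonempty_axes c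
  refine ⟨(fun q : ℝ × ℝ => A.gn q.1 q.2) '' (Icc (-1) 1 ×ˢ Icc (-1) 1), ?_,
    A.area_gn_image_lt_top ?_⟩
  · rw [nhdsWithin_univ]
    have ho : IsOpen (hemisphere c) := by
      simp only [hemisphere, sdist, arccos_lt_pi_div_two]
      exact isOpen_lt continuous_const (continuous_ip c)
    have hc : c ∈ hemisphere c := by rw [mem_hemisphere, ip_self]; exact one_pos
    have h1 := (A.continuousOn_gnomonic c hc).continuousAt (ho.mem_nhds hc)
    have h2 : Icc (-1 : ℝ) 1 ×ˢ Icc (-1 : ℝ) 1 ∈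
        𝓝 ((ip c A.u / ip c c, ip c A.p / ip c c) : ℝ × ℝ) := by
      rw [A.ip_c_u, A.ip_c_p, zero_div]
      exact prod_mem_nhds (Icc_mem_nhds (by norm_num) (by norm_num))
        (Icc_mem_nhds (by norm_num) (by norm_num))
    filter_upwards [h1 h2, ho.mem_nhds hc] with x hx hxS
    exact ⟨_, hx, A.gn_eq hxS⟩
  · exact (isCompact_Icc.prod isCompact_Icc).measure_lt_top

/-- Orthogonal projection along a point of `U` is 1-Lipschitz, and the image of `U` is a
neighbourhood of the origin, of positive Lebesgue measure. -/
theorem area_pos {U : Set Sph2} (hU : IsOpen U) (hne : U.Nonempty) : 0 < area U := by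
  obtain ⟨c, hc⟩ := hne
  obtain ⟨A⟩ := nonempty_axes c
  have hlip : LipschitzWith 1 fun x : Sph2 => (ip x A.u, ip x A.p) := by
    have h : ∀ y : Sph2, LipschitzWith 1 fun x : Sph2 => ip x y := by
      refine fun y => LipschitzWith.of_dist_le_mul fun a b => ?_
      have h1 : ‖(y : E3)‖ = 1 := by simp
      rw [Real.dist_eq, ip, ip, ← inner_sub_left, Subtype.dist_eq, dist_eq_norm]
      refine (abs_real_inner_le_norm _ _).trans ?_
      rw [h1]; simp
    simpa using (h A.u).prodMk (h A.p)
  -- `g` converts coordinates of the orthogonal projection into gnomonic ones, so `f` inverts the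
  -- projection near the origin.
  obtain ⟨g, hg⟩ : ∃ g : ℝ × ℝ → ℝ × ℝ, ∀ q, g q = (q.1 / √(1 - q.1 ^ 2 - q.2 ^ 2),
      q.2 / √(1 - q.1 ^ 2 - q.2 ^ 2)) := ⟨_, fun _ => rfl⟩
  obtain ⟨f, hf⟩ : ∃ f : ℝ × ℝ → Sph2, ∀ q, f q = A.gn (g q).1 (g q).2 := ⟨_, fun _ => rfl⟩
  have hs : ContinuousAt (fun q : ℝ × ℝ => √(1 - q.1 ^ 2 - q.2 ^ 2)) (0, 0) := by fun_prop
  have hgc : ContinuousAt g (0, 0) := by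
    rw [funext hg]
    exact (continuousAt_fst.div hs (by norm_num)).prodMk (continuousAt_snd.div hs (by norm_num))
  have hfc : ContinuousAt f (0, 0) := by
    rw [funext hf]
    exact ContinuousAt.comp (g := fun q : ℝ × ℝ => A.gn q.1 q.2) A.continuous_gn.continuousAt hgc
  have hf0 : f (0, 0) = c := by
    simp [hf, hg, A.gn_zero]
  have hW : f ⁻¹' U ∩ {q | q.1 ^ 2 + q.2 ^ 2 < 1} ∈ 𝓝 ((0, 0) : ℝ × ℝ) := by
    refine inter_mem (hfc (by rw [hf0]; exact hU.mem_nhds hc)) ?_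
    refine IsOpen.mem_nhds (isOpen_lt (by fun_prop) continuous_const) (by norm_num)
  have hsub : f ⁻¹' U ∩ {q | q.1 ^ 2 + q.2 ^ 2 < 1} ⊆
      (fun x : Sph2 => (ip x A.u, ip x A.p)) '' U := by
    rintro ⟨x, y⟩ ⟨h1, h2⟩
    have h2 : x ^ 2 + y ^ 2 < 1 := h2
    refine ⟨_, h1, ?_⟩
    have h0 : 0 < 1 - x ^ 2 - y ^ 2 := by linarith
    have h3 : 0 < √(1 - x ^ 2 - y ^ 2) := sqrt_pos.2 h0
    have e : √(1 + (x / √(1 - x ^ 2 - y ^ 2)) ^ 2 + (y / √(1 - x ^ 2 - y ^ 2)) ^ 2) =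
        (√(1 - x ^ 2 - y ^ 2))⁻¹ := by
      have : 1 + (x / √(1 - x ^ 2 - y ^ 2)) ^ 2 + (y / √(1 - x ^ 2 - y ^ 2)) ^ 2 =
          (√(1 - x ^ 2 - y ^ 2))⁻¹ ^ 2 := by
        rw [div_pow, div_pow, inv_pow, sq_sqrt h0.le]
        field_simp
        ring
      rw [this, sqrt_sq (by positivity)]
    simp only [hf, hg]
    rw [A.ip_gn_u, A.ip_gn_p, e, inv_inv]
    congr 1 <;> field_simp
  have h1 : 0 < volume ((fun x : Sph2 => (ip x A.u, ip x A.p)) '' U) :=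
    (Measure.measure_pos_of_mem_nhds _ hW).trans_le (measure_mono hsub)
  have h2 := hlip.hausdorffMeasure_image_le (d := 2) (by norm_num) U
  rw [hausdorffMeasure_prod_real] at h2
  have h3 : 0 < (μH[2] : Measure Sph2) U := by simpa using h1.trans_le h2
  rw [area, Measure.euclideanHausdorffMeasure_def, Measure.smul_apply]
  have h4 := Measure.addHaarScalarFactor_volume_hausdorffMeasure_ne_zero 2
  rw [ENNReal.smul_def, smul_eq_mul]
  exact ENNReal.mul_pos (by simpa using h4) (by simpa using h3.ne')

namespace Axes

variable {c : Sph2} (A : Axes c)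

/-- The rotation about the axis through the poles. -/
def rot (θ : ℝ) (x : Sph2) : Sph2 :=
  ⟨A.vec (cos θ * ip x c - sin θ * ip x A.u) (sin θ * ip x c + cos θ * ip x A.u) (ip x A.p), by
    rw [mem_sphere_zero_iff_norm, norm_vec, sqrt_eq_one, ← A.sum_sq x]
    linear_combination (ip x c ^ 2 + ip x A.u ^ 2) * sin_sq_add_cos_sq θ⟩

theorem ip_rot_c (θ : ℝ) (x : Sph2) : ip (A.rot θ x) c = cos θ * ip x c - sin θ * ip x A.u :=
  A.vec_inj_c _ _ _

theorem ip_rot_u (θ : ℝ) (x : Sph2) : ip (A.rot θ x) A.u = sin θ * ip x c + cos θ * ip x A.u :=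
  A.vec_inj_u _ _ _

theorem ip_rot_p (θ : ℝ) (x : Sph2) : ip (A.rot θ x) A.p = ip x A.p :=
  A.vec_inj_p _ _ _

theorem rot_neg_rot (θ : ℝ) (x : Sph2) : A.rot θ (A.rot (-θ) x) = x := by
  have := sin_sq_add_cos_sq θ
  apply A.ext_coords <;> simp only [ip_rot_c, ip_rot_u, ip_rot_p, cos_neg, sin_neg]
  · linear_combination ip x c * this
  · linear_combination ip x A.u * this

theorem isometry_rot (θ : ℝ) : Isometry (A.rot θ) := by
  refine Isometry.of_dist_eq fun x y => ?_
  rw [Subtype.dist_eq, Subtype.dist_eq, dist_eq_norm, dist_eq_norm]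
  have e : ∀ w s t w' s' t' : ℝ,
      A.vec w s t - A.vec w' s' t' = A.vec (w - w') (s - s') (t - t') := by
    intros; simp only [vec]; module
  rw [A.coe_eq_vec x, A.coe_eq_vec y]
  simp only [rot]
  rw [e, e, norm_vec, norm_vec]
  congr 1
  linear_combination ((ip x c - ip y c) ^ 2 + (ip x A.u - ip y A.u) ^ 2) * sin_sq_add_cos_sq θ

theorem area_rot_preimage (θ : ℝ) (s : Set Sph2) : area (A.rot θ ⁻¹' s) = area s := by
  have hsurj : Function.Surjective (A.rot θ) := fun x => ⟨_, A.rot_neg_rot θ x⟩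
  rw [area, (A.isometry_rot θ).euclideanHausdorffMeasure_preimage, hsurj.range_eq, inter_univ, area]

end Axes

end Sph2
end

/-! ### Splitting the area into longitude and latitude. -/

noncomputable section

open Real Set Filter Topology MeasureTheory

namespace Sph2

namespace Axes

variable {c : Sph2} (A : Axes c)

/-- The orthogonal projection to the plane of the equator, as a complex number. -/
def eq (x : Sph2) : ℂ := ⟨ip x c, ip x A.u⟩

/-- The longitude on the whole sphere, as an angle. -/
def az (x : Sph2) : AddCircle (2 * π) := ((A.eq x).arg : ℝ)

/-- The tangent of the latitude. -/
def lev (x : Sph2) : ℝ := ip x A.p / √(ip x c ^ 2 + ip x A.u ^ 2)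

theorem measurable_ip (y : Sph2) : Measurable fun x => ip x y := (continuous_ip y).measurable

theorem measurable_eq : Measurable A.eq := by
  have : Continuous A.eq := by
    have h : A.eq = fun x => (ip x c : ℂ) + ip x A.u * Complex.I := by
      ext x
      exact Complex.mk_eq_add_mul_I _ _
    rw [h]
    have h1 := continuous_ip c
    have h2 := continuous_ip A.u
    fun_prop
  exact this.measurable

theorem measurable_az : Measurable A.az :=
  (AddCircle.measurable_mk').comp (Complex.measurable_arg.comp A.measurable_eq)

theorem measurable_lev : Measurable A.lev := by
  have h1 := measurable_ip c
  have h2 := measurable_ip A.u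
  have h3 := measurable_ip A.p
  unfold lev
  fun_prop

theorem eq_rot (θ : ℝ) (x : Sph2) :
    A.eq (A.rot θ x) = (Complex.cos θ + Complex.sin θ * Complex.I) * A.eq x := by
  rw [← Complex.ofReal_cos, ← Complex.ofReal_sin, ← Complex.mk_eq_add_mul_I]
  apply Complex.ext
  · simp [eq, ip_rot_c]
  · simp [eq, ip_rot_u]; ring

theorem az_rot (θ : ℝ) {x : Sph2} (hx : A.eq x ≠ 0) :
    A.az (A.rot θ x) = (θ : AddCircle (2 * π)) + A.az x := by
  have h0 : Complex.cos θ + Complex.sin θ * Complex.I ≠ 0 := by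
    rw [← Complex.exp_mul_I]; exact Complex.exp_ne_zero _
  have h := Complex.arg_mul_coe_angle h0 hx
  have h2 := Complex.arg_cos_add_sin_mul_I_coe_angle (θ : Real.Angle)
  rw [Real.Angle.cos_coe, Real.Angle.sin_coe, Complex.ofReal_cos, Complex.ofReal_sin] at h2
  rw [h2] at h
  rw [az, eq_rot]
  exact h

theorem eq_rot_ne_zero (θ : ℝ) (x : Sph2) : A.eq (A.rot θ x) ≠ 0 ↔ A.eq x ≠ 0 := by
  have h0 : Complex.cos θ + Complex.sin θ * Complex.I ≠ 0 := by
    rw [← Complex.exp_mul_I]; exact Complex.exp_ne_zero _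
  rw [eq_rot]
  simp [h0]

theorem lev_rot (θ : ℝ) (x : Sph2) : A.lev (A.rot θ x) = A.lev x := by
  rw [lev, ip_rot_p, lev]
  congr 2
  rw [ip_rot_c, ip_rot_u]
  linear_combination (ip x c ^ 2 + ip x A.u ^ 2) * sin_sq_add_cos_sq θ

theorem measurableSet_eq_ne_zero : MeasurableSet {x | A.eq x ≠ 0} :=
  (A.measurable_eq (measurableSet_singleton (0 : ℂ))).compl

instance : Fact (0 < 2 * π) := ⟨two_pi_pos⟩

/-- Longitude and latitude are independent with respect to the area. -/
theorem map_az_eq_smul {B : Set ℝ} (hB : MeasurableSet B) :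
    ∃ k : ENNReal, ((μHE[2] : Measure Sph2).restrict ({x | A.eq x ≠ 0} ∩ A.lev ⁻¹' B)).map A.az =
      k • (volume : Measure (AddCircle (2 * π))) := by
  set ν := ((μHE[2] : Measure Sph2).restrict ({x | A.eq x ≠ 0} ∩ A.lev ⁻¹' B)).map A.az with hν
  have hS := A.measurableSet_eq_ne_zero.inter (A.measurable_lev hB)
  have happ : ∀ {J}, MeasurableSet J →
      ν J = area (A.az ⁻¹' J ∩ ({x | A.eq x ≠ 0} ∩ A.lev ⁻¹' B)) := by
    intro J hJ
    rw [hν, Measure.map_apply A.measurable_az hJ, Measure.restrict_apply (A.measurable_az hJ), area]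
  -- The rotation by `θ` preserves the area and the level and translates the longitude by `θ`.
  have hinv : ν.IsAddLeftInvariant := by
    refine ⟨fun g => ?_⟩
    obtain ⟨θ, rfl⟩ := QuotientAddGroup.mk_surjective g
    ext J hJ
    have hJ' : MeasurableSet ((fun a => (θ : AddCircle (2 * π)) + a) ⁻¹' J) :=
      (measurable_const_add _) hJ
    rw [Measure.map_apply (measurable_const_add _) hJ]
    refine (happ hJ').trans ?_
    rw [happ hJ, ← A.area_rot_preimage θ (A.az ⁻¹' J ∩ ({x | A.eq x ≠ 0} ∩ A.lev ⁻¹' B))]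
    congr 1
    ext x
    simp only [mem_inter_iff, mem_preimage, mem_ofPred_eq, lev_rot, eq_rot_ne_zero]
    constructor
    · rintro ⟨h1, h2, h3⟩
      exact ⟨by rwa [az_rot _ _ h2], h2, h3⟩
    · rintro ⟨h1, h2, h3⟩
      exact ⟨by rwa [az_rot _ _ h2] at h1, h2, h3⟩
  refine ⟨_, Measure.isAddInvariant_eq_smul_of_compactSpace ν
    (volume : Measure (AddCircle (2 * π)))⟩

/-- Longitude in `(-π, π]` and latitude are independent with respect to the area. -/
theorem map_arg_lev : ∃ m : Measure ℝ, IsFiniteMeasure m ∧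
    ((μHE[2] : Measure Sph2).restrict {x | A.eq x ≠ 0}).map (fun x => ((A.eq x).arg, A.lev x)) =
      (volume.restrict (Ioc (-π) π)).prod m := by
  set m₀ := ((μHE[2] : Measure Sph2).restrict {x | A.eq x ≠ 0}).map A.lev with hm₀
  have hpi : ENNReal.ofReal (2 * π) ≠ 0 := by simpa using pi_pos
  -- The circle has total mass `2 * π`; dividing by it leaves plain Lebesgue measure in the
  -- longitude.
  refine ⟨(ENNReal.ofReal (2 * π))⁻¹ • m₀, ?_, ?_⟩
  · exact Measure.smul_finite _ (ENNReal.inv_ne_top.2 hpi)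
  have : IsFiniteMeasure ((ENNReal.ofReal (2 * π))⁻¹ • m₀) :=
    Measure.smul_finite _ (ENNReal.inv_ne_top.2 hpi)
  have hmeas : Measurable fun x => ((A.eq x).arg, A.lev x) :=
    (Complex.measurable_arg.comp A.measurable_eq).prodMk A.measurable_lev
  refine (Measure.prod_eq fun J B hJ hB => ?_).symm
  obtain ⟨k, hk⟩ := A.map_az_eq_smul hB
  have hk1 := congrArg (fun ν => ν univ) hk
  simp only [Measure.map_apply A.measurable_az MeasurableSet.univ, Measure.smul_apply,
    AddCircle.measure_univ, preimage_univ, Measure.restrict_apply MeasurableSet.univ, univ_inter,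
    smul_eq_mul] at hk1
  have hmB : m₀ B = k * ENNReal.ofReal (2 * π) := by
    rw [← hk1, hm₀, Measure.map_apply A.measurable_lev hB,
      Measure.restrict_apply (A.measurable_lev hB), inter_comm]
  -- the set of angles with representative in `J`
  set r : AddCircle (2 * π) → ℝ :=
    fun a => (AddCircle.measurableEquivIoc (2 * π) (-π) a : ℝ) with hr
  have hrm : Measurable r := measurable_subtype_coe.comp (MeasurableEquiv.measurable _)
  have hrmk : ∀ l ∈ Ioc (-π) π, r (l : AddCircle (2 * π)) = l := by
    intro l hl
    have hl' : l ∈ Ioc (-π) (-π + 2 * π) := by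
      rwa [show -π + 2 * π = π by ring]
    have := (AddCircle.measurableEquivIoc (2 * π) (-π)).apply_symm_apply ⟨l, hl'⟩
    exact congrArg Subtype.val this
  have hraz : ∀ x, r (A.az x) = (A.eq x).arg := fun x => hrmk _ (Complex.arg_mem_Ioc _)
  have hk2 := congrArg (fun ν => ν (r ⁻¹' J)) hk
  simp only [Measure.map_apply A.measurable_az (hrm hJ), Measure.smul_apply, smul_eq_mul,
    Measure.restrict_apply (A.measurable_az (hrm hJ))] at hk2
  have hvol : volume (r ⁻¹' J) = volume.restrict (Ioc (-π) π) J := by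
    rw [← (AddCircle.measurePreserving_mk (2 * π) (-π)).map_eq,
      Measure.map_apply AddCircle.measurable_mk' (hrm hJ),
      Measure.restrict_apply (AddCircle.measurable_mk' (hrm hJ)),
      Measure.restrict_apply hJ, show -π + 2 * π = π by ring]
    congr 1
    ext l
    simp only [mem_inter_iff, mem_preimage]
    constructor
    · rintro ⟨h1, h2⟩
      exact ⟨by rwa [hrmk l h2] at h1, h2⟩
    · rintro ⟨h1, h2⟩
      exact ⟨by rwa [hrmk l h2], h2⟩
  rw [Measure.map_apply hmeas (hJ.prod hB), Measure.restrict_apply (hmeas (hJ.prod hB)),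
    Measure.smul_apply, smul_eq_mul, hmB, ← hvol]
  have e : (fun x => ((A.eq x).arg, A.lev x)) ⁻¹' J ×ˢ B ∩ {x | A.eq x ≠ 0} =
      A.az ⁻¹' (r ⁻¹' J) ∩ ({x | A.eq x ≠ 0} ∩ A.lev ⁻¹' B) := by
    ext x
    simp only [mem_inter_iff, mem_preimage, mem_prod, hraz]
    tauto
  rw [e, hk2, mul_comm k (ENNReal.ofReal (2 * π)), ← mul_assoc (ENNReal.ofReal (2 * π))⁻¹,
    ENNReal.inv_mul_cancel hpi ENNReal.ofReal_ne_top, one_mul, mul_comm]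

theorem arg_lev_pt {l : ℝ} (hl : l ∈ Ioo (-(π / 2)) (π / 2)) (t : ℝ) :
    (A.eq (A.pt l t)).arg = l ∧ A.lev (A.pt l t) = t := by
  have hc := cos_pos_of_mem_Ioo hl
  have h0 : 0 < √(1 + t ^ 2) := by positivity
  have hu : ip (A.pt l t) A.u = sin l / √(1 + t ^ 2) := by
    rw [pt, ip_gn_u, sqrt_pt hl, tan_eq_sin_div_cos]; field_simp
  constructor
  · rw [eq, A.ip_pt_c hl, hu]
    have := Complex.arg_mul_cos_add_sin_mul_I (r := (√(1 + t ^ 2))⁻¹) (by positivity) (θ := l)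
      ⟨by linarith [hl.1, pi_pos], by linarith [hl.2, pi_pos]⟩
    refine Eq.trans ?_ this
    congr 1
    apply Complex.ext
    · simp [← Complex.ofReal_cos, ← Complex.ofReal_sin, div_eq_inv_mul]
      exact Or.inl (by field_simp)
    · simp [← Complex.ofReal_cos, ← Complex.ofReal_sin, div_eq_inv_mul]
      exact Or.inl (by field_simp)
  · rw [lev, A.ip_pt_c hl, hu, A.ip_pt_p hl]
    have : (cos l / √(1 + t ^ 2)) ^ 2 + (sin l / √(1 + t ^ 2)) ^ 2 = (√(1 + t ^ 2))⁻¹ ^ 2 := by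
      field_simp
      linear_combination sin_sq_add_cos_sq l
    rw [this, sqrt_sq (by positivity)]
    field_simp

theorem measurable_pt : Measurable fun q : ℝ × ℝ => A.pt q.1 q.2 := by
  have h1 : Measurable fun q : ℝ × ℝ => (tan q.1, q.2 / cos q.1) := by
    refine Measurable.prodMk ?_ (by fun_prop)
    simp only [tan_eq_sin_div_cos]
    fun_prop
  show Measurable ((fun q : ℝ × ℝ => A.gn q.1 q.2) ∘ fun q : ℝ × ℝ => (tan q.1, q.2 / cos q.1))
  exact A.continuous_gn.measurable.comp h1

theorem measurableSet_fib {X : Set Sph2} (hX : MeasurableSet X) :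
    MeasurableSet {q : ℝ × ℝ | q.1 ∈ SymCone.fib (A.cone X) q.2} := by
  have : {q : ℝ × ℝ | q.1 ∈ SymCone.fib (A.cone X) q.2} =
      Prod.fst ⁻¹' Ioo (-(π / 2)) (π / 2) ∩ (fun q : ℝ × ℝ => A.pt q.1 q.2) ⁻¹' X := by
    ext q
    exact A.mem_fib
  rw [this]
  exact (measurable_fst measurableSet_Ioo).inter (A.measurable_pt hX)

/-- The area as an integral of the lengths of the fibres. -/
theorem exists_area_eq_lintegral : ∃ m : Measure ℝ, IsFiniteMeasure m ∧
    ∀ X ⊆ hemisphere c, MeasurableSet X →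
      area X = ∫⁻ t, volume (SymCone.fib (A.cone X) t) ∂m := by
  obtain ⟨m, hm, h⟩ := A.map_arg_lev
  refine ⟨m, hm, fun X hS hX => ?_⟩
  have hmeas : Measurable fun x => ((A.eq x).arg, A.lev x) :=
    (Complex.measurable_arg.comp A.measurable_eq).prodMk A.measurable_lev
  have hF := A.measurableSet_fib hX
  have h1 := congrArg (fun ν => ν {q : ℝ × ℝ | q.1 ∈ SymCone.fib (A.cone X) q.2}) h
  simp only [Measure.map_apply hmeas hF, Measure.restrict_apply (hmeas hF)] at h1
  rw [Measure.prod_apply_symm hF] at h1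
  have e1 : (fun x => ((A.eq x).arg, A.lev x)) ⁻¹' {q : ℝ × ℝ | q.1 ∈ SymCone.fib (A.cone X) q.2} ∩
      {x | A.eq x ≠ 0} = X := by
    ext x
    constructor
    · rintro ⟨h2, h3⟩
      obtain ⟨h4, h5⟩ := A.mem_fib.1 h2
      have hx : x ∈ hemisphere c := by
        rw [mem_hemisphere]
        have h6 := Complex.abs_arg_lt_pi_div_two_iff.1 (abs_lt.2 h4)
        rcases h6 with h6 | h6
        · exact h6
        · exact absurd h6 h3
      obtain ⟨l, hl, t, rfl⟩ := A.exists_pt hx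
      dsimp only at h5
      rwa [(A.arg_lev_pt hl t).1, (A.arg_lev_pt hl t).2] at h5
    · intro hx
      have h0 : A.eq x ≠ 0 := fun h0 => by
        have := mem_hemisphere.1 (hS hx)
        have h7 := congrArg Complex.re h0
        simp only [eq, Complex.zero_re] at h7
        linarith
      obtain ⟨l, hl, t, rfl⟩ := A.exists_pt (hS hx)
      refine ⟨?_, h0⟩
      show (A.eq (A.pt l t)).arg ∈ SymCone.fib (A.cone X) (A.lev (A.pt l t))
      rw [(A.arg_lev_pt hl t).1, (A.arg_lev_pt hl t).2]
      exact A.mem_fib.2 ⟨hl, hx⟩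
  rw [e1] at h1
  rw [area, h1]
  refine lintegral_congr fun t => ?_
  have e2 : (fun l => (l, t)) ⁻¹' {q : ℝ × ℝ | q.1 ∈ SymCone.fib (A.cone X) q.2} =
      SymCone.fib (A.cone X) t := rfl
  have hFt : MeasurableSet (SymCone.fib (A.cone X) t) := measurable_prodMk_right hF
  rw [e2, Measure.restrict_apply hFt]
  congr 1
  refine inter_eq_left.2 fun l hl => ?_
  exact ⟨by linarith [hl.1.1, pi_pos], by linarith [hl.1.2, pi_pos]⟩

end Axes

end Sph2
end

/-! ### Caps, and the effect of symmetrization on areas and overlaps. -/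

noncomputable section

open Real Set Filter Topology MeasureTheory

namespace Sph2

/-- The cap with centre `c`, in terms of the height over the plane orthogonal to `c`. -/
def disk (c : Sph2) (κ : ℝ) : Set Sph2 := {x | κ ≤ ip x c}

theorem mem_disk {c x : Sph2} {κ : ℝ} : x ∈ disk c κ ↔ κ ≤ ip x c := Iff.rfl

theorem ip_le_one (x y : Sph2) : ip x y ≤ 1 := by
  have := real_inner_le_norm (x : EuclideanSpace ℝ (Fin 3)) (y : EuclideanSpace ℝ (Fin 3))
  simpa [ip] using this

theorem neg_one_le_ip (x y : Sph2) : -1 ≤ ip x y := by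
  have := neg_le_of_abs_le
    (abs_real_inner_le_norm (x : EuclideanSpace ℝ (Fin 3)) (y : EuclideanSpace ℝ (Fin 3)))
  simpa [ip] using this

theorem cap_eq_disk (c : Sph2) {r : ℝ} (h0 : 0 ≤ r) (hr : r ≤ π) : cap c r = disk c (cos r) := by
  ext x
  rw [cap, mem_ofPred_eq, sdist, mem_disk]
  constructor
  · intro h
    have := cos_le_cos_of_nonneg_of_le_pi (arccos_nonneg _) hr h
    rwa [cos_arccos (neg_one_le_ip _ _) (ip_le_one _ _)] at this
  · intro h
    have := arccos_le_arccos h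
    rwa [arccos_cos h0 hr] at this

theorem disk_subset_hemisphere {c : Sph2} {κ : ℝ} (hκ : 0 < κ) : disk c κ ⊆ hemisphere c :=
  fun _ hx => mem_hemisphere.2 (hκ.trans_le hx)

theorem isClosed_disk (c : Sph2) (κ : ℝ) : IsClosed (disk c κ) :=
  isClosed_le continuous_const (continuous_ip c)

theorem isOpen_hemisphere (c : Sph2) : IsOpen (hemisphere c) := by
  have : hemisphere c = {x | 0 < ip x c} := by ext; exact mem_hemisphere
  rw [this]
  exact isOpen_lt continuous_const (continuous_ip c)

theorem isSymmConvexDisk_disk (c : Sph2) {κ : ℝ} (hκ : 0 < κ) (hκ1 : κ < 1) :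
    IsSymmConvexDisk c (disk c κ) := by
  refine ⟨disk_subset_hemisphere hκ, ⟨(isClosed_disk c κ).isCompact,
    ⟨⟨c, disk_subset_hemisphere hκ⟩, ?_⟩, ?_⟩, ?_⟩
  · rintro x hx y hy z ⟨a, b, ha, hb, he⟩
    have e : ip z c = a * ip x c + b * ip y c := by
      rw [ip, he, inner_add_left, inner_smul_left, inner_smul_left]; rfl
    have h1 : 1 ≤ a + b := by
      have hz : ‖(z : EuclideanSpace ℝ (Fin 3))‖ = 1 := by simp
      rw [he] at hz
      rw [← hz]
      refine (norm_add_le _ _).trans ?_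
      simp [norm_smul, abs_of_nonneg ha, abs_of_nonneg hb]
    rw [mem_disk] at *
    rw [e]
    nlinarith [mul_le_mul_of_nonneg_left hx ha, mul_le_mul_of_nonneg_left hy hb]
  · have ho : IsOpen {x : Sph2 | κ < ip x c} := isOpen_lt continuous_const (continuous_ip c)
    have hsub : {x : Sph2 | κ < ip x c} ⊆ disk c κ := fun x (hx : κ < ip x c) => hx.le
    refine ⟨c, interior_maximal hsub ho ?_⟩
    show κ < ip c c
    rwa [ip_self]
  · intro x hx y hy
    have : ip y c = ip x c := by
      rw [ip, hy, inner_sub_left, inner_smul_left]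
      show 2 * ip x c * ip c c - ip x c = ip x c
      rw [ip_self]; ring
    rwa [mem_disk, this]

namespace Axes

variable {c : Sph2} (A : Axes c) {K X Y : Set Sph2}

open SymCone

theorem mem_fib_disk {κ l t : ℝ} :
    l ∈ fib (A.cone (disk c κ)) t ↔ l ∈ Ioo (-(π / 2)) (π / 2) ∧ κ * √(1 + t ^ 2) ≤ cos l := by
  rw [mem_fib]
  refine and_congr_right fun hl => ?_
  have h0 : 0 < √(1 + t ^ 2) := by positivity
  rw [mem_disk, A.ip_pt_c hl, le_div_iff₀ h0]

/-- On a fibre a cap bounds `cos l` from below, and the half width, a mean of the two end values,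
does not exceed the larger one. -/
theorem steiner_subset_disk (hX : SymCone (A.cone X)) {κ : ℝ} (h : X ⊆ disk c κ) :
    A.steiner X ⊆ disk c κ := by
  intro y hy
  obtain ⟨l, hl, t, rfl⟩ := A.exists_pt (A.steiner_subset_hemisphere hy)
  obtain ⟨hne, hle⟩ := (A.pt_mem_steiner hX hl t).1 hy
  have m1 := hX.R_mem hne
  have m2 := hX.neg_R_mem hne
  have key : ∀ {z}, z ∈ fib (A.cone X) t → κ * √(1 + t ^ 2) ≤ cos z := fun hz =>
    (A.mem_fib_disk.1 (A.mem_fib.2 ⟨hz.1, h (A.mem_fib.1 hz).2⟩)).2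
  have k1 := key m1
  have k2 := key m2
  have h0 : 0 < √(1 + t ^ 2) := by positivity
  rw [mem_disk, A.ip_pt_c hl, le_div_iff₀ h0, ← cos_abs]
  unfold hw at hle
  rcases le_total (R (A.cone X) t) (R (A.cone X) (-t)) with h1 | h1
  · rw [cos_neg] at k2
    refine k2.trans (cos_le_cos_of_nonneg_of_le_pi (abs_nonneg _) ?_ (by linarith))
    linarith [m2.1.1, pi_pos]
  · refine k1.trans (cos_le_cos_of_nonneg_of_le_pi (abs_nonneg _) ?_ (by linarith))
    linarith [m1.1.2, pi_pos]

/-- Fibres of a cap are centred, and a fibre that contains `l` and `-l` has half width at least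
`|l|`. -/
theorem disk_subset_steiner (hX : SymCone (A.cone X)) {κ : ℝ} (hκ : 0 < κ) (h : disk c κ ⊆ X) :
    disk c κ ⊆ A.steiner X := by
  intro y hy
  obtain ⟨l, hl, t, rfl⟩ := A.exists_pt (disk_subset_hemisphere hκ hy)
  have hy' := (A.mem_fib_disk.1 (A.mem_fib.2 ⟨hl, hy⟩)).2
  have habs := abs_lt.2 hl
  have m1 : |l| ∈ fib (A.cone X) t := by
    have : |l| ∈ fib (A.cone (disk c κ)) t :=
      A.mem_fib_disk.2 ⟨⟨by linarith [abs_nonneg l, pi_pos], habs⟩, by rwa [cos_abs]⟩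
    exact A.mem_fib.2 ⟨this.1, h (A.mem_fib.1 this).2⟩
  have m2 : -|l| ∈ fib (A.cone X) t := by
    have : -|l| ∈ fib (A.cone (disk c κ)) t :=
      A.mem_fib_disk.2 ⟨⟨by linarith, by linarith [abs_nonneg l, pi_pos]⟩,
        by rwa [cos_neg, cos_abs]⟩
    exact A.mem_fib.2 ⟨this.1, h (A.mem_fib.1 this).2⟩
  refine (A.pt_mem_steiner hX hl t).2 ⟨⟨_, m1⟩, ?_⟩
  have := hX.le_R m1
  have := hX.neg_R_le m2
  unfold hw
  linarith

/-- Convexity is `symCone_sym`; the cap inside keeps the interior nonempty. -/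
theorem isSymmConvexDisk_steiner (hX : IsSymmConvexDisk c X) {κ : ℝ} (hκ : 0 < κ) (hκ1 : κ < 1)
    (h : disk c κ ⊆ X) : IsSymmConvexDisk c (A.steiner X) := by
  refine A.isSymmConvexDisk_of_symCone A.steiner_subset_hemisphere ?_ ?_
  · rw [A.cone_steiner (A.symCone hX)]
    exact symCone_sym (A.symCone hX)
  · exact (isSymmConvexDisk_disk c hκ hκ1).2.1.2.2.mono
      (interior_mono (A.disk_subset_steiner (A.symCone hX) hκ h))

theorem steiner_disk {κ : ℝ} (hκ : 0 < κ) (hκ1 : κ < 1) : A.steiner (disk c κ) = disk c κ := by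
  have h := A.symCone (isSymmConvexDisk_disk c hκ hκ1)
  exact (A.steiner_subset_disk h subset_rfl).antisymm (A.disk_subset_steiner h hκ subset_rfl)

theorem fib_steiner (hX : SymCone (A.cone X)) {t : ℝ} (h : (fib (A.cone X) t).Nonempty) :
    fib (A.cone (A.steiner X)) t = Icc (-hw (A.cone X) t) (hw (A.cone X) t) := by
  have h1 := hX.hw_lt h
  ext l
  rw [mem_fib]
  constructor
  · rintro ⟨hl, h2⟩
    exact abs_le.1 ((A.pt_mem_steiner hX hl t).1 h2).2
  · intro hl
    have hl' : l ∈ Ioo (-(π / 2)) (π / 2) := ⟨by linarith [hl.1], by linarith [hl.2]⟩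
    exact ⟨hl', (A.pt_mem_steiner hX hl' t).2 ⟨h, abs_le.2 hl⟩⟩

theorem fib_steiner_eq_empty (hX : SymCone (A.cone X)) {t : ℝ} (h : fib (A.cone X) t = ∅) :
    fib (A.cone (A.steiner X)) t = ∅ := by
  refine eq_empty_of_forall_notMem fun l hl => ?_
  have hl := A.mem_fib.1 hl
  have := ((A.pt_mem_steiner hX hl.1 t).1 hl.2).1
  rw [h] at this
  exact not_nonempty_empty this

theorem volume_fib_steiner (hX : SymCone (A.cone X)) (t : ℝ) :
    volume (fib (A.cone (A.steiner X)) t) = volume (fib (A.cone X) t) := by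
  rcases (fib (A.cone X) t).eq_empty_or_nonempty with h | h
  · rw [h, A.fib_steiner_eq_empty hX h]
  · rw [A.fib_steiner hX h, hX.fib_eq_Icc h, volume_Icc, volume_Icc, hw]
    congr 1; ring

theorem fib_inter (X Y : Set Sph2) (t : ℝ) :
    fib (A.cone (X ∩ Y)) t = fib (A.cone X) t ∩ fib (A.cone Y) t := by
  ext l
  simp only [mem_inter_iff, mem_fib]
  tauto

/-- The fibres of two symmetrals are nested. -/
theorem volume_fib_steiner_inter (hX : SymCone (A.cone X)) (hY : SymCone (A.cone Y)) (t : ℝ) :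
    volume (fib (A.cone (A.steiner X ∩ A.steiner Y)) t) =
      min (volume (fib (A.cone X) t)) (volume (fib (A.cone Y) t)) := by
  rw [fib_inter, ← A.volume_fib_steiner hX, ← A.volume_fib_steiner hY]
  have hsub : fib (A.cone (A.steiner X)) t ⊆ fib (A.cone (A.steiner Y)) t ∨
      fib (A.cone (A.steiner Y)) t ⊆ fib (A.cone (A.steiner X)) t := by
    rcases (fib (A.cone X) t).eq_empty_or_nonempty with h | h
    · rw [A.fib_steiner_eq_empty hX h]; exact Or.inl (empty_subset _)
    rcases (fib (A.cone Y) t).eq_empty_or_nonempty with h' | h'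
    · rw [A.fib_steiner_eq_empty hY h']; exact Or.inr (empty_subset _)
    rw [A.fib_steiner hX h, A.fib_steiner hY h']
    rcases le_total (hw (A.cone X) t) (hw (A.cone Y) t) with h1 | h1
    · exact Or.inl (Icc_subset_Icc (by linarith) h1)
    · exact Or.inr (Icc_subset_Icc (by linarith) h1)
  rcases hsub with h | h
  · rw [inter_eq_left.2 h, min_eq_left (measure_mono h)]
  · rw [inter_eq_right.2 h, min_eq_right (measure_mono h)]

theorem volume_fib_inter_le (X Y : Set Sph2) (t : ℝ) : volume (fib (A.cone (X ∩ Y)) t) ≤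
    min (volume (fib (A.cone X) t)) (volume (fib (A.cone Y) t)) := by
  rw [fib_inter]
  exact le_min (measure_mono inter_subset_left) (measure_mono inter_subset_right)

theorem continuousOn_pt (t : ℝ) : ContinuousOn (fun l => A.pt l t) (Ioo (-(π / 2)) (π / 2)) := by
  show ContinuousOn ((fun q : ℝ × ℝ => A.gn q.1 q.2) ∘ fun l => (tan l, t / cos l)) _
  refine A.continuous_gn.comp_continuousOn (ContinuousOn.prodMk continuousOn_tan_Ioo ?_)
  exact continuousOn_const.div continuous_cos.continuousOn fun l hl => (cos_pos_of_mem_Ioo hl).ne'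

theorem volume_fib_pos {U : Set Sph2} (hU : IsOpen U) {t : ℝ} (h : (fib (A.cone U) t).Nonempty) :
    0 < volume (fib (A.cone U) t) := by
  have : fib (A.cone U) t = Ioo (-(π / 2)) (π / 2) ∩ (fun l => A.pt l t) ⁻¹' U := by
    ext l; exact A.mem_fib
  have ho : IsOpen (fib (A.cone U) t) := by
    rw [this]
    exact (A.continuousOn_pt t).isOpen_inter_preimage isOpen_Ioo hU
  exact ho.measure_pos _ h

theorem fib_mono (h : X ⊆ Y) (t : ℝ) : fib (A.cone X) t ⊆ fib (A.cone Y) t :=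
  fun _ hl => A.mem_fib.2 ⟨hl.1, h (A.mem_fib.1 hl).2⟩

theorem volume_fib_lt_top (X : Set Sph2) (t : ℝ) : volume (fib (A.cone X) t) < ⊤ :=
  (measure_mono (fun _ hl => hl.1)).trans_lt
    (measure_Ioo_lt_top (a := -(π / 2)) (b := π / 2))

theorem volume_fib_inter_lt {t : ℝ}
    (h : (fib (A.cone (interior (Y \ X))) t).Nonempty) :
    volume (fib (A.cone (X ∩ Y)) t) < volume (fib (A.cone Y) t) := by
  have h1 := A.volume_fib_pos isOpen_interior h
  have hd : Disjoint (fib (A.cone (X ∩ Y)) t) (fib (A.cone (interior (Y \ X))) t) := by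
    rw [Set.disjoint_left]
    intro l hl hl'
    exact (interior_subset (A.mem_fib.1 hl').2).2 (A.mem_fib.1 hl).2.1
  have hm : MeasurableSet (fib (A.cone (interior (Y \ X))) t) :=
    measurable_prodMk_right (A.measurableSet_fib isOpen_interior.measurableSet)
  have h2 : volume (fib (A.cone (X ∩ Y)) t) + volume (fib (A.cone (interior (Y \ X))) t) ≤
      volume (fib (A.cone Y) t) := by
    rw [← measure_union hd hm]
    exact measure_mono (union_subset (A.fib_mono inter_subset_right t)
      (A.fib_mono (interior_subset.trans sdiff_subset) t))
  exact (ENNReal.lt_add_right (A.volume_fib_lt_top _ t).ne h1.ne').trans_le h2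

theorem measurable_volume_fib (hX : MeasurableSet X) :
    Measurable fun t => volume (fib (A.cone X) t) :=
  measurable_measure_prodMk_right (A.measurableSet_fib hX)

/-- Symmetrization preserves the area. -/
theorem area_steiner (hX : IsSymmConvexDisk c X) (hS : IsSymmConvexDisk c (A.steiner X)) :
    area (A.steiner X) = area X := by
  obtain ⟨m, -, hm⟩ := A.exists_area_eq_lintegral
  rw [hm _ hS.1 hS.2.1.1.measurableSet, hm _ hX.1 hX.2.1.1.measurableSet]
  exact lintegral_congr fun t => A.volume_fib_steiner (A.symCone hX) t

/-- Symmetrization does not decrease the area of the intersection. -/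
theorem area_inter_le (hX : IsSymmConvexDisk c X) (hS : IsSymmConvexDisk c (A.steiner X))
    (hY : IsSymmConvexDisk c Y) (hT : IsSymmConvexDisk c (A.steiner Y)) :
    area (X ∩ Y) ≤ area (A.steiner X ∩ A.steiner Y) := by
  obtain ⟨m, -, hm⟩ := A.exists_area_eq_lintegral
  rw [hm _ (inter_subset_left.trans hS.1) (hS.2.1.1.measurableSet.inter hT.2.1.1.measurableSet),
    hm _ (inter_subset_left.trans hX.1) (hX.2.1.1.measurableSet.inter hY.2.1.1.measurableSet)]
  refine lintegral_mono fun t => ?_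
  rw [A.volume_fib_steiner_inter (A.symCone hX) (A.symCone hY)]
  exact A.volume_fib_inter_le _ _ _

theorem continuousOn_lev : ContinuousOn A.lev (hemisphere c) := by
  unfold lev
  have h1 := continuous_ip c
  have h2 := continuous_ip A.u
  have h3 := continuous_ip A.p
  refine h3.continuousOn.div (by fun_prop) fun x hx => ?_
  have := mem_hemisphere.1 hx
  positivity

theorem continuous_pt_right (l : ℝ) : Continuous fun t => A.pt l t := by
  show Continuous ((fun q : ℝ × ℝ => A.gn q.1 q.2) ∘ fun t => (tan l, t / cos l))
  exact A.continuous_gn.comp (by fun_prop)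

/-- Symmetrization increases the area of the intersection if some distance curve meets the interiors
of both differences. -/
theorem area_inter_lt (hX : IsSymmConvexDisk c X) (hS : IsSymmConvexDisk c (A.steiner X))
    (hY : IsSymmConvexDisk c Y) (hT : IsSymmConvexDisk c (A.steiner Y)) {x y : Sph2}
    (hx : x ∈ interior (X \ Y)) (hy : y ∈ interior (Y \ X)) (hxy : ip x A.p = ip y A.p) :
    area (X ∩ Y) < area (A.steiner X ∩ A.steiner Y) := by
  have hxS : x ∈ hemisphere c := hX.1 (interior_subset hx).1
  have hyS : y ∈ hemisphere c := hY.1 (interior_subset hy).1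
  obtain ⟨lx, hlx, t, rfl⟩ := A.exists_pt hxS
  obtain ⟨ly, hly, t', rfl⟩ := A.exists_pt hyS
  have ht : t = t' := by
    have := congrArg arcsin hxy
    rw [← lat, ← lat, A.lat_pt hlx, A.lat_pt hly] at this
    exact arctan_injective this
  subst ht
  -- `T` consists of the levels at which the meridian of `y` is in the interior of `Y \ X`, and `V`
  -- of the points inside `X \ Y` at such levels. At every level of `V` neither fibre contains the
  -- other, and positive area of `V` gives these levels positive measure.
  set T : Set ℝ := {s | A.pt ly s ∈ interior (Y \ X)} with hTdef
  have hTo : IsOpen T := isOpen_interior.preimage (A.continuous_pt_right ly)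
  set V : Set Sph2 := (hemisphere c ∩ A.lev ⁻¹' T) ∩ interior (X \ Y) with hV
  have hVo : IsOpen V :=
    (A.continuousOn_lev.isOpen_inter_preimage (isOpen_hemisphere c) hTo).inter isOpen_interior
  have hVpos : 0 < area V := by
    refine area_pos hVo ⟨A.pt lx t, ⟨hxS, ?_⟩, hx⟩
    show A.lev (A.pt lx t) ∈ T
    rw [(A.arg_lev_pt hlx t).2]
    exact hy
  obtain ⟨m, hmf, hm⟩ := A.exists_area_eq_lintegral
  have hmX := hX.2.1.1.measurableSet
  have hmY := hY.2.1.1.measurableSet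
  have hmXY := hmX.inter hmY
  rw [hm V (fun z hz => hz.1.1) hVo.measurableSet] at hVpos
  have hfin : area (X ∩ Y) ≠ ⊤ := (measure_lt_top (μHE[2] : Measure Sph2) _).ne
  rw [hm _ (inter_subset_left.trans hX.1) hmXY] at hfin
  rw [hm _ (inter_subset_left.trans hS.1) (hS.2.1.1.measurableSet.inter hT.2.1.1.measurableSet),
    hm _ (inter_subset_left.trans hX.1) hmXY]
  simp only [A.volume_fib_steiner_inter (A.symCone hX) (A.symCone hY)]
  have hmeas : MeasurableSet {s | volume (fib (A.cone V) s) ≠ 0} :=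
    (A.measurable_volume_fib hVo.measurableSet) (measurableSet_singleton 0).compl
  refine lintegral_strict_mono_of_ae_le_of_ae_lt_on (s := {s | volume (fib (A.cone V) s) ≠ 0})
    ((A.measurable_volume_fib hmX).min (A.measurable_volume_fib hmY)).aemeasurable hfin
    (ae_of_all _ fun s => A.volume_fib_inter_le _ _ _) ?_ (ae_of_all _ fun s hs => ?_)
  · intro h0
    have : (∫⁻ s, volume (fib (A.cone V) s) ∂m) = 0 := by
      rw [lintegral_eq_zero_iff (A.measurable_volume_fib hVo.measurableSet)]
      exact h0
    exact hVpos.ne' this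
  · obtain ⟨l, hl⟩ : (fib (A.cone V) s).Nonempty := by
      rw [nonempty_iff_ne_empty]
      rintro he
      exact hs (by rw [he, measure_empty])
    have hlV := (A.mem_fib.1 hl).2
    refine lt_min ?_ ?_
    · rw [inter_comm]
      exact A.volume_fib_inter_lt ⟨l, A.mem_fib.2 ⟨hl.1, hlV.2⟩⟩
    · refine A.volume_fib_inter_lt ⟨ly, A.mem_fib.2 ⟨hly, ?_⟩⟩
      have h1 : A.lev (A.pt l s) ∈ T := hlV.1.2
      rwa [(A.arg_lev_pt hl.1 s).2] at h1

end Axes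

end Sph2
end

/-! ### Interior, boundary and area of symmetric convex disks. -/

noncomputable section

open Real Set Filter Topology MeasureTheory

namespace Sph2

theorem dist_sq (x y : Sph2) : dist x y ^ 2 = 2 - 2 * ip x y := by
  have h1 : ‖(x : EuclideanSpace ℝ (Fin 3))‖ = 1 := by simp
  have h2 : ‖(y : EuclideanSpace ℝ (Fin 3))‖ = 1 := by simp
  rw [Subtype.dist_eq, dist_eq_norm, norm_sub_sq_real, h1, h2, ip]
  ring

/-- The chord of an arc `θ` is `2 * sin (θ / 2)`, and Jordan's inequality bounds the sine from
below. -/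
theorem sdist_le (x y : Sph2) : sdist x y ≤ π / 2 * dist x y := by
  have h0 : 0 ≤ sdist x y := arccos_nonneg _
  have h1 : sdist x y ≤ π := arccos_le_pi _
  have h2 : cos (sdist x y) = ip x y := cos_arccos (neg_one_le_ip _ _) (ip_le_one _ _)
  have h3 : 2 / π * (sdist x y / 2) ≤ sin (sdist x y / 2) := mul_le_sin (by linarith) (by linarith)
  have h4 : dist x y = 2 * sin (sdist x y / 2) := by
    have h5 : 0 ≤ sin (sdist x y / 2) := sin_nonneg_of_nonneg_of_le_pi (by linarith) (by linarith)
    have h6 := cos_sq' (sdist x y / 2)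
    have h7 := cos_two_mul (sdist x y / 2)
    rw [mul_div_cancel₀ _ two_ne_zero, h2] at h7
    have h8 := dist_sq x y
    exact (sq_eq_sq₀ dist_nonneg (by positivity)).1 (by nlinarith)
  have h5 := mul_le_mul_of_nonneg_left h3 pi_pos.le
  have h6 : π * (2 / π * (sdist x y / 2)) = sdist x y := by field_simp
  rw [h4]
  linarith

namespace Axes

variable {c : Sph2} {X : Set Sph2}

open SymCone

theorem convex_cone_one (A : Axes c) (hX : SymCone (A.cone X)) :
    Convex ℝ {q : ℝ × ℝ | A.cone X 1 q.1 q.2} := by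
  intro x hx y hy a b ha hb hab
  have := hX.comb ha hb (by linarith) hx hy
  rw [mul_one, mul_one, hab] at this
  exact this

theorem gn_mem_interior (A : Axes c) {q : ℝ × ℝ}
    (hq : q ∈ interior {q : ℝ × ℝ | A.cone X 1 q.1 q.2}) :
    A.gn q.1 q.2 ∈ interior X := by
  have ho := A.continuousOn_gnomonic.isOpen_inter_preimage (isOpen_hemisphere c)
    (isOpen_interior (s := {q : ℝ × ℝ | A.cone X 1 q.1 q.2}))
  refine interior_maximal ?_ ho ⟨A.gn_mem _ _, ?_⟩
  · rintro x ⟨hx, hx'⟩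
    have h1 : (ip x A.u / ip x c, ip x A.p / ip x c) ∈ {q : ℝ × ℝ | A.cone X 1 q.1 q.2} :=
      interior_subset hx'
    have := (A.cone_one _ _ _).1 h1
    rwa [A.gn_eq hx] at this
  · rw [mem_preimage, gn_div_u, gn_div_p]
    exact hq

theorem interior_cone_one_nonempty (A : Axes c) (hX : IsSymmConvexDisk c X) :
    (interior {q : ℝ × ℝ | A.cone X 1 q.1 q.2}).Nonempty := by
  obtain ⟨x, hx⟩ := hX.2.1.2.2
  have hxS := hX.1 (interior_subset hx)
  have hsub : (fun q : ℝ × ℝ => A.gn q.1 q.2) ⁻¹' interior X ⊆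
      {q : ℝ × ℝ | A.cone X 1 q.1 q.2} := fun q hq =>
    (A.cone_one _ _ _).2 (interior_subset (s := X) hq)
  refine ⟨(ip x A.u / ip x c, ip x A.p / ip x c),
    interior_maximal hsub (isOpen_interior.preimage A.continuous_gn) ?_⟩
  rwa [mem_preimage, A.gn_eq hxS]

/-- In the gnomonic plane the origin is the midpoint of an interior point and its reflection. -/
theorem center_mem_interior (A : Axes c) (hX : IsSymmConvexDisk c X) : c ∈ interior X := by
  have hC := A.symCone hX
  have hconv := (A.convex_cone_one hC).interior
  obtain ⟨q, hq⟩ := A.interior_cone_one_nonempty hX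
  set S := {q : ℝ × ℝ | A.cone X 1 q.1 q.2} with hS
  have hneg : -q ∈ interior S := by
    refine interior_maximal (s := S) (t := (fun q => -q) ⁻¹' interior S) ?_
      (isOpen_interior.preimage continuous_neg) (by simpa using hq)
    intro r hr
    have h1 : A.cone X 1 (-r.1) (-r.2) := interior_subset (s := S) hr
    have h2 := hC.neg h1
    rw [neg_neg, neg_neg] at h2
    exact h2
  have h0 := hconv hq hneg (show (0 : ℝ) ≤ 1 / 2 by norm_num) (show (0 : ℝ) ≤ 1 / 2 by norm_num)
    (by norm_num)
  rw [smul_neg, add_neg_cancel] at h0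
  have := A.gn_mem_interior h0
  rwa [Prod.fst_zero, Prod.snd_zero, gn_zero] at this

/-- The frontier of a convex set in the gnomonic plane is null, and `gn` maps null sets to null
sets. -/
theorem area_sdiff_interior (A : Axes c) (hX : IsSymmConvexDisk c X) :
    area (X \ interior X) = 0 := by
  have hfr := (A.convex_cone_one (A.symCone hX)).addHaar_frontier volume
  refine measure_mono_null (t := _) ?_ (A.area_gn_image_eq_zero hfr)
  rintro x ⟨hx, hx'⟩
  have hxS := hX.1 hx
  refine ⟨(ip x A.u / ip x c, ip x A.p / ip x c), ⟨subset_closure ?_, fun h => hx' ?_⟩, A.gn_eq hxS⟩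
  · exact (A.cone_one _ _ _).2 (by rwa [A.gn_eq hxS])
  · have := A.gn_mem_interior h
    rwa [A.gn_eq hxS] at this

theorem subset_closure_interior (A : Axes c) (hX : IsSymmConvexDisk c X) :
    X ⊆ closure (interior X) := by
  intro x hx
  have hxS := hX.1 hx
  have h1 := (A.convex_cone_one (A.symCone hX)).closure_interior_eq_closure_of_nonempty_interior
    (A.interior_cone_one_nonempty hX)
  have h2 : (ip x A.u / ip x c, ip x A.p / ip x c) ∈
      closure (interior {q : ℝ × ℝ | A.cone X 1 q.1 q.2}) := by
    rw [h1]
    exact subset_closure ((A.cone_one _ _ _).2 (by rwa [A.gn_eq hxS]))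
  have h3 := map_mem_closure A.continuous_gn h2 (t := interior X) fun q hq => A.gn_mem_interior hq
  rwa [A.gn_eq hxS] at h3

/-- Each fibre of the circle has at most two points. -/
theorem area_circle (A : Axes c) {κ : ℝ} (hκ : 0 < κ) : area {x | ip x c = κ} = 0 := by
  obtain ⟨m, -, hm⟩ := A.exists_area_eq_lintegral
  have hs : {x : Sph2 | ip x c = κ} ⊆ hemisphere c :=
    fun x (hx : ip x c = κ) => mem_hemisphere.2 (hx ▸ hκ)
  rw [hm _ hs (isClosed_eq (continuous_ip c) continuous_const).measurableSet]
  rw [lintegral_congr (g := fun _ => 0) fun t => ?_, lintegral_zero]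
  have hsub : fib (A.cone {x | ip x c = κ}) t ⊆
      {arccos (κ * √(1 + t ^ 2)), -arccos (κ * √(1 + t ^ 2))} := by
    intro l hl
    have h1 : ip (A.pt l t) c = κ := (A.mem_fib.1 hl).2
    have h0 : 0 < √(1 + t ^ 2) := by positivity
    rw [A.ip_pt_c hl.1, div_eq_iff h0.ne'] at h1
    have h2 := hl.1
    rw [← h1, ← cos_abs, arccos_cos (abs_nonneg _) (by linarith [abs_lt.2 h2, pi_pos])]
    rcases abs_choice l with h | h
    · exact Or.inl h.symm
    · exact Or.inr (by rw [h]; simp)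
  exact (((finite_singleton _).insert _).subset hsub).measure_zero _

end Axes

theorem exists_disk_subset {c : Sph2} {K : Set Sph2} (hK : IsSymmConvexDisk c K) :
    ∃ κ, 0 < κ ∧ κ < 1 ∧ disk c κ ⊆ K := by
  obtain ⟨A⟩ := nonempty_axes c
  obtain ⟨ε, hε, h⟩ := Metric.mem_nhds_iff.1
    (mem_interior_iff_mem_nhds.1 (A.center_mem_interior hK))
  -- By `dist_sq` this height bounds the squared distance from `c` by `ε ^ 2 / 2`; the `1 / 2` keeps
  -- the height positive.
  refine ⟨max (1 / 2) (1 - ε ^ 2 / 4), by positivity, max_lt (by norm_num) (by nlinarith), ?_⟩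
  intro x hx
  have h1 : 1 - ε ^ 2 / 4 ≤ ip x c := (le_max_right _ _).trans hx
  refine h (Metric.mem_ball.2 ?_)
  have := dist_sq x c
  exact lt_of_pow_lt_pow_left₀ 2 hε.le (by nlinarith [pow_pos hε 2])

theorem exists_subset_disk {c : Sph2} {K : Set Sph2} (hK : IsSymmConvexDisk c K) :
    ∃ κ, 0 < κ ∧ κ < 1 ∧ K ⊆ disk c κ := by
  have hc := Axes.center_mem hK
  obtain ⟨x, hx, hmin⟩ := hK.2.1.1.exists_isMinOn ⟨c, hc⟩ (continuous_ip c).continuousOn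
  have := mem_hemisphere.1 (hK.1 hx)
  refine ⟨min (1 / 2) (ip x c), by positivity, (min_le_left _ _).trans_lt (by norm_num), ?_⟩
  exact fun y hy => (min_le_right _ _).trans (isMinOn_iff.1 hmin y hy)

theorem exists_ip_eq (c : Sph2) {v : ℝ} (h : v ^ 2 ≤ 1) : ∃ x : Sph2, ip x c = v := by
  obtain ⟨A⟩ := nonempty_axes c
  refine ⟨⟨A.vec v (√(1 - v ^ 2)) 0, ?_⟩, A.vec_inj_c _ _ _⟩
  rw [mem_sphere_zero_iff_norm, A.norm_vec, sq_sqrt (by linarith), sqrt_eq_one]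
  ring

theorem area_disk_lt (c : Sph2) {κ κ' : ℝ} (h : κ < κ') (h0 : -1 ≤ κ) (h1 : κ' ≤ 1) :
    area (disk c κ') < area (disk c κ) := by
  have ho : IsOpen {x : Sph2 | κ < ip x c ∧ ip x c < κ'} :=
    (isOpen_lt continuous_const (continuous_ip c)).inter
      (isOpen_lt (continuous_ip c) continuous_const)
  obtain ⟨x, hx⟩ := exists_ip_eq c (v := (κ + κ') / 2)
    (by rw [sq_le_one_iff_abs_le_one, abs_le]; constructor <;> linarith)
  have hpos := area_pos ho ⟨x, by rw [mem_ofPred_eq, hx]; constructor <;> linarith⟩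
  have hd : Disjoint (disk c κ') {x : Sph2 | κ < ip x c ∧ ip x c < κ'} :=
    Set.disjoint_left.2 fun x hx hx' => not_lt.2 hx hx'.2
  have hle : area (disk c κ') + area {x : Sph2 | κ < ip x c ∧ ip x c < κ'} ≤ area (disk c κ) := by
    unfold area
    rw [← measure_union hd ho.measurableSet]
    refine measure_mono (union_subset (fun x hx => h.le.trans hx) fun x hx => hx.1.le)
  exact (ENNReal.lt_add_right (measure_lt_top (μHE[2] : Measure Sph2) _).ne hpos.ne').trans_le hle

/-- The indicators of nearby caps converge off the boundary circle, which is null. -/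
theorem continuousAt_area_disk (c : Sph2) {κ : ℝ} (hκ : 0 < κ) :
    ContinuousAt (fun κ => area (disk c κ)) κ := by
  obtain ⟨A⟩ := nonempty_axes c
  refine tendsto_measure_of_ae_tendsto_indicator_of_isFiniteMeasure (𝓝 κ)
    (isClosed_disk c κ).measurableSet (fun κ => (isClosed_disk c κ).measurableSet) ?_
  have h0 : ∀ᵐ x ∂(μHE[2] : Measure Sph2), ip x c ≠ κ := by
    rw [ae_iff]
    simpa [area] using A.area_circle hκ
  filter_upwards [h0] with x hx
  rcases hx.lt_or_gt with h | h
  · filter_upwards [lt_mem_nhds h] with v hv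
    exact ⟨fun h' => absurd hv (not_lt.2 h'), fun h' => absurd h (not_lt.2 h')⟩
  · filter_upwards [gt_mem_nhds h] with v hv
    exact ⟨fun _ => h.le, fun _ => hv.le⟩

theorem exists_area_disk_eq {c : Sph2} {K : Set Sph2} (hK : IsSymmConvexDisk c K) :
    ∃ κ, 0 < κ ∧ κ < 1 ∧ area (disk c κ) = area K := by
  obtain ⟨κ₁, h1, h1', hs1⟩ := exists_subset_disk hK
  obtain ⟨κ₂, h2, h2', hs2⟩ := exists_disk_subset hK
  have hc : ContinuousOn (fun κ => area (disk c κ)) (uIcc κ₁ κ₂) := fun κ hκ =>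
    (continuousAt_area_disk c ((lt_min h1 h2).trans_le hκ.1)).continuousWithinAt
  obtain ⟨κ, hκ, he⟩ := intermediate_value_uIcc hc
    (mem_uIcc_of_ge (measure_mono hs2) (measure_mono hs1))
  exact ⟨κ, (lt_min h1 h2).trans_le hκ.1, hκ.2.trans_lt (max_lt h1' h2'), he⟩

/-- Two convex disks of the same area that differ have points in the interiors of both
differences. -/
theorem interior_sdiff_nonempty {c : Sph2} {X Y : Set Sph2} (hX : IsSymmConvexDisk c X)
    (hY : IsSymmConvexDisk c Y) (h : area X = area Y) (hne : X ≠ Y) :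
    (interior (X \ Y)).Nonempty := by
  obtain ⟨A⟩ := nonempty_axes c
  have key : ∀ {X Y : Set Sph2}, IsSymmConvexDisk c X → IsSymmConvexDisk c Y → ¬ X ⊆ Y →
      (interior (X \ Y)).Nonempty := by
    intro X Y hX hY h
    obtain ⟨x, hx, hxY⟩ := not_subset.1 h
    have hYo : IsOpen Yᶜ := hY.2.1.1.isClosed.isOpen_compl
    obtain ⟨z, hz, hz'⟩ := mem_closure_iff.1 (A.subset_closure_interior hX hx) _ hYo hxY
    have hsub : Yᶜ ∩ interior X ⊆ X \ Y := fun w hw => ⟨interior_subset hw.2, hw.1⟩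
    exact ⟨z, interior_maximal hsub (hYo.inter isOpen_interior) ⟨hz, hz'⟩⟩
  by_cases hs : X ⊆ Y
  · exfalso
    have hpos := area_pos isOpen_interior (key hY hX fun h' => hne (hs.antisymm h'))
    have hle : area X + area (interior (Y \ X)) ≤ area Y := by
      unfold area
      rw [← measure_union (Set.disjoint_left.2 fun x hx hx' => (interior_subset hx').2 hx)
        isOpen_interior.measurableSet]
      exact measure_mono (union_subset hs (interior_subset.trans sdiff_subset))
    rw [h] at hle
    exact absurd hle (not_le.2 (ENNReal.lt_add_right
      (measure_lt_top (μHE[2] : Measure Sph2) _).ne hpos.ne'))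
  · exact key hX hY hs

end Sph2
end

/-! ### Hausdorff limits of symmetric convex disks. -/

noncomputable section

open Real Set Filter Topology MeasureTheory

namespace Sph2

/-- Convergence of a sequence of sets in the Hausdorff metric. -/
structure HausdorffLimit (X : ℕ → Set Sph2) (Z : Set Sph2) : Prop where
  exists_near : ∀ ε > 0, ∀ᶠ n in atTop, ∀ x ∈ X n, ∃ y ∈ Z, dist x y < ε
  exists_near' : ∀ ε > 0, ∀ᶠ n in atTop, ∀ y ∈ Z, ∃ x ∈ X n, dist x y < ε

namespace HausdorffLimit

variable {X : ℕ → Set Sph2} {Z : Set Sph2}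

theorem mem (h : HausdorffLimit X Z) (hZ : IsClosed Z) {f : ℕ → Sph2} {x : Sph2}
    (hf : ∀ n, f n ∈ X n) (hx : Tendsto f atTop (𝓝 x)) : x ∈ Z := by
  rw [← hZ.closure_eq, Metric.mem_closure_iff]
  intro ε hε
  obtain ⟨n, h1, h2⟩ := ((h.exists_near (ε / 2) (by linarith)).and
    (Metric.tendsto_nhds.1 hx (ε / 2) (by linarith))).exists
  obtain ⟨y, hy, hd⟩ := h1 _ (hf n)
  exact ⟨y, hy, by linarith [dist_triangle_left x y (f n)]⟩

theorem exists_tendsto (h : HausdorffLimit X Z) (hX : ∀ n, IsCompact (X n))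
    (hne : ∀ n, (X n).Nonempty) {y : Sph2} (hy : y ∈ Z) :
    ∃ f : ℕ → Sph2, (∀ n, f n ∈ X n) ∧ Tendsto f atTop (𝓝 y) := by
  choose f hf hd using fun n => (hX n).exists_infDist_eq_dist (hne n) y
  refine ⟨f, hf, Metric.tendsto_nhds.2 fun ε hε => ?_⟩
  filter_upwards [h.exists_near' ε hε] with n hn
  obtain ⟨x, hx, hxy⟩ := hn y hy
  rw [dist_comm, ← hd]
  exact (Metric.infDist_le_dist_of_mem hx).trans_lt (by rwa [dist_comm])

theorem eventually_notMem (h : HausdorffLimit X Z) (hZ : IsClosed Z) {x : Sph2} (hx : x ∉ Z) :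
    ∀ᶠ n in atTop, x ∉ X n := by
  obtain ⟨ε, hε, hb⟩ := Metric.isOpen_iff.1 hZ.isOpen_compl x hx
  filter_upwards [h.exists_near ε hε] with n hn hxn
  obtain ⟨y, hy, hd⟩ := hn x hxn
  exact hb (Metric.mem_ball'.2 hd) hy

end HausdorffLimit

namespace Axes

variable {c : Sph2} (A : Axes c) {X : ℕ → Set Sph2} {Z : Set Sph2}

theorem exists_tendsto_gn (h : HausdorffLimit X Z) (hX : ∀ n, IsSymmConvexDisk c (X n)) {a b : ℝ}
    (hab : A.gn a b ∈ Z) : ∃ f g : ℕ → ℝ, (∀ n, A.gn (f n) (g n) ∈ X n) ∧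
      Tendsto f atTop (𝓝 a) ∧ Tendsto g atTop (𝓝 b) := by
  obtain ⟨F, hF, hlim⟩ := h.exists_tendsto (fun n => (hX n).2.1.1)
    (fun n => ⟨c, center_mem (hX n)⟩) hab
  have h1 := ((A.continuousOn_gnomonic _ (A.gn_mem a b)).continuousAt
    ((isOpen_hemisphere c).mem_nhds (A.gn_mem a b))).tendsto.comp hlim
  rw [A.gn_div_u, A.gn_div_p] at h1
  refine ⟨_, _, fun n => ?_, (continuous_fst.tendsto _).comp h1, (continuous_snd.tendsto _).comp h1⟩
  simp only [Function.comp]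
  rw [A.gn_eq ((hX n).1 (hF n))]
  exact hF n

theorem gn_mem_of_tendsto (h : HausdorffLimit X Z) (hZ : IsClosed Z) {f g : ℕ → ℝ} {a b : ℝ}
    (hfg : ∀ n, A.gn (f n) (g n) ∈ X n) (hf : Tendsto f atTop (𝓝 a)) (hg : Tendsto g atTop (𝓝 b)) :
    A.gn a b ∈ Z := by
  have h1 : Tendsto (fun n => (f n, g n)) atTop (𝓝 (a, b)) := hf.prodMk_nhds hg
  have h2 := (A.continuous_gn.tendsto (a, b)).comp h1
  exact h.mem hZ hfg h2

theorem symCone_of_limit (h : HausdorffLimit X Z) (hZ : IsCompact Z) (hZS : Z ⊆ hemisphere c)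
    (hX : ∀ n, IsSymmConvexDisk c (X n)) : SymCone (A.cone Z) where
  pos h := h.1
  smul hr h := ⟨mul_pos hr h.1, by
    rw [mul_div_mul_left _ _ hr.ne', mul_div_mul_left _ _ hr.ne']; exact h.2⟩
  center := by
    rw [cone_one, gn_zero]
    exact h.mem hZ.isClosed (fun n => center_mem (hX n)) tendsto_const_nhds
  neg := by
    rintro w s t ⟨hw, hm⟩
    obtain ⟨f, g, hfg, hf, hg⟩ := A.exists_tendsto_gn h hX hm
    refine ⟨hw, ?_⟩
    rw [neg_div, neg_div]
    refine A.gn_mem_of_tendsto h hZ.isClosed (fun n => ?_) hf.neg hg.neg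
    rw [← cone_one]
    exact (A.symCone (hX n)).neg ((A.cone_one _ _ _).2 (hfg n))
  add := by
    rintro w s t w' s' t' ⟨hw, hm⟩ ⟨hw', hm'⟩
    obtain ⟨f, g, hfg, hf, hg⟩ := A.exists_tendsto_gn h hX hm
    obtain ⟨f', g', hfg', hf', hg'⟩ := A.exists_tendsto_gn h hX hm'
    refine ⟨add_pos hw hw', ?_⟩
    have lim : ∀ {f f' : ℕ → ℝ} {x x' : ℝ}, Tendsto f atTop (𝓝 (x / w)) →
        Tendsto f' atTop (𝓝 (x' / w')) →
        Tendsto (fun n => (w * f n + w' * f' n) / (w + w')) atTop (𝓝 ((x + x') / (w + w'))) := by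
      intro f f' x x' h1 h2
      have := ((h1.const_mul w).add (h2.const_mul w')).div_const (w + w')
      rwa [mul_div_cancel₀ _ hw.ne', mul_div_cancel₀ _ hw'.ne'] at this
    refine A.gn_mem_of_tendsto h hZ.isClosed (fun n => ?_) (lim hf hf') (lim hg hg')
    have h1 := (A.cone_one _ _ _).2 (hfg n)
    have h2 := (A.cone_one _ _ _).2 (hfg' n)
    have := (A.symCone (hX n)).comb hw.le hw'.le (by linarith) h1 h2
    rw [mul_one, mul_one] at this
    exact this.2
  compact := A.isCompact_cone hZS hZ

/-- A convex set in the plane that contains points near the vertices of a square contains the centre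
of the square. -/
theorem _root_.mem_of_near_square {S : Set (ℝ × ℝ)} (hS : Convex ℝ S) (hS' : IsClosed S)
    {x y δ : ℝ} (hδ : 0 < δ)
    (h : ∀ σ : ℝ, |σ| = 1 → (∃ q ∈ S, |q.1 - (x + σ * δ)| < δ / 4 ∧ |q.2 - y| < δ / 4) ∧
      ∃ q ∈ S, |q.1 - x| < δ / 4 ∧ |q.2 - (y + σ * δ)| < δ / 4) : (x, y) ∈ S := by
  by_contra hxy
  obtain ⟨f, u, hf, hu⟩ := geometric_hahn_banach_closed_point hS hS' hxy
  have hlin : ∀ q : ℝ × ℝ, f q = q.1 * f (1, 0) + q.2 * f (0, 1) := fun q => by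
    have : q = q.1 • ((1, 0) : ℝ × ℝ) + q.2 • ((0, 1) : ℝ × ℝ) := by ext <;> simp
    conv_lhs => rw [this]
    rw [map_add, map_smul, map_smul, smul_eq_mul, smul_eq_mul]
  replace hf : ∀ q ∈ S, q.1 * f (1, 0) + q.2 * f (0, 1) < u := fun q hq => hlin q ▸ hf q hq
  replace hu : u < x * f (1, 0) + y * f (0, 1) := hlin (x, y) ▸ hu
  generalize f (1, 0) = α at hf hu
  generalize f (0, 1) = β at hf hu
  have bd : ∀ {e γ : ℝ}, |e| < δ / 4 → -(δ / 4 * |γ|) ≤ e * γ := fun {e γ} he => by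
    have h1 : |e| * |γ| ≤ δ / 4 * |γ| := by gcongr
    rw [← abs_mul] at h1
    exact (neg_le_neg h1).trans (neg_abs_le _)
  -- The signs select one vertex in each direction, where the separating functional exceeds its
  -- value at the centre by `δ * |α|` and `δ * |β|`. The errors of the two nearby points add up to
  -- at most half of the total gain.
  have sg : ∀ γ : ℝ, ∃ σ : ℝ, |σ| = 1 ∧ σ * γ = |γ| := fun γ => by
    rcases abs_choice γ with h | h
    · exact ⟨1, by simp, by rw [h, one_mul]⟩
    · exact ⟨-1, by simp, by rw [h, neg_one_mul]⟩
  obtain ⟨σ, hσ, e1⟩ := sg α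
  obtain ⟨τ, hτ, e2⟩ := sg β
  obtain ⟨q, hq, k1, k2⟩ := (h σ hσ).1
  obtain ⟨r, hr, k3, k4⟩ := (h τ hτ).2
  have i1 := hf q hq
  have i2 := hf r hr
  have j1 := bd (γ := α) k1
  have j2 := bd (γ := β) k2
  have j3 := bd (γ := α) k3
  have j4 := bd (γ := β) k4
  have t1 : σ * δ * α = δ * |α| := by rw [← e1]; ring
  have t2 : τ * δ * β = δ * |β| := by rw [← e2]; ring
  have p1 := mul_nonneg hδ.le (abs_nonneg α)
  have p2 := mul_nonneg hδ.le (abs_nonneg β)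
  linarith

/-- `Z` contains the vertices of a small square about `z`; eventually `X n` has points near all of
them, and its convexity gives `z` itself. -/
theorem eventually_mem_of_limit (h : HausdorffLimit X Z) (hZS : Z ⊆ hemisphere c)
    (hX : ∀ n, IsSymmConvexDisk c (X n)) {z : Sph2} (hz : z ∈ interior Z) :
    ∀ᶠ n in atTop, z ∈ X n := by
  obtain ⟨A⟩ := nonempty_axes c
  have hzS := hZS (interior_subset hz)
  obtain ⟨x, y, rfl⟩ : ∃ x y, z = A.gn x y := ⟨_, _, (A.gn_eq hzS).symm⟩
  have hnhds : (fun q : ℝ × ℝ => A.gn q.1 q.2) ⁻¹' Z ∈ 𝓝 (x, y) :=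
    A.continuous_gn.continuousAt (mem_interior_iff_mem_nhds.1 hz)
  obtain ⟨δ, hδ, hb⟩ := Metric.nhds_basis_closedBall.mem_iff.1 hnhds
  have near : ∀ {a b : ℝ}, A.gn a b ∈ Z → ∀ᶠ n in atTop, ∃ q ∈ {q : ℝ × ℝ | A.cone (X n) 1 q.1 q.2},
      |q.1 - a| < δ / 4 ∧ |q.2 - b| < δ / 4 := by
    intro a b hab
    obtain ⟨f, g, hfg, hf, hg⟩ := A.exists_tendsto_gn h hX hab
    filter_upwards [Metric.tendsto_nhds.1 hf (δ / 4) (by linarith),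
      Metric.tendsto_nhds.1 hg (δ / 4) (by linarith)] with n h1 h2
    exact ⟨(f n, g n), (A.cone_one _ _ _).2 (hfg n), h1, h2⟩
  have hmem : ∀ {a b : ℝ}, |a - x| ≤ δ → |b - y| ≤ δ → A.gn a b ∈ Z := by
    intro a b h1 h2
    refine hb (show (a, b) ∈ _ from ?_)
    rw [Metric.mem_closedBall, Prod.dist_eq]
    exact max_le h1 h2
  have hx1 : A.gn (x + 1 * δ) y ∈ Z := hmem (by simp [abs_of_pos hδ]) (by simp [hδ.le])
  have hx2 : A.gn (x + -1 * δ) y ∈ Z := hmem (by simp [abs_of_pos hδ]) (by simp [hδ.le])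
  have hy1 : A.gn x (y + 1 * δ) ∈ Z := hmem (by simp [hδ.le]) (by simp [abs_of_pos hδ])
  have hy2 : A.gn x (y + -1 * δ) ∈ Z := hmem (by simp [hδ.le]) (by simp [abs_of_pos hδ])
  filter_upwards [near hx1, near hx2, near hy1, near hy2] with n n1 n2 n3 n4
  have hC := A.symCone (hX n)
  refine (A.cone_one _ _ _).1 (mem_of_near_square (S := {q : ℝ × ℝ | A.cone (X n) 1 q.1 q.2})
    (A.convex_cone_one hC) hC.compact.isClosed hδ fun σ hσ => ?_)
  rcases eq_or_eq_neg_of_abs_eq hσ with rfl | rfl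
  · exact ⟨n1, n3⟩
  · exact ⟨n2, n4⟩

end Axes

namespace HausdorffLimit

variable {c : Sph2} {X : ℕ → Set Sph2} {Z : Set Sph2}

theorem disk_subset (h : HausdorffLimit X Z) (hZ : IsClosed Z) {κ : ℝ} (hX : ∀ n, disk c κ ⊆ X n) :
    disk c κ ⊆ Z := fun _ hx => h.mem hZ (fun n => hX n hx) tendsto_const_nhds

theorem subset_disk (h : HausdorffLimit X Z) (hX : ∀ n, IsSymmConvexDisk c (X n)) {κ : ℝ}
    (hκ : ∀ n, X n ⊆ disk c κ) : Z ⊆ disk c κ := by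
  intro z hz
  obtain ⟨f, hf, hlim⟩ := h.exists_tendsto (fun n => (hX n).2.1.1)
    (fun n => ⟨c, Axes.center_mem (hX n)⟩) hz
  exact (isClosed_disk c κ).mem_of_tendsto hlim (Eventually.of_forall fun n => hκ n (hf n))

/-- A Hausdorff limit of symmetric convex disks between two caps is a symmetric convex disk. -/
theorem isSymmConvexDisk (h : HausdorffLimit X Z) (hZ : IsCompact Z)
    (hX : ∀ n, IsSymmConvexDisk c (X n)) {κ κ' : ℝ} (hκ : 0 < κ) (hκ1 : κ < 1) (hκ' : 0 < κ')
    (h1 : ∀ n, disk c κ ⊆ X n) (h2 : ∀ n, X n ⊆ disk c κ') : IsSymmConvexDisk c Z := by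
  obtain ⟨A⟩ := nonempty_axes c
  have hZS : Z ⊆ hemisphere c := (h.subset_disk hX h2).trans (disk_subset_hemisphere hκ')
  refine A.isSymmConvexDisk_of_symCone hZS (A.symCone_of_limit h hZ hZS hX) ?_
  exact (isSymmConvexDisk_disk c hκ hκ1).2.1.2.2.mono
    (interior_mono (h.disk_subset hZ.isClosed h1))

/-- The indicators converge at interior points of `Z` and outside `Z`; the remaining boundary points
are null. -/
theorem tendsto_area_inter (h : HausdorffLimit X Z) (hZ : IsSymmConvexDisk c Z)
    (hX : ∀ n, IsSymmConvexDisk c (X n)) {Y : Set Sph2} (hY : MeasurableSet Y) :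
    Tendsto (fun n => area (X n ∩ Y)) atTop (𝓝 (area (Z ∩ Y))) := by
  obtain ⟨A⟩ := nonempty_axes c
  refine tendsto_measure_of_ae_tendsto_indicator_of_isFiniteMeasure atTop
    (hZ.2.1.1.measurableSet.inter hY) (fun n => (hX n).2.1.1.measurableSet.inter hY) ?_
  have h0 : ∀ᵐ x ∂(μHE[2] : Measure Sph2), x ∉ Z \ interior Z :=
    measure_eq_zero_iff_ae_notMem.1 (A.area_sdiff_interior hZ)
  filter_upwards [h0] with x hx
  by_cases hxZ : x ∈ Z
  · have hxi : x ∈ interior Z := by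
      by_contra h'
      exact hx ⟨hxZ, h'⟩
    filter_upwards [Axes.eventually_mem_of_limit h hZ.1 hX hxi] with n hn
    simp [hn, hxZ]
  · filter_upwards [h.eventually_notMem hZ.2.1.1.isClosed hxZ] with n hn
    simp [hn, hxZ]

theorem tendsto_hausdorffSDist (h : HausdorffLimit X Z) :
    Tendsto (fun n => hausdorffSDist (X n) Z) atTop (𝓝 0) := by
  rw [Metric.tendsto_nhds]
  intro ε hε
  have hε' : 0 < ε / π := by positivity
  filter_upwards [h.exists_near _ hε', h.exists_near' _ hε'] with n h1 h2
  have key : ∀ {x y : Sph2}, dist x y < ε / π → sdist x y ≤ ε / 2 := by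
    intro x y hd
    refine (sdist_le x y).trans ?_
    calc π / 2 * dist x y ≤ π / 2 * (ε / π) := by gcongr
      _ = ε / 2 := by field_simp
  have hle : hausdorffSDist (X n) Z ≤ ε / 2 := by
    refine csInf_le ⟨0, fun r hr => hr.1⟩ ⟨by positivity, fun x hx => ?_, fun y hy => ?_⟩
    · obtain ⟨y, hy, hd⟩ := h1 x hx
      exact ⟨y, hy, key hd⟩
    · obtain ⟨x, hx, hd⟩ := h2 y hy
      exact ⟨x, hx, key hd⟩
  have h0 : 0 ≤ hausdorffSDist (X n) Z := Real.sInf_nonneg fun r hr => hr.1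
  rw [Real.dist_eq, sub_zero, abs_of_nonneg h0]
  linarith

end HausdorffLimit

end Sph2
end

/-! ### The extremal argument. -/

noncomputable section

open Real Set Filter Topology MeasureTheory

namespace Sph2

/-- Every sequence of nonempty compact sets has a subsequence that converges in the Hausdorff
metric. -/
theorem exists_hausdorffLimit {X : ℕ → Set Sph2} (hX : ∀ n, IsCompact (X n))
    (hne : ∀ n, (X n).Nonempty) : ∃ Z : Set Sph2, IsCompact Z ∧ ∃ φ : ℕ → ℕ, StrictMono φ ∧
      HausdorffLimit (fun n => X (φ n)) Z := by
  obtain ⟨Z, φ, hφ, hlim⟩ := CompactSpace.tendsto_subseq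
    (fun n => (⟨⟨X n, hX n⟩, hne n⟩ : TopologicalSpace.NonemptyCompacts Sph2))
  have hfin : ∀ n, Metric.hausdorffEDist (X (φ n)) (Z : Set Sph2) ≠ ⊤ := fun n =>
    Metric.hausdorffEDist_ne_top_of_nonempty_of_bounded (hne _) Z.nonempty (hX _).isBounded
      Z.isCompact.isBounded
  refine ⟨Z, Z.isCompact, φ, hφ, ⟨fun ε hε => ?_, fun ε hε => ?_⟩⟩
  · filter_upwards [Metric.tendsto_nhds.1 hlim ε hε] with n hn x hx
    exact Metric.exists_dist_lt_of_hausdorffDist_lt hx hn (hfin n)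
  · filter_upwards [Metric.tendsto_nhds.1 hlim ε hε] with n hn y hy
    exact Metric.exists_dist_lt_of_hausdorffDist_lt' hy hn (hfin n)

/-- The symmetric convex disks obtained from `K` that lie between two caps. -/
structure Reachable (c : Sph2) (K : Set Sph2) (κ κ' : ℝ) (X : Set Sph2) : Prop where
  obtainable : Obtainable c K X
  isSymmConvexDisk : IsSymmConvexDisk c X
  disk_subset : disk c κ ⊆ X
  subset_disk : X ⊆ disk c κ'
  area_eq : area X = area K

theorem Reachable.steiner {c : Sph2} {K X : Set Sph2} {κ κ' : ℝ} (h : Reachable c K κ κ' X)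
    (hκ : 0 < κ) (hκ1 : κ < 1) (A : Axes c) : Reachable c K κ κ' (A.steiner X) := by
  have hC := A.symCone h.isSymmConvexDisk
  have hS := A.isSymmConvexDisk_steiner h.isSymmConvexDisk hκ hκ1 h.disk_subset
  exact ⟨.step X A h.obtainable (A.applicable h.isSymmConvexDisk), hS,
    A.disk_subset_steiner hC hκ h.disk_subset, A.steiner_subset_disk hC h.subset_disk,
    (A.area_steiner h.isSymmConvexDisk hS).trans h.area_eq⟩

theorem exists_seq_tendsto_disk {c : Sph2} {K : Set Sph2} (hK : IsSymmConvexDisk c K) {ρ : ℝ}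
    (hρ : 0 < ρ) (hρ1 : ρ < 1) (ha : area (disk c ρ) = area K) :
    ∃ Km : ℕ → Set Sph2, (∀ m, IsSymmConvexDisk c (Km m) ∧ Obtainable c K (Km m)) ∧
      HausdorffLimit Km (disk c ρ) := by
  obtain ⟨κ, hκ, hκ1, hκK⟩ := exists_disk_subset hK
  obtain ⟨κ', hκ', -, hKκ'⟩ := exists_subset_disk hK
  set D := disk c ρ with hD
  have hDs : IsSymmConvexDisk c D := isSymmConvexDisk_disk c hρ hρ1
  have hDm : MeasurableSet D := hDs.2.1.1.measurableSet
  set V : Set ENNReal := (fun X => area (X ∩ D)) '' {X | Reachable c K κ κ' X} with hV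
  have hVne : V.Nonempty := ⟨_, K, ⟨.base, hK, hκK, hKκ', rfl⟩, rfl⟩
  obtain ⟨v, -, hv, hvV⟩ := exists_seq_tendsto_sSup hVne (OrderTop.bddAbove V)
  choose X hX hXv using hvV
  have hXs : ∀ n, IsSymmConvexDisk c (X n) := fun n => (hX n).isSymmConvexDisk
  obtain ⟨Z, hZc, φ, hφ, hlim⟩ := exists_hausdorffLimit (fun n => (hXs n).2.1.1)
    (fun n => ⟨c, Axes.center_mem (hXs n)⟩)
  have hZ := hlim.isSymmConvexDisk hZc (fun n => hXs (φ n)) hκ hκ1 hκ'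
    (fun n => (hX _).disk_subset) (fun n => (hX _).subset_disk)
  have hκZ := hlim.disk_subset hZc.isClosed (fun n => (hX (φ n)).disk_subset)
  have hZa : area Z = area K := by
    have h1 := hlim.tendsto_area_inter hZ (fun n => hXs (φ n)) MeasurableSet.univ
    simp only [inter_univ, (hX _).area_eq] at h1
    exact tendsto_nhds_unique h1 tendsto_const_nhds
  have hsup : sSup V = area (Z ∩ D) := by
    refine tendsto_nhds_unique (hv.comp hφ.tendsto_atTop) ?_
    have h1 := hlim.tendsto_area_inter hZ (fun n => hXs (φ n)) hDm
    exact h1.congr fun n => hXv (φ n)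
  refine ⟨_, fun m => ⟨hXs (φ m), (hX (φ m)).obtainable⟩, ?_⟩
  suffices hZD : Z = D by rwa [← hZD]
  by_contra hne
  have haZ : area Z = area D := hZa.trans ha.symm
  obtain ⟨x, hx⟩ := interior_sdiff_nonempty hZ hDs haZ hne
  obtain ⟨y, hy⟩ := interior_sdiff_nonempty hDs hZ haZ.symm (Ne.symm hne)
  -- Orthogonality to `c` makes `p` an admissible pole; orthogonality to `x - y` gives `x` and `y`
  -- the same latitude.
  obtain ⟨p, hp1, hp2⟩ := exists_orthogonal (c : EuclideanSpace ℝ (Fin 3))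
    ((x : EuclideanSpace ℝ (Fin 3)) - (y : EuclideanSpace ℝ (Fin 3)))
  obtain ⟨A, hA⟩ := exists_axes (c := c) (p := p) hp1
  have hxy : ip x A.p = ip y A.p := by
    rw [inner_sub_left, sub_eq_zero] at hp2
    rw [hA]
    exact hp2
  have hsZ := A.isSymmConvexDisk_steiner hZ hκ hκ1 hκZ
  have hsD : A.steiner D = D := A.steiner_disk hρ hρ1
  have hlt := A.area_inter_lt hZ hsZ hDs (hsD.symm ▸ hDs) hx hy hxy
  rw [hsD, ← hsup] at hlt
  -- `Z` need not be reachable, so the bound is proved with `X (φ n)`, whose symmetral is, and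
  -- passes to the limit in `area (X (φ n) ∩ Z)`. Adding `area Z` on both sides avoids subtraction
  -- in `ENNReal`.
  have hle : area (A.steiner Z ∩ D) + area Z ≤ sSup V + area Z := by
    refine le_of_tendsto' (x := atTop) (f := fun n => area (A.steiner Z ∩ D) + area (X (φ n) ∩ Z))
      ?_ fun n => ?_
    · have h1 := hlim.tendsto_area_inter hZ (fun n => hXs (φ n)) hZc.measurableSet
      rw [inter_self] at h1
      exact h1.const_add _
    · have hR := (hX (φ n)).steiner hκ hκ1 A
      have hmS := hR.isSymmConvexDisk.2.1.1.measurableSet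
      have h1 : area (X (φ n) ∩ Z) ≤ area (A.steiner (X (φ n)) ∩ A.steiner Z) :=
        A.area_inter_le (hXs _) hR.isSymmConvexDisk hZ hsZ
      have h2 : area (A.steiner (X (φ n)) ∩ D) ≤ sSup V := le_sSup ⟨_, hR, rfl⟩
      have h3 : area (A.steiner Z ∩ D) ≤
          area (A.steiner (X (φ n)) ∩ D) + area (A.steiner Z \ A.steiner (X (φ n))) := by
        refine (measure_mono ?_).trans (measure_union_le _ _)
        rintro z ⟨hz, hzD⟩
        by_cases hzX : z ∈ A.steiner (X (φ n))
        · exact Or.inl ⟨hzX, hzD⟩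
        · exact Or.inr ⟨hz, hzX⟩
      have h4 : area (A.steiner Z ∩ A.steiner (X (φ n))) +
          area (A.steiner Z \ A.steiner (X (φ n))) = area Z :=
        (measure_inter_add_sdiff _ hmS).trans (A.area_steiner hZ hsZ)
      calc area (A.steiner Z ∩ D) + area (X (φ n) ∩ Z)
          ≤ (sSup V + area (A.steiner Z \ A.steiner (X (φ n)))) +
            area (A.steiner Z ∩ A.steiner (X (φ n))) := by
              rw [inter_comm (A.steiner Z) (A.steiner (X (φ n)))]
              exact add_le_add (h3.trans (by gcongr)) h1
        _ = sSup V + area Z := by rw [← h4, add_assoc, add_comm (area (_ \ _))]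
  have hfin : area Z ≠ ⊤ := (measure_lt_top (μHE[2] : Measure Sph2) _).ne
  exact absurd hlt (not_lt.2 ((ENNReal.add_le_add_iff_right hfin).1 hle))

end Sph2

end

/-! ### Uniqueness of the radius and conclusion. -/

theorem mainTheorem9 (c : Sph2) (K : Set Sph2) (hK : Sph2.IsSymmConvexDisk c K) :
    ∃ r : ℝ, (0 < r ∧ r < Real.pi ∧ Sph2.area (Sph2.cap c r) = Sph2.area K) ∧
      (∀ s : ℝ, 0 < s → s < Real.pi → Sph2.area (Sph2.cap c s) = Sph2.area K → s = r) ∧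
      ∃ Km : ℕ → Set Sph2,
        (∀ m, Sph2.IsSymmConvexDisk c (Km m) ∧ Sph2.Obtainable c K (Km m)) ∧
        Filter.Tendsto (fun m => Sph2.hausdorffSDist (Km m) (Sph2.cap c r)) Filter.atTop
          (nhds 0) := by
  obtain ⟨ρ, hρ, hρ1, ha⟩ := Sph2.exists_area_disk_eq hK
  have hr0 : 0 < Real.arccos ρ := Real.arccos_pos.2 hρ1
  have hrpi : Real.arccos ρ < Real.pi := lt_of_le_of_lt (Real.arccos_le_pi_div_two.2 hρ.le)
    (by linarith [Real.pi_pos])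
  have hcap : Sph2.cap c (Real.arccos ρ) = Sph2.disk c ρ := by
    rw [Sph2.cap_eq_disk c hr0.le hrpi.le, Real.cos_arccos (by linarith) hρ1.le]
  rw [← hcap] at ha
  have mono : ∀ {s t : ℝ}, 0 < s → s < t → t < Real.pi → Sph2.area (Sph2.cap c s) <
      Sph2.area (Sph2.cap c t) := by
    intro s t hs hst ht
    rw [Sph2.cap_eq_disk c hs.le (by linarith), Sph2.cap_eq_disk c (by linarith) ht.le]
    exact Sph2.area_disk_lt c (Real.cos_lt_cos_of_nonneg_of_le_pi hs.le ht.le hst)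
      (Real.neg_one_le_cos _) (Real.cos_le_one _)
  refine ⟨Real.arccos ρ, ⟨hr0, hrpi, ha⟩, fun s hs0 hs1 hs => ?_, ?_⟩
  · rcases lt_trichotomy s (Real.arccos ρ) with h | h | h
    · exact absurd (hs.trans ha.symm) (mono hs0 h hrpi).ne
    · exact h
    · exact absurd (ha.trans hs.symm) (mono hr0 h hs1).ne
  · rw [hcap] at ha ⊢
    obtain ⟨Km, h1, h2⟩ := Sph2.exists_seq_tendsto_disk hK hρ hρ1 ha
    exact ⟨Km, h1, h2.tendsto_hausdorffSDist⟩
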